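/- Let $R$ be a discrete valuation ring and let $\mathcal X$ be a flat $R$-scheme. Let $\mathcal X^\dagger=(\mathcal X,\mathcal M_{\mathcal X})$ be the Zariski log scheme with the divisorial log structure of the special fibre, $\mathcal M_{\mathcal X}=\mathcal O_{\mathcal X}\cap j_*\mathcal O_{\mathcal X_\eta}^\times$, where $j:\mathcal X_\eta\to\mathcal X$ is the generic fibre. Write $\mathcal M^\sharp=\mathcal M/\mathcal O^\times$, and for $x\in\mathcal X$ let $I(x)\subseteq\mathcal O_{\mathcal X,x}$ be the ideal generated by $\mathcal M_{\mathcal X,x}\setminus\mathcal O_{\mathcal X,x}^\times$. Assume that $\mathcal X^\dagger$ is log regular: it is fs, and for every $x$ the ring $\mathcal O_{\mathcal X,x}/I(x)$ is a regular local ring with $\dim\mathcal O_{\mathcal X,x}=\dim\mathcal O_{\mathcal X,x}/I(x)+\operatorname{rank}_{\mathbf Z}(\mathcal M^\sharp_{\mathcal X,x})^{\mathrm{gp}}$. Let $F(\mathcal X)=\{x\in\mathcal X : I(x)=\mathfrak m_x\}$ be the fan of $\mathcal X^\dagger$, with the subspace topology and the restriction of $\mathcal M^\sharp_{\mathcal X}$,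 and let $\pi:(\mathcal X,\mathcal M_{\mathcal X}^\sharp)\to F(\mathcal X)$ be the characteristic morphism, which maps $x$ to the point corresponding to the prime ideal $I(x)$ of $\mathcal O_{\mathcal X,x}$. For $y\in F(\mathcal X)$ put $U(y)=\pi^{-1}(y)$. The height $h$ of a point of a fan is the dimension of the stalk of the structure sheaf of monoids at that point. Let $\varphi:F'\to F(\mathcal X)$ be a subdivision, i.e. a morphism of monoidal spaces such that $F'$ is an fs fan (locally isomorphic to the fan $\operatorname{Spec}P$ of an fs monoid $P$), the map $\mathcal M_{F(\mathcal X),\varphi(t)}^{\mathrm{gp}}\to\mathcal M_{F',t}^{\mathrm{gp}}$ is surjective for every $t\in F'$, and $\operatorname{Mor}(\operatorname{Spec}\mathbf N,F')\to\operatorname{Mor}(\operatorname{Spec}\mathbf N,F(\mathcal X))$ is injective. Let $\mathrm{Bl}_\varphi:\varphi^\star\mathcal X\to\mathcal X^\dagger$ be the log blow-up along $\varphi$, i.e. the final object among the fs log schemes $T$ equipped with a morphism $f:T\to\mathcal X^\dagger$ and a morphism of monoidal spaces $g:(T,\mathcal M_T^\sharp)\to F'$ such that $\varphi\circ g=\pi\circ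 f$; let $\rho:(\varphi^\star\mathcal X,\mathcal M^\sharp)\to F'$ be its structural morphism, and for $x'\in F'$ put $U(x')=\rho^{-1}(x')$. Let $x'\in F'$ and let $x\in\mathcal X$ be a point of $U(\varphi(x'))$, i.e. $\pi(x)=\varphi(x')$. Then $U(x')$ is locally closed in $\varphi^\star\mathcal X$, the heights $h(x')\le h(\varphi(x'))$ are finite, and, if $U(x')$ is given its reduced scheme structure, its scheme-theoretic intersection with the fibre $\mathrm{Bl}_\varphi^{-1}(x)$ (that is, the fibre over $x$ of $U(x')\to\mathcal X$) is isomorphic, as a $\kappa(x)$-scheme, to the split torus $$U(x')\cap\mathrm{Bl}_\varphi^{-1}(x)\;\cong\;\mathbf G_{m,\kappa(x)}^{\,h(\varphi(x'))-h(x')}.$$ -/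

import Mathlib

open AlgebraicGeometry CategoryTheory TopologicalSpace

universe u v w

namespace LogGeom

/-! ### Monoids -/

section Monoids

/-- A face of a commutative monoid `P`: a submonoid `S` such that `a * b ∈ S` implies `a ∈ S` (and
hence `b ∈ S`).  Faces are exactly the complements of the prime ideals of `P`. -/
def Face (P : Type u) [CommMonoid P] : Type u :=
  {S : Submonoid P // ∀ a b : P, a * b ∈ S → a ∈ S}

instance (P : Type u) [CommMonoid P] : PartialOrder (Face P) :=
  inferInstanceAs (PartialOrder {S : Submonoid P // ∀ a b : P, a * b ∈ S → a ∈ S})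

/-- The dimension of a monoid: the supremum of the lengths of chains of prime ideals (equivalently,
of their complements, the faces). -/
noncomputable def monoidDim (P : Type u) [CommMonoid P] : WithBot ℕ∞ :=
  Order.krullDim (Face P)

/-- A fine and saturated (fs) monoid: cancellative, finitely generated, and saturated, i.e. if
`x = a / b` in the group envelope satisfies `x ^ n ∈ P` for some `n > 0`, then `x ∈ P`. -/
structure IsFsMonoid (P : Type u) [CommMonoid P] : Prop where
  cancel : IsCancelMul P
  fg : Monoid.FG P
  saturated : ∀ (a b c : P) (n : ℕ), n ≠ 0 → a ^ n = b ^ n * c → ∃ d, a = b * d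

/-- The rank of the group envelope of a commutative monoid. -/
noncomputable def gpRank (P : Type u) [CommMonoid P] : ℕ :=
  Module.finrank ℤ (Additive (Algebra.GrothendieckGroup P))

/-- The map of group envelopes induced by a homomorphism of commutative monoids. -/
noncomputable def gpMap {P : Type u} {Q : Type v} [CommMonoid P] [CommMonoid Q] (f : P →* Q) :
    Algebra.GrothendieckGroup P →* Algebra.GrothendieckGroup Q :=
  Algebra.GrothendieckGroup.lift ((Algebra.GrothendieckGroup.of (M := Q)).comp f)

/-- For a monoid homomorphism `f : P →* Q`, the induced homomorphism `P/Pˣ →* Q/Qˣ`.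
(`Associates P` is the quotient of `P` by its group of units.) -/
def sharpMap {P : Type u} {Q : Type v} [CommMonoid P] [CommMonoid Q] (f : P →* Q) :
    Associates P →* Associates Q where
  toFun := Quotient.map f fun _ _ h => h.map f
  map_one' := by
    change Associates.mk (f 1) = 1
    rw [map_one]; rfl
  map_mul' a b := by
    refine Quotient.inductionOn₂ a b fun x y => ?_
    change Associates.mk (f (x * y)) = Associates.mk (f x) * Associates.mk (f y)
    rw [map_mul, Associates.mk_mul_mk]

@[simp] theorem sharpMap_mk {P : Type u} {Q : Type v} [CommMonoid P] [CommMonoid Q] (f : P →* Q)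
    (a : P) : sharpMap f (Associates.mk a) = Associates.mk (f a) := rfl

/-- The congruence on `P` attached to a face `S`, whose quotient is the sharp localisation
`P_S / (P_S)ˣ`, where `P_S = S⁻¹P`. -/
def faceCon {P : Type u} [CommMonoid P] (S : Face P) : Con P where
  r a b := ∃ s ∈ S.1, ∃ t ∈ S.1, a * s = b * t
  iseqv :=
    { refl := fun a => ⟨1, S.1.one_mem, 1, S.1.one_mem, rfl⟩
      symm := fun ⟨s, hs, t, ht, h⟩ => ⟨t, ht, s, hs, h.symm⟩
      trans := by
        rintro a b c ⟨s, hs, t, ht, h⟩ ⟨s', hs', t', ht', h'⟩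
        refine ⟨s * s', S.1.mul_mem hs hs', t' * t, S.1.mul_mem ht' ht, ?_⟩
        rw [← mul_assoc, h, mul_right_comm, h', mul_assoc] }
  mul' := by
    rintro a b c d ⟨s, hs, t, ht, h⟩ ⟨s', hs', t', ht', h'⟩
    refine ⟨s * s', S.1.mul_mem hs hs', t * t', S.1.mul_mem ht ht', ?_⟩
    rw [mul_mul_mul_comm, h, h', mul_mul_mul_comm]

end Monoids

/-! ### Sheaves of monoids -/

/-- A sheaf of commutative monoids on a topological space, given by its stalks together with, for
every open `U`, the submonoid of those families of germs over `U` that are sections (the espace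
étalé description of a sheaf).  The axiom `locality` says that sections restrict and glue, i.e.
that being a section is a local property; every germ comes from a section near the point, and two
sections with the same germ at a point agree near it. -/
structure MonoidSheaf (X : Type u) [TopologicalSpace X] where
  stalk : X → Type v
  [stalkMonoid : ∀ x, CommMonoid (stalk x)]
  sections : ∀ U : Opens X, Submonoid (∀ x : U, stalk x)
  locality : ∀ (U : Opens X) (s : ∀ x : U, stalk x),
    (∀ x ∈ U, ∃ (V : Opens X) (_ : x ∈ V) (t : ∀ y : V, stalk y), t ∈ sections V ∧
      ∀ (y : X) (hU : y ∈ U) (hV : y ∈ V), s ⟨y, hU⟩ = t ⟨y, hV⟩) → s ∈ sections U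
  exists_germ : ∀ (x : X) (m : stalk x), ∃ (U : Opens X) (hx : x ∈ U) (s : ∀ y : U, stalk y),
    s ∈ sections U ∧ s ⟨x, hx⟩ = m
  germ_eq : ∀ (U V : Opens X) (s : ∀ y : U, stalk y) (t : ∀ y : V, stalk y),
    s ∈ sections U → t ∈ sections V → ∀ (x : X) (hU : x ∈ U) (hV : x ∈ V),
    s ⟨x, hU⟩ = t ⟨x, hV⟩ → ∃ W : Opens X, x ∈ W ∧
      ∀ (y : X) (hU : y ∈ U) (hV : y ∈ V), y ∈ W → s ⟨y, hU⟩ = t ⟨y, hV⟩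

attribute [instance] MonoidSheaf.stalkMonoid

namespace MonoidSheaf

/-- The sheaf of monoids with given stalks whose sections are the families of germs that locally
belong to a given collection of basic families. -/
def ofBase {X : Type u} [TopologicalSpace X] (stalk : X → Type v) [∀ x, CommMonoid (stalk x)]
    (IsBase : ∀ U : Opens X, (∀ x : U, stalk x) → Prop)
    (one : IsBase ⊤ 1)
    (mul : ∀ (U V : Opens X) (s : ∀ x : U, stalk x) (t : ∀ x : V, stalk x), IsBase U s →
      IsBase V t → IsBase (U ⊓ V) fun x => s ⟨x, x.2.1⟩ * t ⟨x, x.2.2⟩)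
    (exists_germ : ∀ (x : X) (m : stalk x), ∃ (U : Opens X) (hx : x ∈ U) (s : ∀ y : U, stalk y),
      IsBase U s ∧ s ⟨x, hx⟩ = m)
    (germ_eq : ∀ (U V : Opens X) (s : ∀ y : U, stalk y) (t : ∀ y : V, stalk y),
      IsBase U s → IsBase V t → ∀ (x : X) (hU : x ∈ U) (hV : x ∈ V),
      s ⟨x, hU⟩ = t ⟨x, hV⟩ → ∃ W : Opens X, x ∈ W ∧
        ∀ (y : X) (hU : y ∈ U) (hV : y ∈ V), y ∈ W → s ⟨y, hU⟩ = t ⟨y, hV⟩) :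
    MonoidSheaf.{u, v} X where
  stalk := stalk
  sections U :=
    { carrier := {s | ∀ x ∈ U, ∃ (W V : Opens X) (_ : x ∈ W) (_ : x ∈ V) (t : ∀ y : V, stalk y),
        IsBase V t ∧ ∀ (y : X) (hU : y ∈ U) (hV : y ∈ V), y ∈ W → s ⟨y, hU⟩ = t ⟨y, hV⟩}
      one_mem' := fun _ _ => ⟨⊤, ⊤, trivial, trivial, 1, one, fun _ _ _ _ => rfl⟩
      mul_mem' := by
        intro s s' hs hs' x hx
        obtain ⟨W, V, hW, hV, t, ht, e⟩ := hs x hx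
        obtain ⟨W', V', hW', hV', t', ht', e'⟩ := hs' x hx
        refine ⟨W ⊓ W', V ⊓ V', ⟨hW, hW'⟩, ⟨hV, hV'⟩, _, mul V V' t t' ht ht',
          fun y hU hy hyW => ?_⟩
        rw [Pi.mul_apply, e y hU hy.1 hyW.1, e' y hU hy.2 hyW.2] }
  locality U s h x hx := by
    obtain ⟨V, hV, t, ht, e⟩ := h x hx
    obtain ⟨W, A, hW, hA, r, hr, e'⟩ := ht x hV
    exact ⟨W ⊓ V, A, ⟨hW, hV⟩, hA, r, hr,
      fun y hU hyA hy => (e y hU hy.2).trans (e' y hy.2 hyA hy.1)⟩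
  exists_germ x m := by
    obtain ⟨U, hx, s, hs, e⟩ := exists_germ x m
    exact ⟨U, hx, s, fun y hy => ⟨⊤, U, trivial, hy, s, hs, fun _ _ _ _ => rfl⟩, e⟩
  germ_eq U V s t hs ht x hU hV e := by
    obtain ⟨A', A, hA', hA, a, ha, ea⟩ := hs x hU
    obtain ⟨B', B, hB', hB, b, hb, eb⟩ := ht x hV
    obtain ⟨W, hW, h⟩ := germ_eq A B a b ha hb x hA hB
      (by rw [← ea x hU hA hA', ← eb x hV hB hB', e])
    refine ⟨W ⊓ ((A ⊓ B) ⊓ (A' ⊓ B')), ⟨hW, ⟨hA, hB⟩, hA', hB'⟩, fun y yU yV hy => ?_⟩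
    rw [ea y yU hy.2.1.1 hy.2.2.1, eb y yV hy.2.1.2 hy.2.2.2, h y _ _ hy.1]

/-- The inverse image `f⁻¹M` of a sheaf of monoids under a continuous map: the stalk at `x` is
the stalk of `M` at `f x`, and the sections are the families that are locally pulled back from
sections of `M`. -/
def pullback {X : Type u} {Y : Type w} [TopologicalSpace X] [TopologicalSpace Y]
    (f : C(X, Y)) (M : MonoidSheaf.{w, v} Y) : MonoidSheaf.{u, v} X :=
  ofBase (fun x => M.stalk (f x))
    (fun U s => ∃ (V : Opens Y) (hV : ∀ x ∈ U, f x ∈ V) (t : ∀ y : V, M.stalk y),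
      t ∈ M.sections V ∧ ∀ x : U, s x = t ⟨f x, hV x x.2⟩)
    ⟨⊤, fun _ _ => trivial, 1, (M.sections ⊤).one_mem, fun _ => rfl⟩
    (by
      rintro U V s t ⟨A, hA, a, ha, ea⟩ ⟨B, hB, b, hb, eb⟩
      refine ⟨A ⊓ B, fun x hx => ⟨hA x hx.1, hB x hx.2⟩,
        (fun y : ↥(A ⊓ B) => a ⟨y, y.2.1⟩) * (fun y : ↥(A ⊓ B) => b ⟨y, y.2.2⟩),
        Submonoid.mul_mem _ ?_ ?_, ?_⟩
      · exact M.locality _ _ fun x hx => ⟨A, hx.1, a, ha, fun _ _ _ => rfl⟩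
      · exact M.locality _ _ fun x hx => ⟨B, hx.2, b, hb, fun _ _ _ => rfl⟩
      · intro x
        simp only [Pi.mul_apply, ea, eb])
    (by
      intro x m
      obtain ⟨V, hV, t, ht, e⟩ := M.exists_germ (f x) m
      exact ⟨V.comap f, hV, fun y => t ⟨f y, y.2⟩, ⟨V, fun _ h => h, t, ht, fun _ => rfl⟩, e⟩)
    (by
      rintro U V s t ⟨A, hA, a, ha, ea⟩ ⟨B, hB, b, hb, eb⟩ x hU hV e
      obtain ⟨W, hW, h⟩ := M.germ_eq A B a b ha hb (f x) (hA x hU) (hB x hV)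
        (by rw [← ea ⟨x, hU⟩, ← eb ⟨x, hV⟩, e])
      exact ⟨W.comap f, hW, fun y yU yV hy => by rw [ea, eb]; exact h _ _ _ hy⟩)

/-- The sheaf `M^♯ = M/M^×`: its stalks are the quotients of the stalks of `M` by their units, and
its sections are the families that are locally induced by sections of `M`. -/
def sharp {X : Type u} [TopologicalSpace X] (M : MonoidSheaf.{u, v} X) : MonoidSheaf.{u, v} X :=
  ofBase (fun x => Associates (M.stalk x))
    (fun U s => ∃ t ∈ M.sections U, ∀ x : U, s x = Associates.mk (t x))
    ⟨1, (M.sections ⊤).one_mem, fun _ => rfl⟩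
    (by
      rintro U V s t ⟨a, ha, ea⟩ ⟨b, hb, eb⟩
      refine ⟨(fun y : ↥(U ⊓ V) => a ⟨y, y.2.1⟩) * (fun y : ↥(U ⊓ V) => b ⟨y, y.2.2⟩),
        Submonoid.mul_mem _ ?_ ?_, ?_⟩
      · exact M.locality _ _ fun x hx => ⟨U, hx.1, a, ha, fun _ _ _ => rfl⟩
      · exact M.locality _ _ fun x hx => ⟨V, hx.2, b, hb, fun _ _ _ => rfl⟩
      · intro x
        simp only [Pi.mul_apply, ea, eb, Associates.mk_mul_mk])
    (by
      intro x m
      obtain ⟨m, rfl⟩ := Associates.mk_surjective m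
      obtain ⟨V, hV, t, ht, e⟩ := M.exists_germ x m
      exact ⟨V, hV, fun y => Associates.mk (t y), ⟨t, ht, fun _ => rfl⟩, congrArg _ e⟩)
    (by
      rintro U V s t ⟨a, ha, ea⟩ ⟨b, hb, eb⟩ x hU hV e
      rw [ea, eb, Associates.mk_eq_mk_iff_associated] at e
      obtain ⟨c, hc⟩ := e
      obtain ⟨A, hA, p, hp, ep⟩ := M.exists_germ x (c : M.stalk x)
      obtain ⟨B, hB, q, hq, eq⟩ := M.exists_germ x ((c⁻¹ : (M.stalk x)ˣ) : M.stalk x)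
      -- products of sections, restricted to the intersections of their domains
      have key : ∀ (C D : Opens X) (c' : ∀ y : C, M.stalk y) (d' : ∀ y : D, M.stalk y),
          c' ∈ M.sections C → d' ∈ M.sections D →
          (fun y : ↥(C ⊓ D) => c' ⟨y, y.2.1⟩ * d' ⟨y, y.2.2⟩) ∈ M.sections (C ⊓ D) := by
        intro C D c' d' hc' hd'
        refine Submonoid.mul_mem (M.sections (C ⊓ D)) (x := fun y => c' ⟨y, y.2.1⟩)
          (y := fun y => d' ⟨y, y.2.2⟩) ?_ ?_
        · exact M.locality _ _ fun x hx => ⟨C, hx.1, c', hc', fun _ _ _ => rfl⟩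
        · exact M.locality _ _ fun x hx => ⟨D, hx.2, d', hd', fun _ _ _ => rfl⟩
      obtain ⟨W₁, hW₁, h₁⟩ := M.germ_eq (A ⊓ B) ⊤ _ 1 (key A B p q hp hq) (M.sections ⊤).one_mem x
        ⟨hA, hB⟩ trivial (by simp [ep, eq])
      obtain ⟨W₂, hW₂, h₂⟩ := M.germ_eq (U ⊓ A) V _ b (key U A a p ha hp) hb x ⟨hU, hA⟩ hV
        (by simpa [ep] using hc)
      refine ⟨(W₁ ⊓ W₂) ⊓ (A ⊓ B), ⟨⟨hW₁, hW₂⟩, hA, hB⟩, fun y yU yV hy => ?_⟩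
      rw [ea, eb, Associates.mk_eq_mk_iff_associated]
      have hu := h₁ y ⟨hy.2.1, hy.2.2⟩ trivial hy.1.1
      exact ⟨Units.mkOfMulEqOne _ _ hu, h₂ y ⟨yU, hy.2.1⟩ yV hy.1.2⟩)

end MonoidSheaf

/-! ### Monoidal spaces and fans -/

/-- A monoidal space: a topological space with a sheaf of commutative monoids. -/
structure MonoidalSpace where
  carrier : Type u
  [top : TopologicalSpace carrier]
  sheaf : MonoidSheaf.{u, u} carrier

namespace MonoidalSpace

instance : CoeSort MonoidalSpace.{u} (Type u) := ⟨carrier⟩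

instance (X : MonoidalSpace.{u}) : TopologicalSpace X := X.top

/-- The stalk of the structure sheaf of a monoidal space. -/
abbrev stalk (X : MonoidalSpace.{u}) (x : X) : Type u := X.sheaf.stalk x

/-- A morphism of monoidal spaces: a continuous map `f : X → Y` with a homomorphism of sheaves of
monoids `f⁻¹M_Y → M_X` that is local on the stalks. -/
@[ext]
structure Hom (X : MonoidalSpace.{u}) (Y : MonoidalSpace.{v}) where
  toFun : X → Y
  continuous : Continuous toFun
  stalkMap : ∀ x, Y.stalk (toFun x) →* X.stalk x
  isLocal : ∀ x m, IsUnit (stalkMap x m) → IsUnit m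
  map_sections : ∀ (V : Opens Y), ∀ s ∈ Y.sheaf.sections V,
    (fun x : V.comap ⟨toFun, continuous⟩ => stalkMap x (s ⟨toFun x, x.2⟩)) ∈
      X.sheaf.sections (V.comap ⟨toFun, continuous⟩)

instance (X : MonoidalSpace.{u}) (Y : MonoidalSpace.{v}) :
    CoeFun (Hom X Y) fun _ => X → Y := ⟨Hom.toFun⟩

/-- Composition of morphisms of monoidal spaces (`f.comp g` is `f` after `g`). -/
def Hom.comp {X : MonoidalSpace.{u}} {Y : MonoidalSpace.{v}} {Z : MonoidalSpace.{w}}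
    (f : Hom Y Z) (g : Hom X Y) : Hom X Z where
  toFun x := f (g x)
  continuous := f.continuous.comp g.continuous
  stalkMap x := (g.stalkMap x).comp (f.stalkMap (g x))
  isLocal _ _ h := f.isLocal _ _ (g.isLocal _ _ h)
  map_sections V s hs := g.map_sections _ _ (f.map_sections V s hs)

/-- An isomorphism of monoidal spaces: a homeomorphism that is bijective on all stalks. -/
structure Hom.IsIso {X : MonoidalSpace.{u}} {Y : MonoidalSpace.{v}} (f : Hom X Y) : Prop where
  isHomeomorph : IsHomeomorph f
  bijective : ∀ x, Function.Bijective (f.stalkMap x)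

/-- The monoidal space induced on a subset: the subspace topology and the restricted sheaf. -/
def restrict (X : MonoidalSpace.{u}) (Z : Set X) : MonoidalSpace.{u} where
  carrier := Z
  sheaf := X.sheaf.pullback ⟨Subtype.val, continuous_subtype_val⟩

end MonoidalSpace

/-- The topology on the set of faces (prime ideals) of `P`, with the sets
`D(a) = {S | a ∈ S}` as a basis. -/
instance (P : Type u) [CommMonoid P] : TopologicalSpace (Face P) :=
  TopologicalSpace.generateFrom {D | ∃ a : P, D = {S : Face P | a ∈ S.1}}

/-- The affine fan `Spec P` of a commutative monoid: the space of prime ideals of `P`, here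
represented by their complementary faces `S`, with the sheaf of monoids with stalks
`P_S / (P_S)ˣ`, whose sections are locally given by elements of `P`. -/
def specFan (P : Type u) [CommMonoid P] : MonoidalSpace.{u} where
  carrier := Face P
  sheaf := MonoidSheaf.ofBase (fun S : Face P => (faceCon S).Quotient)
    (fun U s => ∃ p : P, ∀ S : U, s S = (p : (faceCon S.1).Quotient))
    ⟨1, fun _ => rfl⟩
    (by
      rintro U V s t ⟨p, hp⟩ ⟨q, hq⟩
      exact ⟨p * q, fun S => congrArg₂ (· * ·) (hp ⟨S.1, S.2.1⟩) (hq ⟨S.1, S.2.2⟩)⟩)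
    (by
      intro S m
      obtain ⟨p, rfl⟩ := Con.mk'_surjective m
      exact ⟨⊤, trivial, fun _ => (p : (faceCon _).Quotient), ⟨p, fun _ => rfl⟩, rfl⟩)
    (by
      rintro U V s t ⟨p, hp⟩ ⟨q, hq⟩ S hU hV e
      rw [hp, hq] at e
      obtain ⟨a, ha, b, hb, h⟩ := (Con.eq _).1 e
      let D (c : P) : Opens (Face P) := ⟨{T : Face P | c ∈ T.1},
        TopologicalSpace.isOpen_generateFrom_of_mem ⟨c, rfl⟩⟩
      refine ⟨D a ⊓ D b, ⟨ha, hb⟩, fun T hU hV hT => ?_⟩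
      rw [hp, hq]
      exact (Con.eq _).2 ⟨a, hT.1, b, hT.2, h⟩)

/-- An fs fan: a monoidal space that is locally isomorphic to `Spec P` for fs monoids `P`. -/
def IsFsFan (F : MonoidalSpace.{u}) : Prop :=
  ∀ t : F, ∃ U : Opens F, t ∈ U ∧ ∃ (P : Type u) (_ : CommMonoid P), IsFsMonoid P ∧
    ∃ f : MonoidalSpace.Hom (F.restrict (U : Set F)) (specFan P), f.IsIso

/-- The height of a point of a fan: the dimension of the stalk at that point. -/
noncomputable def height (F : MonoidalSpace.{u}) (t : F) : WithBot ℕ∞ :=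
  monoidDim (F.stalk t)

/-- Subdivisions `φ : F' → F` of a fan `F` (not necessarily proper): `F'` is an fs fan, the maps
on the group envelopes of the stalks are surjective, and
`Mor(Spec ℕ, F') → Mor(Spec ℕ, F)` is injective. -/
structure IsSubdivision {F' F : MonoidalSpace.{u}} (φ : MonoidalSpace.Hom F' F) : Prop where
  isFsFan : IsFsFan F'
  gp_surjective : ∀ t : F', Function.Surjective (gpMap (φ.stalkMap t))
  injective : Function.Injective
    fun h : MonoidalSpace.Hom (specFan (Multiplicative ℕ)) F' => φ.comp h

/-! ### Log schemes -/

/-- A (Zariski) log scheme: a scheme `X` with a sheaf of monoids `M` and a homomorphism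
`α : M → 𝒪_X` of sheaves of monoids (given on stalks, and mapping sections to sections) that
induces an isomorphism `α⁻¹(𝒪_X^×) → 𝒪_X^×`. -/
structure LogScheme where
  X : Scheme.{u}
  M : MonoidSheaf.{u, u} X
  α : ∀ x, M.stalk x →* X.presheaf.stalk x
  α_sections : ∀ (U : X.Opens), ∀ s ∈ M.sections U, ∀ x ∈ U,
    ∃ (V : X.Opens) (_ : x ∈ V) (f : Γ(X, V)), ∀ (y : X) (hU : y ∈ U) (hV : y ∈ V),
      α y (s ⟨y, hU⟩) = X.presheaf.germ V y hV f
  existsUnique_unit : ∀ x (a : (X.presheaf.stalk x)ˣ), ∃! m : M.stalk x, α x m = a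

namespace LogScheme

theorem isUnit_of_isUnit_α (X : LogScheme.{u}) {x : X.X} {m : X.M.stalk x}
    (h : IsUnit (X.α x m)) : IsUnit m := by
  obtain ⟨a, ha⟩ := h
  obtain ⟨n, hn, -⟩ := X.existsUnique_unit x a⁻¹
  obtain ⟨e, -, he⟩ := X.existsUnique_unit x 1
  have h1 : m * n = e := he _ (by simp [hn, ← ha])
  have h2 : 1 = e := he _ (by simp)
  exact IsUnit.of_mul_eq_one n (h1.trans h2.symm)

/-- A morphism of log schemes: a morphism of schemes `f : T → X` and a homomorphism of sheaves of
monoids `f⁻¹M_X → M_T` (given on stalks, and mapping sections to sections) compatible with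
`f⁻¹𝒪_X → 𝒪_T`. -/
@[ext]
structure Hom (T X : LogScheme.{u}) where
  base : T.X ⟶ X.X
  stalkMap : ∀ t, X.M.stalk (base t) →* T.M.stalk t
  map_sections : ∀ (V : X.X.Opens), ∀ s ∈ X.M.sections V,
    (fun t : ↥(base ⁻¹ᵁ V) => stalkMap t (s ⟨base t, t.2⟩)) ∈ T.M.sections (base ⁻¹ᵁ V)
  α_stalkMap : ∀ t m, T.α t (stalkMap t m) = base.stalkMap t (X.α (base t) m)

theorem Hom.isUnit_of_isUnit_stalkMap {T X : LogScheme.{u}} (f : Hom T X) {t : T.X}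
    {m : X.M.stalk (f.base t)} (h : IsUnit (f.stalkMap t m)) : IsUnit m := by
  apply X.isUnit_of_isUnit_α
  have h' := h.map (T.α t)
  rw [f.α_stalkMap] at h'
  exact isUnit_of_map_unit (f.base.stalkMap t).hom _ h'

/-- Composition of morphisms of log schemes (`f.comp g` is `f` after `g`). -/
def Hom.comp {S T X : LogScheme.{u}} (f : Hom T X) (g : Hom S T) : Hom S X where
  base := g.base ≫ f.base
  stalkMap s := (g.stalkMap s).comp (f.stalkMap (g.base s))
  map_sections V s hs := g.map_sections _ _ (f.map_sections V s hs)
  α_stalkMap s m := by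
    rw [Scheme.Hom.stalkMap_comp]
    exact (g.α_stalkMap s _).trans (congrArg _ (f.α_stalkMap (g.base s) m))

/-- The monoidal space `(X, M_X^♯)` of a log scheme, with `M_X^♯ = M_X/𝒪_X^×`. -/
abbrev sharp (X : LogScheme.{u}) : MonoidalSpace.{u} where
  carrier := X.X
  sheaf := X.M.sharp

/-- The morphism `(T, M_T^♯) → (X, M_X^♯)` induced by a morphism of log schemes. -/
def Hom.sharp {T X : LogScheme.{u}} (f : Hom T X) : MonoidalSpace.Hom T.sharp X.sharp where
  toFun t := f.base t
  continuous := f.base.continuous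
  stalkMap t := sharpMap (f.stalkMap t)
  isLocal t m h := by
    obtain ⟨m, rfl⟩ := Associates.mk_surjective m
    exact Associates.isUnit_mk.2 (f.isUnit_of_isUnit_stalkMap (Associates.isUnit_mk.1 h))
  map_sections V s hs t ht := by
    obtain ⟨W, A, hW, hA, r, ⟨p, hp, ep⟩, e⟩ := hs (f.base t) ht
    exact ⟨f.base ⁻¹ᵁ W, f.base ⁻¹ᵁ A, hW, hA,
      fun y => Associates.mk (f.stalkMap y (p ⟨f.base y, y.2⟩)),
      ⟨_, f.map_sections A p hp, fun _ => rfl⟩, fun y yU yA yW => by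
        have := (e (f.base y) yU yA yW).trans (ep _)
        exact congrArg (sharpMap (f.stalkMap y)) this⟩

/-- A chart of the log structure on an open `U`: a homomorphism `β : P → M_X(U)` such that the
associated log structure `P^a = P ⊕_{β⁻¹(𝒪^×)} 𝒪_X^× → M_X|_U` is an isomorphism, spelled out on
stalks as surjectivity and injectivity of `(p, u) ↦ β(p)u`.  (The units of `M_{X,y}` are those of
`𝒪_{X,y}`.) -/
structure IsChart (X : LogScheme.{u}) (U : X.X.Opens) {P : Type u} [CommMonoid P]
    (β : P →* X.M.sections U) : Prop where
  surjective : ∀ (y : U) (m : X.M.stalk y), ∃ (p : P) (a : (X.M.stalk y)ˣ), (β p).1 y * a = m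
  injective : ∀ (y : U) (p q : P) (a b : (X.M.stalk y)ˣ), (β p).1 y * a = (β q).1 y * b →
    ∃ f g : P, IsUnit ((β f).1 y) ∧ IsUnit ((β g).1 y) ∧ p * f = q * g ∧
      a * (β g).1 y = b * (β f).1 y

/-- An fs log scheme: locally, the log structure has a chart by an fs monoid. -/
def IsFs (X : LogScheme.{u}) : Prop :=
  ∀ x : X.X, ∃ U : X.X.Opens, x ∈ U ∧ ∃ (P : Type u) (_ : CommMonoid P) (β : P →* X.M.sections U),
    IsFsMonoid P ∧ X.IsChart U β

/-- The ideal `I(x, M_X)` of `𝒪_{X,x}` generated by `M_{X,x} ∖ 𝒪_{X,x}^×`. -/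
noncomputable def logIdeal (X : LogScheme.{u}) (x : X.X) : Ideal (X.X.presheaf.stalk x) :=
  Ideal.span {a | ∃ m : X.M.stalk x, ¬ IsUnit m ∧ X.α x m = a}

/-- Log regularity: `X` is fs and, for every point `x`, the local ring `𝒪_{X,x}/I(x, M_X)` is
regular and `dim 𝒪_{X,x} = dim 𝒪_{X,x}/I(x, M_X) + rank (M_{X,x}^♯)^gp`. -/
structure IsLogRegular (X : LogScheme.{u}) : Prop where
  isFs : X.IsFs
  isRegularLocalRing : ∀ x, IsRegularLocalRing (X.X.presheaf.stalk x ⧸ X.logIdeal x)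
  dim_eq : ∀ x, ringKrullDim (X.X.presheaf.stalk x) =
    ringKrullDim (X.X.presheaf.stalk x ⧸ X.logIdeal x) + (gpRank (X.sharp.stalk x) : ℕ)

/-- The fan `F(X)`: the set of points `x` such that `I(x, M_X)` is the maximal ideal of `𝒪_{X,x}`,
with the subspace topology and the restriction of `M_X^♯`. -/
noncomputable def fan (X : LogScheme.{u}) : MonoidalSpace.{u} :=
  X.sharp.restrict {x : X.X | X.logIdeal x = IsLocalRing.maximalIdeal (X.X.presheaf.stalk x)}

/-- For `y ∈ F(X)` and `x ∈ X`: `y` is the image `π(x)` of `x` under the characteristic morphism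
`π : X → F(X)`, i.e. `y` is the point of `X` (a generisation of `x`) which corresponds to the prime
ideal `I(x, M_X)` of `𝒪_{X,x}`.  In other words, `x` lies in the stratum `U(y) = π⁻¹(y)`. -/
def IsCharPoint (X : LogScheme.{u}) (x : X.X) (y : X.fan) : Prop :=
  ∃ h : y.1 ⤳ x, X.logIdeal x =
    (IsLocalRing.maximalIdeal (X.X.presheaf.stalk y.1)).comap
      (X.X.presheaf.stalkSpecializes h).hom

/-- For a morphism of log schemes `f : T → X`, a morphism of monoidal spaces `φ : F' → F(X)` and a
morphism `g : (T, M_T^♯) → F'`: the square `φ ∘ g = π ∘ f^♯` of monoidal spaces commutes, where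
`π : (X, M_X^♯) → F(X)` is the characteristic morphism.  On points this says that
`π(f(t)) = φ(g(t))`.  The homomorphism `π⁻¹M_{F(X)} → M_X^♯` is the isomorphism that on stalks is
inverse to the cospecialisation maps `M_{X,x}^♯ → M_{X,π(x)}^♯ = M_{F(X),π(x)}`, `s_x ↦ s_{π(x)}`;
so on sheaves the condition says that, for a section `s` of `M_X` near `f(t)`, the germ of `s` at
`π(f(t))`, carried to `M_{T,t}^♯` by `φ` and `g`, is equal to the germ of `s` at `f(t)`, carried to
`M_{T,t}^♯` by `f`. -/
def IsCompatible {T X : LogScheme.{u}} {F' : MonoidalSpace.{u}} (φ : MonoidalSpace.Hom F' X.fan)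
    (f : Hom T X) (g : MonoidalSpace.Hom T.sharp F') : Prop :=
  ∀ t : T.X, X.IsCharPoint (f.base t) (φ (g t)) ∧
    ∀ (U : X.X.Opens), ∀ s ∈ X.M.sections U, ∀ (ht : f.base t ∈ U) (hy : (φ (g t)).1 ∈ U),
      g.stalkMap t (φ.stalkMap (g t) (Associates.mk (s ⟨(φ (g t)).1, hy⟩))) =
        Associates.mk (f.stalkMap t (s ⟨f.base t, ht⟩))

/-- The log blow-up `Y = φ^⋆X → X` along a subdivision `φ : F' → F(X)`: an fs log scheme `Y` with
a morphism `b : Y → X` and a morphism `ρ : (Y, M_Y^♯) → F'` such that `φ ∘ ρ = π ∘ b^♯`, which is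
universal, i.e. a final object, among all such triples. -/
structure IsLogBlowup {X Y : LogScheme.{u}} {F' : MonoidalSpace.{u}}
    (φ : MonoidalSpace.Hom F' X.fan) (b : Hom Y X) (ρ : MonoidalSpace.Hom Y.sharp F') : Prop where
  isFs : Y.IsFs
  isCompatible : IsCompatible φ b ρ
  existsUnique : ∀ (T : LogScheme.{u}) (f : Hom T X) (g : MonoidalSpace.Hom T.sharp F'),
    T.IsFs → IsCompatible φ f g → ∃! h : Hom T Y, b.comp h = f ∧ ρ.comp h.sharp = g

/-- A function `f` on an open `V` of `X` is invertible on `V ∩ U`. -/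
def IsUnitOn {X : Scheme.{u}} (U : X.Opens) {V : X.Opens} (f : Γ(X, V)) : Prop :=
  ∀ (y : X) (hy : y ∈ V), y ∈ U → IsUnit (X.presheaf.germ V y hy f)

/-- The product of the restrictions of two functions to the intersection of their domains. -/
def resMul {X : Scheme.{u}} {V W : X.Opens} (f : Γ(X, V)) (g : Γ(X, W)) : Γ(X, V ⊓ W) :=
  X.presheaf.map (homOfLE inf_le_left).op f * X.presheaf.map (homOfLE inf_le_right).op g

theorem germ_resMul {X : Scheme.{u}} {V W : X.Opens} (f : Γ(X, V)) (g : Γ(X, W)) (y : X)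
    (hy : y ∈ V ⊓ W) : X.presheaf.germ (V ⊓ W) y hy (resMul f g) =
      X.presheaf.germ V y hy.1 f * X.presheaf.germ W y hy.2 g := by
  rw [resMul, map_mul]
  exact congrArg₂ (· * ·) (X.presheaf.germ_res_apply (homOfLE inf_le_left) y hy f)
    (X.presheaf.germ_res_apply (homOfLE inf_le_right) y hy g)

theorem IsUnitOn.resMul {X : Scheme.{u}} {U V W : X.Opens} {f : Γ(X, V)} {g : Γ(X, W)}
    (hf : IsUnitOn U f) (hg : IsUnitOn U g) : IsUnitOn U (resMul f g) := by
  intro y hy hU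
  rw [germ_resMul]
  exact (hf y hy.1 hU).mul (hg y hy.2 hU)

theorem isUnitOn_one {X : Scheme.{u}} {U V : X.Opens} : IsUnitOn U (1 : Γ(X, V)) := by
  intro y hy _
  rw [map_one]
  exact isUnit_one

/-- The stalk at `x` of `𝒪_X ∩ j_*𝒪_U^×`, for an open `j : U → X`: the germs of functions `f` on a
neighbourhood `V` of `x` that are invertible on `V ∩ U`. -/
noncomputable def divisorialStalk (X : Scheme.{u}) (U : X.Opens) (x : X) : Submonoid (X.presheaf.stalk x) where
  carrier := {a | ∃ (V : X.Opens) (hx : x ∈ V) (f : Γ(X, V)),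
    IsUnitOn U f ∧ X.presheaf.germ V x hx f = a}
  one_mem' := ⟨⊤, trivial, 1, isUnitOn_one, map_one _⟩
  mul_mem' := by
    rintro _ _ ⟨V, hV, f, hf, rfl⟩ ⟨W, hW, g, hg, rfl⟩
    exact ⟨V ⊓ W, ⟨hV, hW⟩, resMul f g, hf.resMul hg, germ_resMul f g x _⟩

/-- The sheaf of monoids `𝒪_X ∩ j_*𝒪_U^×`, for an open `j : U → X`: its sections are given by the
functions that are invertible on `U`. -/
noncomputable def divisorialSheaf (X : Scheme.{u}) (U : X.Opens) : MonoidSheaf.{u, u} X :=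
  MonoidSheaf.ofBase (fun x => divisorialStalk X U x)
    (fun V s => ∃ f : Γ(X, V), IsUnitOn U f ∧
      ∀ y : V, (s y : X.presheaf.stalk y.1) = X.presheaf.germ V y.1 y.2 f)
    ⟨1, isUnitOn_one, fun _ => (map_one _).symm⟩
    (by
      rintro V W s t ⟨f, hf, ef⟩ ⟨g, hg, eg⟩
      refine ⟨resMul f g, hf.resMul hg, fun y => ?_⟩
      rw [germ_resMul]
      exact congrArg₂ (· * ·) (ef ⟨y.1, y.2.1⟩) (eg ⟨y.1, y.2.2⟩))
    (by
      rintro x ⟨_, V, hx, f, hf, rfl⟩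
      exact ⟨V, hx, fun y => ⟨X.presheaf.germ V y.1 y.2 f, V, y.2, f, hf, rfl⟩,
        ⟨f, hf, fun _ => rfl⟩, rfl⟩)
    (by
      rintro V V' s t ⟨f, hf, ef⟩ ⟨f', hf', ef'⟩ x hV hV' e
      have e' : X.presheaf.germ V x hV f = X.presheaf.germ V' x hV' f' :=
        (ef ⟨x, hV⟩).symm.trans ((congrArg Subtype.val e).trans (ef' ⟨x, hV'⟩))
      obtain ⟨W, hW, i, j, h⟩ := TopCat.Presheaf.germ_eq X.presheaf x hV hV' f f' e'
      refine ⟨W, hW, fun y yV yV' yW => Subtype.ext ?_⟩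
      refine (ef ⟨y, yV⟩).trans (Eq.trans ?_ (ef' ⟨y, yV'⟩).symm)
      have h₁ := X.presheaf.germ_res_apply i y yW f
      have h₂ := X.presheaf.germ_res_apply j y yW f'
      exact h₁.symm.trans ((congrArg _ h).trans h₂))

/-- The divisorial log structure `M_X = 𝒪_X ∩ j_*𝒪_U^× ⊆ 𝒪_X` for an open `j : U → X` (the
complement of the divisor). -/
noncomputable def divisorial (X : Scheme.{u}) (U : X.Opens) : LogScheme.{u} where
  X := X
  M := divisorialSheaf X U
  α x := (divisorialStalk X U x).subtype
  α_sections V s hs x hx := by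
    obtain ⟨W, A, hW, hA, r, ⟨f, hf, ef⟩, e⟩ := hs x hx
    refine ⟨A ⊓ W, ⟨hA, hW⟩, X.presheaf.map (homOfLE inf_le_left).op f, fun y yV yW => ?_⟩
    refine Eq.trans ?_ (X.presheaf.germ_res_apply (homOfLE inf_le_left) y yW f).symm
    exact (congrArg Subtype.val (e y yV yW.1 yW.2)).trans (ef ⟨y, yW.1⟩)
  existsUnique_unit x a := by
    obtain ⟨V, hx, f, hf⟩ := X.presheaf.exists_germ_eq (a : X.presheaf.stalk x)
    have hx' : x ∈ X.basicOpen f := by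
      rw [Scheme.mem_basicOpen X f x hx, hf]
      exact a.isUnit
    refine ⟨⟨a, X.basicOpen f, hx', X.presheaf.map (homOfLE (X.basicOpen_le f)).op f,
      fun y hy _ => ?_, ?_⟩, rfl, fun m hm => Subtype.ext hm⟩
    · have h := X.presheaf.germ_res_apply (homOfLE (X.basicOpen_le f)) y hy f
      exact h.symm ▸ (Scheme.mem_basicOpen X f y (X.basicOpen_le f hy)).1 hy
    · exact (X.presheaf.germ_res_apply (homOfLE (X.basicOpen_le f)) x hx' f).trans hf

end LogScheme

/-- For a scheme `𝒳` over a discrete valuation ring `R`, the log scheme `𝒳^†`: the scheme `𝒳` with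
the divisorial log structure induced by the special fibre (the preimage of the closed point). -/
noncomputable def dagger {R : Type u} [CommRing R] [IsLocalRing R] {𝒳 : Scheme.{u}}
    (q : 𝒳 ⟶ Spec (CommRingCat.of R)) : LogScheme.{u} :=
  LogScheme.divisorial 𝒳
    ⟨(q ⁻¹' {IsLocalRing.closedPoint R})ᶜ,
      ((IsLocalRing.isClosed_singleton_closedPoint R).preimage q.continuous).isOpen_compl⟩

/-! ### Reduced strata and tori -/

/-- The reduced closed subscheme supported on the closure of a subset `Z` of a scheme. -/
noncomputable def reducedClosure (Y : Scheme.{u}) (Z : Set Y) : Y.IdealSheafData :=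
  Scheme.IdealSheafData.vanishingIdeal ⟨closure Z, isClosed_closure⟩

/-- A locally closed subset `Z` of a scheme `Y` as an open subset of its closure.  (For a general
subset, this is the largest open subset of the closure that is contained in `Z`.) -/
noncomputable def openInClosure (Y : Scheme.{u}) (Z : Set Y) :
    (reducedClosure Y Z).subscheme.Opens :=
  ⟨interior ((reducedClosure Y Z).subschemeι ⁻¹' Z), isOpen_interior⟩

/-- A locally closed subset `Z` of a scheme `Y` with its reduced induced scheme structure. -/
noncomputable def reducedSubscheme (Y : Scheme.{u}) (Z : Set Y) : Scheme.{u} :=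
  (openInClosure Y Z).toScheme

/-- The immersion of a locally closed subset with its reduced induced scheme structure. -/
noncomputable def reducedSubschemeι (Y : Scheme.{u}) (Z : Set Y) : reducedSubscheme Y Z ⟶ Y :=
  (openInClosure Y Z).ι ≫ (reducedClosure Y Z).subschemeι

/-- The split torus `𝔾_m^r = Spec k[ℤ^r]` over `k`, as a `k`-scheme. -/
noncomputable def splitTorus (k : CommRingCat.{u}) (r : ℕ) : Over (Spec k) :=
  Over.mk (Spec.map (CommRingCat.ofHom (algebraMap k (AddMonoidAlgebra k (Fin r → ℤ)))))

end LogGeom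

namespace LogGeom

/-! ### The dimension of a sharp fine monoid -/

section Dimension

variable {N : Type u} [CommMonoid N]

/-! Let `N` be the stalk of the fan at `φ x'` and `P` the stalk of `F'` at `x'`; both are sharp fs
monoids.

Dimension. A sharp, cancellative, finitely generated monoid has dimension equal to the rank of its
group envelope (`monoidDim_eq_gpRank`): ranks increase strictly along chains of faces, and every
proper face is contained in a strictly larger one whose rank is at most one more. Since `N^gp →
P^gp` is a surjection of free groups of finite rank, `N^gp` is `P^gp ⊕ ℤ^r`, where `r` is the
difference of the two heights (`exists_splitting`).

From the stratum to the torus. As `x` lies in the stratum of `φ x'`, `N` is the quotient of `M_x` by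
its units, and this quotient map splits (`exists_section`). At a point `z` of `Y` over `x` and `x'`,
the composite `N → M_x → M_{Y,z}` extends to `P × ℤ^r` (`StratumChart.ext`): the divisibility this
needs can be tested modulo units, where it comes from `P`. The factor `ℤ^r` is sent to units, so it
gives invertible functions on the fibre of the stratum, hence a morphism to the torus.

From the torus to the stratum. The torus over `κ(x)` carries the hollow log structure `P ⊕ 𝒪^×`. The
splittings define a morphism from it to `X`, compatible with the constant map to `x'`, so the
universal property of the blow-up gives a morphism to `Y` landing in the stratum over `x`. The torus
is reduced, hence this morphism factors through the reduced stratum and through its fibre.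

The two morphisms are inverse to each other (`nonempty_iso_splitTorus`). The fibre, with the log
structure inherited from `Y`, maps to the hollow torus because every element of `P` other than `1`
becomes a function vanishing on the reduced stratum; uniqueness in the universal property then
identifies fibre → torus → `Y` with the inclusion. In the other direction the pulled-back characters
are computed directly (`torusUnit_of_comp_eq`). The blow-up is used only through its universal
property, and the fibre need not be known to be reduced beforehand. -/

theorem Face.lt_iff {S T : Face N} : S < T ↔ S.1 < T.1 := Iff.rfl

/-- The class of an element in the group envelope, written additively. -/
noncomputable def gpOf (N : Type u) [CommMonoid N] (a : N) :
    Additive (Algebra.GrothendieckGroup N) :=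
  Additive.ofMul (Algebra.GrothendieckGroup.of a)

theorem gpOf_mul (a b : N) : gpOf N (a * b) = gpOf N a + gpOf N b := by
  simp [gpOf, map_mul]

theorem gpOf_one : gpOf N 1 = 0 := by simp [gpOf]

theorem gpOf_pow (a : N) (n : ℕ) : gpOf N (a ^ n) = (n : ℤ) • gpOf N a := by
  simp [gpOf, map_pow]

theorem gpOf_injective [IsCancelMul N] : Function.Injective (gpOf N) := fun _ _ h =>
  Algebra.GrothendieckGroup.of_injective (Additive.ofMul.injective h)

theorem exists_gpOf_sub (x : Additive (Algebra.GrothendieckGroup N)) :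
    ∃ a b : N, x = gpOf N a - gpOf N b := by
  obtain ⟨⟨a, b⟩, h⟩ := (Localization.monoidOf (⊤ : Submonoid N)).surj x.toMul
  refine ⟨a, b, eq_sub_of_add_eq ?_⟩
  exact congrArg Additive.ofMul h

theorem finite_gp [Monoid.FG N] : Module.Finite ℤ (Additive (Algebra.GrothendieckGroup N)) := by
  rw [Module.Finite.iff_addGroup_fg]
  have : Monoid.FG (Algebra.GrothendieckGroup N) := inferInstance
  exact GroupFG.iff_add_fg.1 (Group.fg_iff_monoid_fg.2 this)

/-- The subgroup of the group envelope generated by a submonoid. -/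
noncomputable def gpSpan (S : Submonoid N) :
    Submodule ℤ (Additive (Algebra.GrothendieckGroup N)) :=
  Submodule.span ℤ (gpOf N '' S)

theorem gpOf_mem_gpSpan {S : Submonoid N} {a : N} (h : a ∈ S) : gpOf N a ∈ gpSpan S :=
  Submodule.subset_span ⟨a, h, rfl⟩

theorem exists_of_mem_gpSpan {S : Submonoid N} {x : Additive (Algebra.GrothendieckGroup N)}
    (h : x ∈ gpSpan S) : ∃ a ∈ S, ∃ b ∈ S, x = gpOf N a - gpOf N b := by
  induction h using Submodule.span_induction with
  | mem x h =>
    obtain ⟨a, ha, rfl⟩ := h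
    exact ⟨a, ha, 1, S.one_mem, by rw [gpOf_one, sub_zero]⟩
  | zero => exact ⟨1, S.one_mem, 1, S.one_mem, by simp⟩
  | add x y _ _ hx hy =>
    obtain ⟨a, ha, b, hb, rfl⟩ := hx
    obtain ⟨c, hc, d, hd, rfl⟩ := hy
    exact ⟨a * c, S.mul_mem ha hc, b * d, S.mul_mem hb hd, by rw [gpOf_mul, gpOf_mul]; abel⟩
  | smul n x _ hx =>
    obtain ⟨a, ha, b, hb, rfl⟩ := hx
    obtain ⟨k, rfl | rfl⟩ := n.eq_nat_or_neg
    · exact ⟨a ^ k, S.pow_mem ha k, b ^ k, S.pow_mem hb k, by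
        rw [gpOf_pow, gpOf_pow, smul_sub]⟩
    · exact ⟨b ^ k, S.pow_mem hb k, a ^ k, S.pow_mem ha k, by
        rw [gpOf_pow, gpOf_pow, smul_sub, neg_smul, neg_smul]; abel⟩

theorem gpSpan_mono {S T : Submonoid N} (h : S ≤ T) : gpSpan S ≤ gpSpan T :=
  Submodule.span_mono (Set.image_mono h)

/-- The rank of a face. -/
noncomputable def faceRank (S : Face N) : ℕ := Module.finrank ℤ (gpSpan S.1)

/-- Ranks add up along `V → W → W/V`, and a finitely generated group has rank zero only if it is
torsion. -/
theorem finrank_lt_of_not_isTorsion {A : Type*} [AddCommGroup A] [Module.Finite ℤ A]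
    {V W : Submodule ℤ A} (h : V ≤ W) {x : A} (hx : x ∈ W)
    (h' : ∀ n : ℤ, n ≠ 0 → n • x ∉ V) : Module.finrank ℤ V < Module.finrank ℤ W := by
  have e := Submodule.finrank_quotient_add_finrank (V.comap W.subtype)
  have e' := (Submodule.comapSubtypeEquivOfLe h).finrank_eq
  have : Module.finrank ℤ (W ⧸ V.comap W.subtype) ≠ 0 := by
    intro h0
    obtain ⟨n, hn, hnx⟩ := Module.finrank_eq_zero_iff.1 h0 (Submodule.Quotient.mk ⟨x, hx⟩)
    rw [← Submodule.Quotient.mk_smul, Submodule.Quotient.mk_eq_zero] at hnx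
    exact h' n hn hnx
  omega

theorem finrank_le_of_isTorsion {A : Type*} [AddCommGroup A] [Module.Finite ℤ A]
    {V W : Submodule ℤ A} (h : V ≤ W) (h' : ∀ x ∈ W, ∃ n : ℤ, n ≠ 0 ∧ n • x ∈ V) :
    Module.finrank ℤ W ≤ Module.finrank ℤ V := by
  have e := Submodule.finrank_quotient_add_finrank (V.comap W.subtype)
  have e' := (Submodule.comapSubtypeEquivOfLe h).finrank_eq
  have : Module.finrank ℤ (W ⧸ V.comap W.subtype) = 0 := by
    rw [Module.finrank_eq_zero_iff]
    intro y
    obtain ⟨⟨x, hx⟩, rfl⟩ := Submodule.Quotient.mk_surjective _ y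
    obtain ⟨n, hn, hnx⟩ := h' x hx
    refine ⟨n, hn, ?_⟩
    rw [← Submodule.Quotient.mk_smul, Submodule.Quotient.mk_eq_zero]
    exact hnx
  omega

/-- An element `t` of `T` outside `S` is not torsion modulo the span of `S`: a relation `t ^ k * b =
a` with `a`, `b` in `S` would put `t` into `S` by the face property. -/
theorem faceRank_strictMono [IsCancelMul N] [Monoid.FG N] :
    StrictMono (faceRank : Face N → ℕ) := by
  intro S T h
  have := finite_gp (N := N)
  obtain ⟨hle, t, ht, hts⟩ := SetLike.lt_iff_le_and_exists.1 (Face.lt_iff.1 h)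
  refine finrank_lt_of_not_isTorsion (gpSpan_mono hle) (gpOf_mem_gpSpan ht) fun n hn hx => hts ?_
  have hk : ∃ k : ℕ, k ≠ 0 ∧ (k : ℤ) • gpOf N t ∈ gpSpan S.1 := by
    refine ⟨n.natAbs, Int.natAbs_ne_zero.2 hn, ?_⟩
    obtain ⟨k, rfl | rfl⟩ := n.eq_nat_or_neg
    · simpa using hx
    · simpa using hx
  obtain ⟨k, hk0, hk⟩ := hk
  obtain ⟨a, ha, b, hb, e⟩ := exists_of_mem_gpSpan hk
  rw [← gpOf_pow, eq_sub_iff_add_eq, ← gpOf_mul] at e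
  have e' : t ^ k * b = a := gpOf_injective e
  obtain ⟨m, rfl⟩ := Nat.exists_eq_succ_of_ne_zero hk0
  refine S.2 t (t ^ m * b) ?_
  rw [← mul_assoc, ← pow_succ', e']
  exact ha

/-! ### Existence of larger faces of the next rank -/

/-- The elements some multiple of which lies, up to elements of `S`, in the submonoid generated
by `R`. -/
def divClosure (S : Submonoid N) (R : Set N) : Submonoid N where
  carrier := {v | ∃ k : ℕ, k ≠ 0 ∧ ∃ s ∈ S, ∃ s' ∈ S, ∃ r ∈ Submonoid.closure R,
    v ^ k * s = r * s'}
  one_mem' := ⟨1, one_ne_zero, 1, S.one_mem, 1, S.one_mem, 1, one_mem _, by simp⟩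
  mul_mem' := by
    rintro a b ⟨k, hk, s, hs, s', hs', r, hr, e⟩ ⟨l, hl, t, ht, t', ht', q, hq, e'⟩
    refine ⟨k * l, mul_ne_zero hk hl, s ^ l * t ^ k, S.mul_mem (S.pow_mem hs l) (S.pow_mem ht k),
      s' ^ l * t' ^ k, S.mul_mem (S.pow_mem hs' l) (S.pow_mem ht' k), r ^ l * q ^ k,
      mul_mem (pow_mem hr l) (pow_mem hq k), ?_⟩
    rw [mul_pow, mul_mul_mul_comm, mul_mul_mul_comm (r ^ l), ← mul_pow, ← mul_pow, ← e, ← e',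
      mul_pow, mul_pow, ← pow_mul, ← pow_mul, mul_comm l k]

theorem mem_divClosure_of_pow {S : Submonoid N} {R : Set N} {v : N} {k : ℕ} (hk : k ≠ 0) {s s' r : N}
    (hs : s ∈ S) (hs' : s' ∈ S) (hr : r ∈ divClosure S R) (e : v ^ k * s = r * s') :
    v ∈ divClosure S R := by
  obtain ⟨l, hl, t, ht, t', ht', q, hq, e'⟩ := hr
  refine ⟨k * l, mul_ne_zero hk hl, s ^ l * t, S.mul_mem (S.pow_mem hs l) ht, s' ^ l * t',
    S.mul_mem (S.pow_mem hs' l) ht', q, hq, ?_⟩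
  rw [← mul_assoc, pow_mul, ← mul_pow, e, mul_pow, mul_right_comm, e', mul_assoc, mul_comm t']

theorem closure_le_divClosure (S : Submonoid N) (R : Set N) :
    Submonoid.closure R ≤ divClosure S R := fun r hr =>
  ⟨1, one_ne_zero, 1, S.one_mem, 1, S.one_mem, r, hr, by simp⟩

/-- The face generated by a face `S` and an element. -/
def faceAdjoin (S : Face N) (c : N) : Face N :=
  ⟨{ carrier := {p | ∃ q, ∃ n : ℕ, ∃ s ∈ S.1, p * q = c ^ n * s}
     one_mem' := ⟨1, 0, 1, S.1.one_mem, by simp⟩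
     mul_mem' := by
       rintro a b ⟨q, n, s, hs, e⟩ ⟨q', n', s', hs', e'⟩
       refine ⟨q * q', n + n', s * s', S.1.mul_mem hs hs', ?_⟩
       rw [mul_mul_mul_comm, e, e', pow_add, mul_mul_mul_comm] },
   fun a b ⟨q, n, s, hs, e⟩ => ⟨b * q, n, s, hs, by rw [← mul_assoc, e]⟩⟩

/-- Such a set is found by minimising the cardinality: an element in the closure of the others could
be erased. Minimal sets play the role of generators of the extremal rays of the rational cone of `N`
modulo `S`. -/
theorem exists_minimal_divClosure_eq_top [Monoid.FG N] [DecidableEq N] (S : Submonoid N) :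
    ∃ R : Finset N, divClosure S (R : Set N) = ⊤ ∧
      ∀ c ∈ R, c ∉ divClosure S ((R.erase c : Finset N) : Set N) := by
  have hex : ∃ n : ℕ, ∃ R : Finset N, R.card = n ∧ divClosure S (R : Set N) = ⊤ := by
    obtain ⟨R, hR⟩ := (Monoid.FG.fg_top : (⊤ : Submonoid N).FG)
    exact ⟨R.card, R, rfl, top_le_iff.1 (hR ▸ closure_le_divClosure S _)⟩
  classical
  obtain ⟨R, hRc, hR⟩ := Nat.find_spec hex
  refine ⟨R, hR, ?_⟩
  intro c hc hmem
  refine Nat.find_min hex (m := (R.erase c).card) ?_ ⟨R.erase c, rfl, ?_⟩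
  · rw [← hRc]; exact Finset.card_erase_lt_of_mem hc
  · rw [eq_top_iff]
    intro v _
    obtain ⟨k, hk, s, hs, s', hs', r, hr, e⟩ : v ∈ divClosure S (R : Set N) := by
      rw [hR]; trivial
    refine mem_divClosure_of_pow hk hs hs' ?_ e
    refine (Submonoid.closure_le (S := divClosure S _)).2 ?_ hr
    intro d hd
    by_cases hdc : d = c
    · rw [hdc]; exact hmem
    · exact closure_le_divClosure _ _
        (Submonoid.subset_closure (Finset.mem_coe.2 (Finset.mem_erase.2 ⟨hdc, hd⟩)))

/-- By minimality `c` spans an extremal ray modulo `S`, so two elements whose product is a multiple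
of `c` modulo `S` lie rationally on that ray. The proof compares the exponents of `c` after both
factors are written through `R`. -/
theorem exists_zsmul_mem_sup [IsCancelMul N] [DecidableEq N] {S : Face N} {R : Finset N}
    (hR : divClosure S.1 (R : Set N) = ⊤) {c : N} (hc : c ∈ R)
    (hmin : c ∉ divClosure S.1 ((R.erase c : Finset N) : Set N)) :
    ∀ p ∈ (faceAdjoin S c).1, ∃ n : ℤ, n ≠ 0 ∧
      n • gpOf N p ∈ gpSpan S.1 ⊔ Submodule.span ℤ {gpOf N c} := by
  have hdec : ∀ r ∈ Submonoid.closure (R : Set N), ∃ n : ℕ,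
      ∃ ρ ∈ Submonoid.closure ((R.erase c : Finset N) : Set N), r = c ^ n * ρ := by
    intro r hr
    rw [← Finset.insert_erase hc, Finset.coe_insert, ← Set.singleton_union,
      Submonoid.closure_union, Submonoid.mem_sup] at hr
    obtain ⟨y, hy, z, hz, rfl⟩ := hr
    obtain ⟨n, rfl⟩ := Submonoid.mem_closure_singleton.1 hy
    exact ⟨n, z, hz, rfl⟩
  rintro p ⟨q, n, s, hs, e⟩
  obtain ⟨k, hk, a, ha, a', ha', r, hr, er⟩ : p ∈ divClosure S.1 (R : Set N) := by
    rw [hR]; trivial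
  obtain ⟨l, hl, b, hb, b', hb', t, ht, et⟩ : q ∈ divClosure S.1 (R : Set N) := by
    rw [hR]; trivial
  obtain ⟨i, ρ, hρ, rfl⟩ := hdec r hr
  obtain ⟨j, τ, hτ, rfl⟩ := hdec t ht
  -- This is `p * q = c ^ n * s` raised to the power `k * l`, with the expressions for `p ^ k` and
  -- `q ^ l` substituted.
  have E : c ^ (n * (k * l)) * (s ^ (k * l) * (a ^ l * b ^ k)) =
      c ^ (i * l + j * k) * (ρ ^ l * τ ^ k * (a' ^ l * b' ^ k)) := by
    calc _ = (p * q) ^ (k * l) * (a ^ l * b ^ k) := by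
          rw [e, mul_pow, ← pow_mul, mul_assoc]
      _ = (p ^ k * a) ^ l * (q ^ l * b) ^ k := by
          rw [mul_pow, mul_pow, mul_pow, ← pow_mul, ← pow_mul, mul_comm l k, mul_mul_mul_comm]
      _ = _ := by
          rw [er, et]
          simp only [mul_pow, ← pow_mul, pow_add]
          ac_rfl
  have hσ : s ^ (k * l) * (a ^ l * b ^ k) ∈ S.1 :=
    mul_mem (pow_mem hs _) (mul_mem (pow_mem ha _) (pow_mem hb _))
  have hσ' : a' ^ l * b' ^ k ∈ S.1 := mul_mem (pow_mem ha' _) (pow_mem hb' _)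
  have hρτ : ρ ^ l * τ ^ k ∈ Submonoid.closure ((R.erase c : Finset N) : Set N) :=
    mul_mem (pow_mem hρ _) (pow_mem hτ _)
  rcases lt_or_ge (i * l + j * k) (n * (k * l)) with hlt | hge
  -- Cancelling the smaller power of `c` leaves a positive power on the left, so a multiple of `c`
  -- is generated modulo `S` by the remaining elements of `R`.
  · exfalso
    obtain ⟨d, hd⟩ := Nat.exists_eq_add_of_lt hlt
    rw [hd, add_assoc, pow_add, mul_assoc] at E
    exact hmin ⟨d + 1, Nat.succ_ne_zero d, _, hσ, _, hσ', _, hρτ, mul_left_cancel E⟩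
  · obtain ⟨d, hd⟩ := Nat.exists_eq_add_of_le hge
    rw [hd, pow_add, mul_assoc] at E
    have E' := mul_left_cancel E
    obtain ⟨m, rfl⟩ := Nat.exists_eq_succ_of_ne_zero hl
    -- Now all of `c` on the left cancels, and `ρ` divides an element of `S`; positivity of `l`
    -- ensures that `ρ` really occurs.
    have hρS : ρ ∈ S.1 := by
      refine S.2 ρ (ρ ^ m * τ ^ k * (c ^ d * (a' ^ (m + 1) * b' ^ k))) ?_
      rw [E'] at hσ
      convert hσ using 1
      rw [Nat.succ_eq_add_one, pow_succ' ρ]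
      ac_rfl
    refine ⟨k, by exact_mod_cast hk, ?_⟩
    have : (k : ℤ) • gpOf N p = (gpOf N ρ + gpOf N a' - gpOf N a) + (i : ℤ) • gpOf N c := by
      rw [← gpOf_pow, ← gpOf_pow]
      have := congrArg (gpOf N) er
      simp only [gpOf_mul] at this
      rw [eq_sub_of_add_eq this]
      abel
    rw [this]
    refine Submodule.add_mem_sup ?_ (Submodule.smul_mem _ _ (Submodule.mem_span_singleton_self _))
    exact sub_mem (add_mem (gpOf_mem_gpSpan hρS) (gpOf_mem_gpSpan ha')) (gpOf_mem_gpSpan ha)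

/-- Up to torsion the span of the new face is the span of `S` together with `c`, which is cyclic
modulo the span of `S`. -/
theorem faceRank_faceAdjoin_le [Monoid.FG N] {S : Face N} {c : N}
    (key : ∀ p ∈ (faceAdjoin S c).1, ∃ n : ℤ, n ≠ 0 ∧
      n • gpOf N p ∈ gpSpan S.1 ⊔ Submodule.span ℤ {gpOf N c}) :
    faceRank (faceAdjoin S c) ≤ faceRank S + 1 := by
  have := finite_gp (N := N)
  have hle : Module.finrank ℤ (gpSpan (faceAdjoin S c).1) ≤
      Module.finrank ℤ ↑(gpSpan S.1 ⊔ Submodule.span ℤ {gpOf N c}) := by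
    refine finrank_le_of_isTorsion (sup_le (gpSpan_mono ?_) ?_) ?_
    · exact fun s hs => ⟨1, 0, s, hs, by simp⟩
    · rw [Submodule.span_singleton_le_iff_mem]
      exact gpOf_mem_gpSpan ⟨1, 1, 1, S.1.one_mem, by simp⟩
    · intro x hx
      obtain ⟨a, ha, b, hb, rfl⟩ := exists_of_mem_gpSpan hx
      obtain ⟨m, hm, hma⟩ := key a ha
      obtain ⟨n, hn, hnb⟩ := key b hb
      refine ⟨m * n, mul_ne_zero hm hn, ?_⟩
      rw [smul_sub]
      refine sub_mem ?_ ?_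
      · rw [mul_comm, mul_smul]; exact Submodule.smul_mem _ _ hma
      · rw [mul_smul]; exact Submodule.smul_mem _ _ hnb
  have hle' : Module.finrank ℤ ↑(gpSpan S.1 ⊔ Submodule.span ℤ {gpOf N c}) ≤
      Module.finrank ℤ (gpSpan S.1) + 1 := by
    set V := gpSpan S.1
    set W := V ⊔ Submodule.span ℤ {gpOf N c} with hW
    have h := Submodule.finrank_quotient_add_finrank (LinearMap.ker (V.mkQ.comp W.subtype))
    rw [(LinearMap.quotKerEquivRange _).finrank_eq] at h
    have e : LinearMap.ker (V.mkQ.comp W.subtype) = V.comap W.subtype := by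
      rw [LinearMap.ker_comp, Submodule.ker_mkQ]
    have e' : LinearMap.range (V.mkQ.comp W.subtype) = Submodule.span ℤ {V.mkQ (gpOf N c)} := by
      rw [LinearMap.range_comp, Submodule.range_subtype, hW, Submodule.map_sup,
        Submodule.mkQ_map_self, bot_sup_eq, Submodule.map_span, Set.image_singleton]
    have h1 : Module.finrank ℤ (Submodule.span ℤ {V.mkQ (gpOf N c)}) ≤ 1 := by
      have := finrank_span_le_card (R := ℤ) ({V.mkQ (gpOf N c)} : Set (_ ⧸ V))
      rwa [Set.toFinset_singleton, Finset.card_singleton] at this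
    rw [e, (Submodule.comapSubtypeEquivOfLe (le_sup_left : V ≤ W)).finrank_eq, e'] at h
    omega
  exact hle.trans hle'

theorem exists_face_succ [IsCancelMul N] [Monoid.FG N] (S : Face N) (hS : S.1 ≠ ⊤) :
    ∃ T : Face N, S < T ∧ faceRank T ≤ faceRank S + 1 := by
  classical
  obtain ⟨R, hR, hmin⟩ := exists_minimal_divClosure_eq_top S.1
  obtain ⟨c, hc⟩ : R.Nonempty := by
    -- If no generator were needed, some positive power of each element would, up to factors from
    -- `S`, be trivial, and the face `S` would be everything.
    rw [Finset.nonempty_iff_ne_empty]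
    rintro rfl
    refine hS (eq_top_iff.2 fun v _ => ?_)
    obtain ⟨k, hk, s, hs, s', hs', r, hr, e⟩ : v ∈ divClosure S.1 ((∅ : Finset N) : Set N) := by
      rw [hR]; trivial
    rw [Finset.coe_empty, Submonoid.closure_empty, Submonoid.mem_bot] at hr
    obtain ⟨m, rfl⟩ := Nat.exists_eq_succ_of_ne_zero hk
    refine S.2 v (v ^ m * s) ?_
    rw [← mul_assoc, ← pow_succ', e, hr, one_mul]
    exact hs'
  have hcS : c ∉ S.1 := fun h => hmin c hc
    ⟨1, one_ne_zero, 1, S.1.one_mem, c, h, 1, one_mem _, by simp⟩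
  refine ⟨faceAdjoin S c, Face.lt_iff.2 (SetLike.lt_iff_le_and_exists.2 ⟨?_, c, ?_, hcS⟩),
    faceRank_faceAdjoin_le (exists_zsmul_mem_sup hR hc (hmin c hc))⟩
  · exact fun s hs => ⟨1, 0, s, hs, by simp⟩
  · exact ⟨1, 1, 1, S.1.one_mem, by simp⟩

/-- The rank function bounds the length of every chain. Conversely, starting from `{1}`, which is a
face by sharpness and has rank `0`, one climbs by steps of rank at most one until the whole monoid
is reached. -/
theorem monoidDim_eq_gpRank [IsCancelMul N] [Monoid.FG N]
    (sharp : ∀ a b : N, a * b = 1 → a = 1) : monoidDim N = (gpRank N : ℕ) := by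
  have := finite_gp (N := N)
  have htop : ∀ S : Face N, faceRank S ≤ gpRank N := fun S => Submodule.finrank_le _
  apply le_antisymm
  · refine iSup_le fun p => ?_
    have : StrictMono fun i : Fin (p.length + 1) => faceRank (p i) :=
      faceRank_strictMono.comp p.strictMono
    have h : p.length ≤ gpRank N := by
      have := (Fin.strictMono_iff_lt_succ.1 this)
      have h' : ∀ i : ℕ, ∀ hi : i < p.length + 1, i ≤ faceRank (p ⟨i, hi⟩) := by
        intro i
        induction i with
        | zero => exact fun _ => Nat.zero_le _
        | succ i ih =>
          intro hi
          exact Nat.succ_le_of_lt ((ih (by omega)).trans_lt (this ⟨i, by omega⟩))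
      exact (h' p.length (by omega)).trans (htop _)
    exact_mod_cast h
  · have chain : ∀ d : ℕ, ∀ S : Face N, gpRank N - faceRank S = d →
        ∃ p : LTSeries (Face N), p.head = S ∧ gpRank N ≤ faceRank S + p.length := by
      intro d
      induction d using Nat.strong_induction_on with
      | _ d ih =>
        intro S hd
        by_cases hS : S.1 = ⊤
        · refine ⟨RelSeries.singleton _ S, rfl, ?_⟩
          have : gpSpan S.1 = ⊤ := by
            rw [eq_top_iff]
            intro x _
            obtain ⟨a, b, rfl⟩ := exists_gpOf_sub x
            rw [hS]
            exact sub_mem (gpOf_mem_gpSpan trivial) (gpOf_mem_gpSpan trivial)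
          refine le_of_eq ?_
          rw [RelSeries.singleton_length, add_zero, faceRank,
            (LinearEquiv.ofEq _ _ this).finrank_eq, finrank_top]
          rfl
        · obtain ⟨T, hST, hT⟩ := exists_face_succ S hS
          have hlt := faceRank_strictMono hST
          obtain ⟨p, hp, hpl⟩ := ih _ (by have := htop T; omega) T rfl
          refine ⟨p.cons S (hp ▸ hST), RelSeries.head_cons _ _ _, ?_⟩
          rw [RelSeries.cons_length]
          omega
    let bot : Face N := ⟨⊥, fun a b h => sharp a b h⟩
    obtain ⟨p, -, hp⟩ := chain _ bot rfl
    have h0 : faceRank bot = 0 := by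
      have : gpSpan bot.1 = ⊥ := by
        rw [gpSpan, Submodule.span_eq_bot]
        rintro _ ⟨a, ha, rfl⟩
        rw [Submonoid.mem_bot.1 ha, gpOf_one]
      rw [faceRank, (LinearEquiv.ofEq _ _ this).finrank_eq, finrank_bot]
    rw [h0, zero_add] at hp
    exact le_trans (b := ((p.length : ℕ) : WithBot ℕ∞)) (by exact_mod_cast hp)
      (Order.LTSeries.length_le_krullDim p)

end Dimension

/-! ### Group envelopes, quotients by faces and splittings -/

section Splitting

/-- The quotient of an fs monoid by a face is fs and sharp. -/
theorem IsFsMonoid.of_face_quotient {P : Type u} {N : Type v} [CommMonoid P] [CommMonoid N]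
    (hP : IsFsMonoid P) (S : Face P) (π : P →* N) (hπ : Function.Surjective π)
    (h : ∀ p q, π p = π q ↔ ∃ f ∈ S.1, ∃ g ∈ S.1, p * f = q * g) :
    IsFsMonoid N ∧ ∀ a b : N, a * b = 1 → a = 1 := by
  have := hP.cancel
  have := hP.fg
  refine ⟨⟨?_, Monoid.fg_of_surjective π hπ, ?_⟩, ?_⟩
  · have : IsLeftCancelMul N := ⟨fun a b c e => by
      obtain ⟨a, rfl⟩ := hπ a
      obtain ⟨b, rfl⟩ := hπ b
      obtain ⟨c, rfl⟩ := hπ c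
      simp only [← map_mul] at e
      obtain ⟨f, hf, g, hg, e⟩ := (h _ _).1 e
      rw [mul_assoc, mul_assoc] at e
      exact (h _ _).2 ⟨f, hf, g, hg, mul_left_cancel e⟩⟩
    exact CommMagma.IsLeftCancelMul.toIsCancelMul N
  · intro a b c n hn e
    obtain ⟨a, rfl⟩ := hπ a
    obtain ⟨b, rfl⟩ := hπ b
    obtain ⟨c, rfl⟩ := hπ c
    simp only [← map_mul, ← map_pow] at e
    obtain ⟨f, hf, g, hg, e⟩ := (h _ _).1 e
    obtain ⟨m, rfl⟩ := Nat.exists_eq_succ_of_ne_zero hn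
    -- The factor `f ^ m` turns the left side of `e` into a full power of `a * f`, so that
    -- saturation of `P` applies.
    obtain ⟨d, hd⟩ := hP.saturated (a * f) b (c * g * f ^ m) (m + 1) (Nat.succ_ne_zero m) (by
      rw [mul_pow, pow_succ' f, ← mul_assoc, e]
      ac_rfl)
    refine ⟨π d, ?_⟩
    rw [← map_mul, ← hd, h]
    exact ⟨f, hf, 1, S.1.one_mem, by simp⟩
  · intro a b e
    obtain ⟨a, rfl⟩ := hπ a
    obtain ⟨b, rfl⟩ := hπ b
    rw [← map_mul, ← map_one π, h] at e
    obtain ⟨f, hf, g, hg, e⟩ := e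
    have : a ∈ S.1 := S.2 a (b * f) (by rw [← mul_assoc, e, one_mul]; exact hg)
    rw [← map_one π, h]
    exact ⟨1, S.1.one_mem, a, this, by simp⟩

/-- If `a ^ n = b ^ n`, saturation shows that `a` and `b` divide each other, and sharpness then
makes them equal. -/
theorem isTorsionFree_gp {N : Type u} [CommMonoid N] (hN : IsFsMonoid N)
    (sharp : ∀ a b : N, a * b = 1 → a = 1) :
    Module.IsTorsionFree ℤ (Additive (Algebra.GrothendieckGroup N)) := by
  have := hN.cancel
  have key : ∀ a b : N, ∀ n : ℕ, n ≠ 0 → a ^ n = b ^ n → a = b := by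
    intro a b n hn e
    obtain ⟨d, hd⟩ := hN.saturated a b 1 n hn (by rw [e, mul_one])
    obtain ⟨c, hc⟩ := hN.saturated b a 1 n hn (by rw [e, mul_one])
    have h1 : d * c = 1 := by
      rw [hd, mul_assoc] at hc
      exact (mul_left_cancel ((mul_one b).trans hc)).symm
    rw [hd, sharp d c h1, mul_one]
  refine Module.isTorsionFree_iff_smul_eq_zero.2 fun n x e => or_iff_not_imp_left.2 fun hn => ?_
  obtain ⟨a, b, rfl⟩ := exists_gpOf_sub x
  have e' : (n.natAbs : ℤ) • (gpOf N a - gpOf N b) = 0 := by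
    obtain ⟨k, rfl | rfl⟩ := n.eq_nat_or_neg
    · simpa using e
    · simpa using e
  rw [smul_sub, ← gpOf_pow, ← gpOf_pow, sub_eq_zero] at e'
  rw [key a b _ (Int.natAbs_ne_zero.2 hn) (gpOf_injective e'), sub_self]

theorem free_gp {N : Type u} [CommMonoid N] (hN : IsFsMonoid N)
    (sharp : ∀ a b : N, a * b = 1 → a = 1) :
    Module.Free ℤ (Additive (Algebra.GrothendieckGroup N)) := by
  have := hN.fg
  have := finite_gp (N := N)
  have := isTorsionFree_gp hN sharp
  infer_instance

/-- The map of group envelopes as a linear map. -/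
noncomputable def gpLinearMap {N : Type u} {P : Type v} [CommMonoid N] [CommMonoid P]
    (ψ : N →* P) : Additive (Algebra.GrothendieckGroup N) →ₗ[ℤ]
      Additive (Algebra.GrothendieckGroup P) :=
  (MonoidHom.toAdditive (gpMap ψ)).toIntLinearMap

theorem gpLinearMap_gpOf {N : Type u} {P : Type v} [CommMonoid N] [CommMonoid P]
    (ψ : N →* P) (a : N) : gpLinearMap ψ (gpOf N a) = gpOf P (ψ a) := by
  have : gpMap ψ (Algebra.GrothendieckGroup.of a) = Algebra.GrothendieckGroup.of (ψ a) :=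
    DFunLike.congr_fun (Algebra.GrothendieckGroup.lift.symm_apply_apply
      ((Algebra.GrothendieckGroup.of (M := P)).comp ψ)) a
  exact congrArg Additive.ofMul this

/-- The group envelope of `N` is the product of that of `P` and a free group. -/
theorem exists_splitting {N : Type u} {P : Type v} [CommMonoid N] [CommMonoid P]
    (hN : IsFsMonoid N) (sN : ∀ a b : N, a * b = 1 → a = 1)
    (hP : IsFsMonoid P) (sP : ∀ a b : P, a * b = 1 → a = 1)
    (ψ : N →* P) (hψ : Function.Surjective (gpMap ψ)) :
    ∃ (r : ℕ) (θ : N →* Multiplicative (Fin r → ℤ)), gpRank N = gpRank P + r ∧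
      Function.Injective (ψ.prod θ) ∧ ∀ q, ∃ a b, ψ.prod θ a = q * ψ.prod θ b := by
  have := hN.cancel
  have := hP.cancel
  have := hN.fg
  have := hP.fg
  have := finite_gp (N := N)
  have := finite_gp (N := P)
  have := free_gp hN sN
  have := free_gp hP sP
  have hg : Function.Surjective (gpLinearMap ψ) := hψ
  obtain ⟨s, hs⟩ := Module.projective_lifting_property (gpLinearMap ψ) LinearMap.id hg
  replace hs : ∀ y, gpLinearMap ψ (s y) = y := fun y => LinearMap.congr_fun hs y
  let L := LinearMap.ker (gpLinearMap ψ)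
  let e := (Module.finBasis ℤ L).equivFun
  let pr : Additive (Algebra.GrothendieckGroup N) →ₗ[ℤ] L :=
    (LinearMap.id - s.comp (gpLinearMap ψ)).codRestrict L fun x => by
      simp only [L, LinearMap.mem_ker, LinearMap.sub_apply, LinearMap.comp_apply, map_sub, hs,
        LinearMap.id_apply, sub_self]
  have hpr : ∀ x, (pr x : Additive (Algebra.GrothendieckGroup N)) = x - s (gpLinearMap ψ x) :=
    fun x => rfl
  let θ : N →* Multiplicative (Fin (Module.finrank ℤ L) → ℤ) :=
    { toFun := fun n => Multiplicative.ofAdd (e (pr (gpOf N n)))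
      map_one' := by rw [gpOf_one, map_zero, map_zero]; rfl
      map_mul' := fun a b => by rw [gpOf_mul, map_add, map_add]; rfl }
  refine ⟨_, θ, ?_, ?_, ?_⟩
  · have h := Submodule.finrank_quotient_add_finrank L
    rw [((gpLinearMap ψ).quotKerEquivOfSurjective hg).finrank_eq] at h
    exact h.symm
  · intro a b h
    have h1 : ψ a = ψ b := congrArg Prod.fst h
    have h2 : pr (gpOf N a) = pr (gpOf N b) :=
      e.injective (Multiplicative.ofAdd.injective (congrArg Prod.snd h))
    have h3 := congrArg Subtype.val h2
    rw [hpr, hpr, gpLinearMap_gpOf, gpLinearMap_gpOf, h1] at h3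
    exact gpOf_injective (sub_left_injective h3)
  · rintro ⟨p, l⟩
    -- This element of the group envelope has components `p` and `l`: the map induced by `ψ` kills
    -- `L` and inverts `s`, while `pr` kills the image of `s` and fixes `L`.
    obtain ⟨a, b, h⟩ := exists_gpOf_sub (s (gpOf P p) + (e.symm l.toAdd : L).1)
    refine ⟨a, b, Prod.ext ?_ ?_⟩
    · have h1 := congrArg (gpLinearMap ψ) h
      rw [map_add, hs, map_sub, gpLinearMap_gpOf, gpLinearMap_gpOf,
        LinearMap.mem_ker.1 (e.symm l.toAdd).2, add_zero, eq_sub_iff_add_eq, ← gpOf_mul] at h1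
      exact (gpOf_injective h1).symm
    · have h1 := congrArg pr h
      have h2 : pr (s (gpOf P p)) = 0 := Subtype.ext (by rw [hpr, hs, sub_self]; rfl)
      have h3 : pr (e.symm l.toAdd) = e.symm l.toAdd := Subtype.ext (by
        rw [hpr, LinearMap.mem_ker.1 (e.symm l.toAdd).2, map_zero, sub_zero])
      rw [map_add, h2, h3, zero_add, map_sub, eq_sub_iff_add_eq] at h1
      have h4 := congrArg e h1
      rw [map_add, LinearEquiv.apply_symm_apply] at h4
      exact congrArg Multiplicative.ofAdd h4.symm

/-- A quotient homomorphism by the units onto a sharp fs monoid splits. -/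
theorem exists_section {M : Type u} {N : Type v} [CommMonoid M] [CommMonoid N] [IsCancelMul M]
    (hN : IsFsMonoid N) (sN : ∀ a b : N, a * b = 1 → a = 1)
    (μ : M →* N) (hμ : Function.Surjective μ) (h : ∀ a b, μ a = μ b → Associated a b) :
    ∃ (σ : N →* M) (c : M →* Mˣ), (∀ n, μ (σ n) = n) ∧ ∀ m, m = σ (μ m) * c m := by
  have := hN.cancel
  have := hN.fg
  have := finite_gp (N := N)
  have := free_gp hN sN
  have hsurj : Function.Surjective (gpLinearMap μ) := by
    intro y
    obtain ⟨a, b, rfl⟩ := exists_gpOf_sub y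
    obtain ⟨a, rfl⟩ := hμ a
    obtain ⟨b, rfl⟩ := hμ b
    exact ⟨gpOf M a - gpOf M b, by rw [map_sub, gpLinearMap_gpOf, gpLinearMap_gpOf]⟩
  obtain ⟨s, hs⟩ := Module.projective_lifting_property (gpLinearMap μ) LinearMap.id hsurj
  replace hs : ∀ y, gpLinearMap μ (s y) = y := fun y => LinearMap.congr_fun hs y
  have key : ∀ n : N, ∃ m : M, μ m = n ∧ gpOf M m = s (gpOf N n) := by
    intro n
    obtain ⟨m, rfl⟩ := hμ n
    -- The section could take values outside `M`. However, `s (μ m)` differs from the lift `m` by a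
    -- fraction `a / b` with `μ a = μ b`; such a fraction is a unit of `M`, so correcting `m` by it
    -- realises `s (μ m)` inside `M`.
    obtain ⟨a, b, hab⟩ := exists_gpOf_sub (s (gpOf N (μ m)) - gpOf M m)
    have h1 := congrArg (gpLinearMap μ) hab
    rw [map_sub, hs, gpLinearMap_gpOf, sub_self, map_sub, gpLinearMap_gpOf, gpLinearMap_gpOf,
      eq_comm, sub_eq_zero] at h1
    obtain ⟨c, hc⟩ := h b a (gpOf_injective h1).symm
    have hmc : gpOf M (m * c) = s (gpOf N (μ m)) := by
      rw [← hc, gpOf_mul, add_sub_cancel_left] at hab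
      rw [gpOf_mul, ← hab, add_sub_cancel]
    refine ⟨m * c, ?_, hmc⟩
    have h2 := congrArg (gpLinearMap μ) hmc
    rw [hs, gpLinearMap_gpOf] at h2
    exact gpOf_injective h2
  choose f hf hf' using key
  let σ : N →* M :=
    { toFun := f
      map_one' := gpOf_injective (by rw [hf', gpOf_one, gpOf_one, map_zero])
      map_mul' := fun a b => gpOf_injective (by
        rw [hf', gpOf_mul, gpOf_mul, map_add, hf', hf']) }
  have hσ : ∀ n, μ (σ n) = n := hf
  have hc : ∀ m, ∃ c : Mˣ, σ (μ m) * c = m := fun m => h _ _ (hσ _)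
  choose c hc using hc
  refine ⟨σ, { toFun := c, map_one' := ?_, map_mul' := ?_ }, hσ, fun m => (hc m).symm⟩
  · refine Units.ext (mul_left_cancel (a := σ (μ 1)) ?_)
    rw [hc, map_one, map_one, one_mul, Units.val_one]
  · intro a b
    refine Units.ext (mul_left_cancel (a := σ (μ (a * b))) ?_)
    rw [hc, Units.val_mul, map_mul, map_mul, mul_mul_mul_comm, hc, hc]

/-- A homomorphism to a cancellative monoid extends along a homomorphism which is an isomorphism
on group envelopes, as soon as it does so elementwise. -/
theorem exists_extension {N : Type u} {Q : Type v} {M : Type w} [CommMonoid N] [CommMonoid Q]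
    [CommMonoid M] [IsCancelMul M] (ι : N →* Q) (hι : Function.Injective ι)
    (hs : ∀ q, ∃ a b, ι a = q * ι b) (f : N →* M)
    (hd : ∀ q a b, ι a = q * ι b → f b ∣ f a) :
    ∃ E : Q →* M, ∀ q a b, ι a = q * ι b → f a = E q * f b := by
  choose a b hab using hs
  choose e he using fun q => hd q _ _ (hab q)
  -- Independence of the chosen fraction: cross-multiplication of two fractions for `q` is an
  -- identity in `N` because `ι` is injective, and the target is cancellative.
  have key : ∀ q a b, ι a = q * ι b → f a = e q * f b := by
    intro q a' b' h
    have h1 : a' * b q = a q * b' := hι (by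
      rw [map_mul, map_mul, h, hab, mul_assoc, mul_assoc, mul_comm (ι b')])
    have h2 := congrArg f h1
    rw [map_mul, map_mul, he] at h2
    refine mul_right_cancel (b := f (b q)) (h2.trans ?_)
    ac_rfl
  have uniq : ∀ q m a b, ι a = q * ι b → f a = m * f b → e q = m := fun q m a b h h' =>
    mul_right_cancel ((key q a b h).symm.trans h')
  refine ⟨{ toFun := e, map_one' := ?_, map_mul' := ?_ }, key⟩
  · exact uniq 1 1 1 1 (by simp) (by simp)
  · intro q q'
    refine uniq _ _ (a q * a q') (b q * b q') ?_ ?_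
    · rw [map_mul, map_mul, hab, hab, mul_mul_mul_comm]
    · rw [map_mul, map_mul, he, he]
      ac_rfl

end Splitting

/-! ### Germs of sheaves of monoids -/

namespace MonoidSheaf

variable {X : Type u} [TopologicalSpace X] (M : MonoidSheaf.{u, v} X)

theorem restrict_mem {U V : Opens X} (h : V ≤ U) {s : ∀ x : U, M.stalk x}
    (hs : s ∈ M.sections U) : (fun x : V => s ⟨x, h x.2⟩) ∈ M.sections V :=
  M.locality _ _ fun _ hx => ⟨U, h hx, s, hs, fun _ _ _ => rfl⟩

/-- Every neighbourhood of `y` contains its generisation `x`, so sections agreeing near `y` agree at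
`x`. -/
theorem exists_cosp {x y : X} (h : x ⤳ y) (m : M.stalk y) :
    ∃ m' : M.stalk x, ∀ (U : Opens X) (s : ∀ z : U, M.stalk z), s ∈ M.sections U →
      ∀ (hx : x ∈ U) (hy : y ∈ U), s ⟨y, hy⟩ = m → s ⟨x, hx⟩ = m' := by
  obtain ⟨U, hy, s, hs, rfl⟩ := M.exists_germ y m
  refine ⟨s ⟨x, h.mem_open U.2 hy⟩, fun V t ht hx hyV e => ?_⟩
  obtain ⟨W, hW, hWe⟩ := M.germ_eq V U t s ht hs y hyV hy e
  exact hWe x _ _ (h.mem_open W.2 hW)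

/-- The cospecialisation homomorphism on stalks. -/
noncomputable def cosp {x y : X} (h : x ⤳ y) : M.stalk y →* M.stalk x where
  toFun m := (M.exists_cosp h m).choose
  map_one' := ((M.exists_cosp h 1).choose_spec ⊤ 1 (M.sections ⊤).one_mem trivial trivial rfl).symm
  map_mul' m n := by
    obtain ⟨U, hU, s, hs, rfl⟩ := M.exists_germ y m
    obtain ⟨V, hV, t, ht, rfl⟩ := M.exists_germ y n
    rw [← (M.exists_cosp h _).choose_spec U s hs (h.mem_open U.2 hU) hU rfl,
      ← (M.exists_cosp h _).choose_spec V t ht (h.mem_open V.2 hV) hV rfl]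
    exact ((M.exists_cosp h _).choose_spec (U ⊓ V) _
      (mul_mem (M.restrict_mem inf_le_left hs) (M.restrict_mem inf_le_right ht))
      (h.mem_open (U ⊓ V).2 ⟨hU, hV⟩) ⟨hU, hV⟩ rfl).symm

theorem cosp_section {x y : X} (h : x ⤳ y) {U : Opens X} {s : ∀ z : U, M.stalk z}
    (hs : s ∈ M.sections U) (hx : x ∈ U) (hy : y ∈ U) : M.cosp h (s ⟨y, hy⟩) = s ⟨x, hx⟩ :=
  ((M.exists_cosp h _).choose_spec U s hs hx hy rfl).symm

@[simp] theorem cosp_refl {x : X} (h : x ⤳ x) (m : M.stalk x) : M.cosp h m = m := by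
  obtain ⟨U, hU, s, hs, rfl⟩ := M.exists_germ x m
  exact M.cosp_section h hs hU hU

theorem cosp_cosp {x y z : X} (h : x ⤳ y) (h' : y ⤳ z) (m : M.stalk z) :
    M.cosp h (M.cosp h' m) = M.cosp (h.trans h') m := by
  obtain ⟨U, hU, s, hs, rfl⟩ := M.exists_germ z m
  have hy := h'.mem_open U.2 hU
  have hx := h.mem_open U.2 hy
  rw [M.cosp_section h' hs hy hU, M.cosp_section h hs hx hy, M.cosp_section _ hs hx hU]

/-- An invertible germ extends to a section consisting of invertible germs. -/
theorem exists_unit_section {x : X} (c : (M.stalk x)ˣ) : ∃ (U : Opens X) (hx : x ∈ U)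
    (s : ∀ y : U, (M.stalk y)ˣ), (fun y : U => (s y : M.stalk y)) ∈ M.sections U ∧
      (fun y : U => ((s y)⁻¹.1 : M.stalk y)) ∈ M.sections U ∧ s ⟨x, hx⟩ = c := by
  obtain ⟨A, hA, p, hp, ep⟩ := M.exists_germ x (c : M.stalk x)
  obtain ⟨B, hB, q, hq, eq⟩ := M.exists_germ x (c⁻¹.1 : M.stalk x)
  obtain ⟨W, hW, h⟩ := M.germ_eq (A ⊓ B) ⊤ _ 1
    (mul_mem (M.restrict_mem inf_le_left hp) (M.restrict_mem inf_le_right hq))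
    (M.sections ⊤).one_mem x ⟨hA, hB⟩ trivial (by simp [ep, eq])
  refine ⟨W ⊓ (A ⊓ B), ⟨hW, hA, hB⟩, fun y => Units.mkOfMulEqOne (p ⟨y, y.2.2.1⟩) (q ⟨y, y.2.2.2⟩)
    (h y y.2.2 trivial y.2.1), ?_, ?_, Units.ext ep⟩
  · exact M.restrict_mem (inf_le_right.trans inf_le_left) hp
  · exact M.restrict_mem (inf_le_right.trans inf_le_right) hq

theorem mk_mem_sharp {U : Opens X} {s : ∀ x : U, M.stalk x} (hs : s ∈ M.sections U) :
    (fun x : U => (Associates.mk (s x) : M.sharp.stalk x)) ∈ M.sharp.sections U :=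
  fun _ hx => ⟨⊤, U, trivial, hx, _, ⟨s, hs, fun _ => rfl⟩, fun _ _ _ _ => rfl⟩

end MonoidSheaf

theorem MonoidalSpace.Hom.ext_of_sections {X : MonoidalSpace.{u}} {Y : MonoidalSpace.{v}}
    {f g : MonoidalSpace.Hom X Y} (h : ∀ x, f x = g x)
    (h' : ∀ (x : X) (V : Opens Y), ∀ s ∈ Y.sheaf.sections V, ∀ (hf : f x ∈ V) (hg : g x ∈ V),
      f.stalkMap x (s ⟨f x, hf⟩) = g.stalkMap x (s ⟨g x, hg⟩)) : f = g := by
  obtain ⟨f, hf, fs, _, _⟩ := f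
  obtain ⟨g, hg, gs, _, _⟩ := g
  obtain rfl : f = g := funext h
  congr 1
  funext x
  ext m
  obtain ⟨V, hV, s, hs, rfl⟩ := Y.sheaf.exists_germ (f x) m
  exact h' x V s hs hV hV

namespace LogScheme

theorem Hom.ext_of_sections {T X : LogScheme.{u}} {f g : Hom T X} (h : f.base = g.base)
    (h' : ∀ (t : T.X) (V : X.X.Opens), ∀ s ∈ X.M.sections V, ∀ (hf : f.base t ∈ V)
      (hg : g.base t ∈ V), f.stalkMap t (s ⟨f.base t, hf⟩) = g.stalkMap t (s ⟨g.base t, hg⟩)) :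
    f = g := by
  obtain ⟨f, fs, _, _⟩ := f
  obtain ⟨g, gs, _, _⟩ := g
  obtain rfl : f = g := h
  congr 1
  funext x
  ext m
  obtain ⟨V, hV, s, hs, rfl⟩ := X.M.exists_germ (f x) m
  exact h' x V s hs hV hV

/-! ### Stalks of fs log schemes -/

section Chart

variable {X : LogScheme.{u}} {U : X.X.Opens} {P : Type u} [CommMonoid P]

/-- The face of a chart of elements that are invertible at a point. -/
def chartFace (β : P →* X.M.sections U) (y : U) : Face P :=
  ⟨(IsUnit.submonoid (X.M.stalk y)).comap
    (((Pi.evalMonoidHom (fun y : U => X.M.stalk y) y).comp (X.M.sections U).subtype).comp β),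
    fun a b h => by
      have h' : IsUnit ((β (a * b)).1 y) := h
      rw [map_mul] at h'
      exact isUnit_of_mul_isUnit_left h'⟩

theorem mem_chartFace {β : P →* X.M.sections U} {y : U} {p : P} :
    p ∈ (chartFace β y).1 ↔ IsUnit ((β p).1 y) := Iff.rfl

/-- This identifies `M_y^♯` with the quotient of `P` by the face of elements invertible at `y`,
which is the form required by `IsFsMonoid.of_face_quotient`. -/
theorem IsChart.mk_eq_mk_iff {β : P →* X.M.sections U} (h : X.IsChart U β) (y : U) (p q : P) :
    Associates.mk ((β p).1 y) = Associates.mk ((β q).1 y) ↔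
      ∃ f ∈ (chartFace β y).1, ∃ g ∈ (chartFace β y).1, p * f = q * g := by
  rw [Associates.mk_eq_mk_iff_associated]
  constructor
  · rintro ⟨c, hc⟩
    obtain ⟨f, g, hf, hg, e, -⟩ := h.injective y p q c 1 (by rw [hc, Units.val_one, mul_one])
    exact ⟨f, hf, g, hg, e⟩
  · rintro ⟨f, hf, g, hg, e⟩
    have e' := congrArg (fun a => (β a).1 y) e
    simp only [map_mul] at e'
    have hf' : IsUnit ((β f).1 y) := hf
    have hg' : IsUnit ((β g).1 y) := hg
    exact ((associated_mul_isUnit_right_iff (b := (β p).1 y) hf').2 (Associated.refl _)).trans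
      ((Associated.of_eq e').trans
        ((associated_mul_isUnit_left_iff hg').2 (Associated.refl _)))

theorem IsChart.associates {β : P →* X.M.sections U} (h : X.IsChart U β) (hP : IsFsMonoid P)
    (y : U) : IsFsMonoid (Associates (X.M.stalk y)) ∧
      ∀ a b : Associates (X.M.stalk y), a * b = 1 → a = 1 := by
  refine hP.of_face_quotient (chartFace β y) (Associates.mkMonoidHom.comp
    (((Pi.evalMonoidHom (fun y : U => X.M.stalk y) y).comp (X.M.sections U).subtype).comp β))
    ?_ (h.mk_eq_mk_iff y)
  intro m
  obtain ⟨m, rfl⟩ := Associates.mk_surjective m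
  obtain ⟨p, a, rfl⟩ := h.surjective y m
  exact ⟨p, Associates.mk_eq_mk_iff_associated.2 ⟨a, rfl⟩⟩

theorem IsChart.isCancelMul {β : P →* X.M.sections U} (h : X.IsChart U β) (hP : IsFsMonoid P)
    (y : U) : IsCancelMul (X.M.stalk y) := by
  have := hP.cancel
  have : IsLeftCancelMul (X.M.stalk y) := ⟨fun n m m' e => by
    obtain ⟨p, a, rfl⟩ := h.surjective y m
    obtain ⟨q, b, rfl⟩ := h.surjective y m'
    obtain ⟨r, c, rfl⟩ := h.surjective y n
    obtain ⟨f, g, hf, hg, e1, e2⟩ := h.injective y (r * p) (r * q) (c * a) (c * b) (by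
      simp only [map_mul, Submonoid.coe_mul, Pi.mul_apply, Units.val_mul]
      simp only at e
      rwa [mul_mul_mul_comm, mul_mul_mul_comm ((β r).1 y) ((c : _)) ((β q).1 y)] at e)
    rw [mul_assoc, mul_assoc] at e1
    have e3 := congrArg (fun a => (β a).1 y) (mul_left_cancel e1)
    simp only [map_mul, Submonoid.coe_mul, Pi.mul_apply] at e3
    simp only [Units.val_mul, mul_assoc] at e2
    have e4 := (Units.mul_right_inj c).1 e2
    -- Multiplication by this unit brings in both relations of the chart, the one in `P` and the one
    -- between units.
    refine (hf.mul hg).mul_left_injective (?_ : _ * _ = _ * _)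
    calc (β p).1 y * a * ((β f).1 y * (β g).1 y)
        = ((β p).1 y * (β f).1 y) * (a * (β g).1 y) := by ac_rfl
      _ = _ := by rw [e3, e4]; ac_rfl⟩
  exact CommMagma.IsLeftCancelMul.toIsCancelMul _

theorem IsFs.isCancelMul (h : X.IsFs) (x : X.X) : IsCancelMul (X.M.stalk x) := by
  obtain ⟨U, hx, P, _, β, hP, hβ⟩ := h x
  exact hβ.isCancelMul hP ⟨x, hx⟩

theorem IsFs.associates (h : X.IsFs) (x : X.X) : IsFsMonoid (Associates (X.M.stalk x)) ∧
    ∀ a b : Associates (X.M.stalk x), a * b = 1 → a = 1 := by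
  obtain ⟨U, hx, P, _, β, hP, hβ⟩ := h x
  exact hβ.associates hP ⟨x, hx⟩

/-- The homomorphism `M_x → M_y^♯` for a specialisation `y ⤳ x`. -/
noncomputable def charMap (X : LogScheme.{u}) {x y : X.X} (h : y ⤳ x) :
    X.M.stalk x →* Associates (X.M.stalk y) :=
  Associates.mkMonoidHom.comp (X.M.cosp h)

theorem charMap_section {x y : X.X} (h : y ⤳ x) {U : X.X.Opens} {s : ∀ z : U, X.M.stalk z}
    (hs : s ∈ X.M.sections U) (hx : x ∈ U) (hy : y ∈ U) :
    X.charMap h (s ⟨x, hx⟩) = Associates.mk (s ⟨y, hy⟩) :=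
  congrArg Associates.mk (X.M.cosp_section h hs hy hx)

/-- The cospecialisation maps of `α`. -/
theorem α_cosp {x y : X.X} (h : y ⤳ x) (m : X.M.stalk x) :
    X.α y (X.M.cosp h m) = X.X.presheaf.stalkSpecializes h (X.α x m) := by
  obtain ⟨U, hU, s, hs, rfl⟩ := X.M.exists_germ x m
  have hy := h.mem_open U.2 hU
  obtain ⟨V, hV, f, hf⟩ := X.α_sections U s hs x hU
  rw [X.M.cosp_section h hs hy hU, hf y hy (h.mem_open V.2 hV), hf x hU hV]
  exact (TopCat.Presheaf.germ_stalkSpecializes_apply X.X.presheaf hV h f).symm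

/-- A non-unit of `M_x` maps into the ideal `I(x)`, which by the choice of `y` is the preimage of
the maximal ideal at `y`; its image at `y` is therefore not invertible either. -/
theorem IsCharPoint.isUnit_of_isUnit_cosp {x : X.X} {y : X.fan} (h : X.IsCharPoint x y)
    {m : X.M.stalk x} (hm : IsUnit (X.M.cosp h.choose m)) : IsUnit m := by
  by_contra h'
  have h1 : X.α x m ∈ X.logIdeal x := Ideal.subset_span ⟨m, h', rfl⟩
  rw [h.choose_spec, Ideal.mem_comap, IsLocalRing.mem_maximalIdeal] at h1
  apply h1
  have := hm.map (X.α y.1)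
  rwa [α_cosp] at this

theorem IsCharPoint.charMap_surjective (hX : X.IsFs) {x : X.X} {y : X.fan}
    (h : X.IsCharPoint x y) : Function.Surjective (X.charMap h.choose) := by
  intro m
  obtain ⟨m, rfl⟩ := Associates.mk_surjective m
  obtain ⟨U, hx, P, _, β, hP, hβ⟩ := hX x
  have hy : y.1 ∈ U := h.choose.mem_open U.2 hx
  obtain ⟨p, a, rfl⟩ := hβ.surjective ⟨y.1, hy⟩ m
  refine ⟨(β p).1 ⟨x, hx⟩, ?_⟩
  rw [charMap_section _ (β p).2 hx hy]
  exact Associates.mk_eq_mk_iff_associated.2 ⟨a, rfl⟩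

/-- An element of a chart invertible at `y` is already invertible at `x`, so relations modulo the
face at `y` are relations modulo the face at `x`. With surjectivity, this gives `M_x^♯ ≅ M_y^♯`. -/
theorem IsCharPoint.associated_of_charMap_eq (hX : X.IsFs) {x : X.X} {y : X.fan}
    (h : X.IsCharPoint x y) {a b : X.M.stalk x} (e : X.charMap h.choose a = X.charMap h.choose b) :
    Associated a b := by
  obtain ⟨U, hx, P, _, β, hP, hβ⟩ := hX x
  have hy : y.1 ∈ U := h.choose.mem_open U.2 hx
  obtain ⟨p, c, rfl⟩ := hβ.surjective ⟨x, hx⟩ a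
  obtain ⟨q, d, rfl⟩ := hβ.surjective ⟨x, hx⟩ b
  have key : ∀ (p : P) (c : (X.M.stalk x)ˣ), X.charMap h.choose ((β p).1 ⟨x, hx⟩ * c) =
      Associates.mk ((β p).1 ⟨y.1, hy⟩) := by
    intro p c
    rw [map_mul, charMap_section _ (β p).2 hx hy]
    have : X.charMap h.choose (c : X.M.stalk x) = 1 :=
      Associates.mk_eq_one.2 (c.isUnit.map (X.M.cosp h.choose))
    rw [this, mul_one]
  rw [key, key, hβ.mk_eq_mk_iff ⟨y.1, hy⟩] at e
  have hface : ∀ f, f ∈ (chartFace β ⟨y.1, hy⟩).1 → f ∈ (chartFace β ⟨x, hx⟩).1 := by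
    intro f hf
    refine mem_chartFace.2 (h.isUnit_of_isUnit_cosp ?_)
    rw [X.M.cosp_section h.choose (β f).2 hy hx]
    exact hf
  obtain ⟨f, hf, g, hg, e⟩ := e
  have e' := (hβ.mk_eq_mk_iff ⟨x, hx⟩ p q).2 ⟨f, hface f hf, g, hface g hg, e⟩
  rw [Associates.mk_eq_mk_iff_associated] at e'
  exact ((associated_mul_unit_left _ _ c.isUnit).trans e').trans
    (associated_mul_unit_right _ _ d.isUnit)

end Chart
end LogScheme

/-! ### The structure sheaf of a scheme as a sheaf of monoids -/

section StructSheaf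

variable {S : Scheme.{u}}

theorem germ_ext {U : S.Opens} {f g : Γ(S, U)}
    (h : ∀ (x : S) (hx : x ∈ U), S.presheaf.germ U x hx f = S.presheaf.germ U x hx g) : f = g :=
  TopCat.Presheaf.section_ext S.sheaf U f g h

theorem exists_glue {U : S.Opens} (s : ∀ x : U, S.presheaf.stalk x.1)
    (h : ∀ x ∈ U, ∃ (V : S.Opens) (_ : x ∈ V) (f : Γ(S, V)),
      ∀ (y : S) (hU : y ∈ U) (hV : y ∈ V), s ⟨y, hU⟩ = S.presheaf.germ V y hV f) :
    ∃ f : Γ(S, U), ∀ x : U, s x = S.presheaf.germ U x.1 x.2 f := by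
  choose V hV f hf using h
  let W : U → S.Opens := fun x => V x.1 x.2 ⊓ U
  let fW : ∀ x : U, Γ(S, W x) := fun x => S.presheaf.map (homOfLE inf_le_left).op (f x.1 x.2)
  have hW : ∀ (x : U) (y : S) (hy : y ∈ W x), S.presheaf.germ (W x) y hy (fW x) = s ⟨y, hy.2⟩ := by
    intro x y hy
    rw [hf x.1 x.2 y hy.2 hy.1]
    exact S.presheaf.germ_res_apply (homOfLE inf_le_left) y hy (f x.1 x.2)
  obtain ⟨g, hg, -⟩ := TopCat.Sheaf.existsUnique_gluing' S.sheaf W U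
    (fun x => homOfLE inf_le_right) (fun x hx => by
      rw [Opens.mem_iSup]
      exact ⟨⟨x, hx⟩, hV x hx, hx⟩) fW (by
      intro x x'
      refine germ_ext fun y hy => ?_
      refine (S.presheaf.germ_res_apply (Opens.infLELeft _ _) y hy (fW x)).trans
        (Eq.trans ?_ (S.presheaf.germ_res_apply (Opens.infLERight _ _) y hy (fW x')).symm)
      rw [hW, hW])
  refine ⟨g, fun x => ?_⟩
  rw [← hW x x.1 ⟨hV x.1 x.2, x.2⟩, ← hg x]
  exact S.presheaf.germ_res_apply (homOfLE inf_le_right) x.1 _ g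

/-- The multiplicative monoid of the structure sheaf. -/
noncomputable def structSheaf (S : Scheme.{u}) : MonoidSheaf.{u, u} S where
  stalk x := S.presheaf.stalk x
  sections U :=
    { carrier := {s | ∃ f : Γ(S, U), ∀ x : U, s x = S.presheaf.germ U x.1 x.2 f}
      one_mem' := ⟨1, fun x => (map_one _).symm⟩
      mul_mem' := by
        rintro a b ⟨f, hf⟩ ⟨g, hg⟩
        exact ⟨f * g, fun x => by rw [Pi.mul_apply, hf, hg, map_mul]⟩ }
  locality U s h := exists_glue s fun x hx => by
    obtain ⟨V, hV, t, ⟨f, hf⟩, e⟩ := h x hx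
    exact ⟨V, hV, f, fun y hU hyV => (e y hU hyV).trans (hf ⟨y, hyV⟩)⟩
  exists_germ x m := by
    obtain ⟨V, hx, f, hf⟩ := S.presheaf.exists_germ_eq m
    exact ⟨V, hx, fun y => S.presheaf.germ V y.1 y.2 f, ⟨f, fun _ => rfl⟩, hf⟩
  germ_eq := by
    rintro U V s t ⟨f, hf⟩ ⟨g, hg⟩ x hU hV e
    rw [hf, hg] at e
    obtain ⟨W, hW, i, j, h⟩ := TopCat.Presheaf.germ_eq S.presheaf x hU hV f g e
    refine ⟨W, hW, fun y yU yV yW => ?_⟩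
    rw [hf, hg]
    have h₁ := S.presheaf.germ_res_apply i y yW f
    have h₂ := S.presheaf.germ_res_apply j y yW g
    exact h₁.symm.trans ((congrArg _ h).trans h₂)

theorem germ_mem_structSheaf {U : S.Opens} (f : Γ(S, U)) :
    (fun x : U => (S.presheaf.germ U x.1 x.2 f : (structSheaf S).stalk x.1)) ∈
      (structSheaf S).sections U := ⟨f, fun _ => rfl⟩

theorem structSheaf_pullback {T : Scheme.{u}} (i : T ⟶ S) {U : S.Opens}
    {s : ∀ x : U, S.presheaf.stalk x.1} (hs : s ∈ (structSheaf S).sections U) :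
    (fun t : ↥(i ⁻¹ᵁ U) => (i.stalkMap t.1 (s ⟨i t.1, t.2⟩) : T.presheaf.stalk t.1)) ∈
      (structSheaf T).sections (i ⁻¹ᵁ U) := by
  obtain ⟨f, hf⟩ := hs
  exact ⟨i.app U f, fun t => (congrArg (i.stalkMap t.1) (hf ⟨i t.1, t.2⟩)).trans
    (Scheme.Hom.germ_stalkMap_apply i U t.1 t.2 f)⟩

theorem exists_unit_germ {x : S} (c : (S.presheaf.stalk x)ˣ) :
    ∃ (U : S.Opens) (hx : x ∈ U) (s : ∀ y : U, (S.presheaf.stalk y.1)ˣ),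
      (fun y : U => (s y : S.presheaf.stalk y.1)) ∈ (structSheaf S).sections U ∧
      (fun y : U => ((s y)⁻¹.1 : S.presheaf.stalk y.1)) ∈ (structSheaf S).sections U ∧
      s ⟨x, hx⟩ = c :=
  (structSheaf S).exists_unit_section (x := x) c

theorem LogScheme.α_mem {X : LogScheme.{u}} {U : X.X.Opens} {s : ∀ x : U, X.M.stalk x}
    (hs : s ∈ X.M.sections U) :
    (fun x : U => (X.α x.1 (s x) : X.X.presheaf.stalk x.1)) ∈ (structSheaf X.X).sections U := by
  refine (structSheaf X.X).locality _ _ fun x hx => ?_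
  obtain ⟨V, hV, f, hf⟩ := X.α_sections U s hs x hx
  exact ⟨V, hV, _, germ_mem_structSheaf f, hf⟩

/-- The condition `α_sections` of a log scheme in terms of the sheaf `structSheaf`. -/
theorem exists_germ_of_mem {U : S.Opens} {s : ∀ x : U, S.presheaf.stalk x.1}
    (hs : s ∈ (structSheaf S).sections U) (x : S) (hx : x ∈ U) :
    ∃ (V : S.Opens) (_ : x ∈ V) (f : Γ(S, V)), ∀ (y : S) (hU : y ∈ U) (hV : y ∈ V),
      s ⟨y, hU⟩ = S.presheaf.germ V y hV f := by
  obtain ⟨f, hf⟩ := hs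
  exact ⟨U, hx, f, fun y hU _ => hf ⟨y, hU⟩⟩

end StructSheaf

/-! ### Hollow log structures -/

namespace LogScheme

/-- The sheaf of monoids `P ⊕ 𝒪_S^×`. -/
noncomputable def hollowSheaf (S : Scheme.{u}) (P : Type u) [CommMonoid P] :
    MonoidSheaf.{u, u} S :=
  MonoidSheaf.ofBase (fun t : S => P × (S.presheaf.stalk t)ˣ)
    (fun U s => ∃ p : P, (∀ y : U, (s y).1 = p) ∧
      (fun y : U => ((s y).2 : S.presheaf.stalk y.1)) ∈ (structSheaf S).sections U)
    ⟨1, fun _ => rfl, ((structSheaf S).sections ⊤).one_mem⟩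
    (by
      rintro U V s t ⟨p, hp, hs⟩ ⟨q, hq, ht⟩
      refine ⟨p * q, fun y => congrArg₂ (· * ·) (hp _) (hq _), ?_⟩
      exact mul_mem ((structSheaf S).restrict_mem inf_le_left hs)
        ((structSheaf S).restrict_mem inf_le_right ht))
    (by
      rintro x ⟨p, c⟩
      obtain ⟨U, hx, s, hs, -, e⟩ := exists_unit_germ c
      exact ⟨U, hx, fun y => (p, s y), ⟨p, fun _ => rfl, hs⟩, congrArg (Prod.mk p) e⟩)
    (by
      rintro U V s t ⟨p, hp, hs⟩ ⟨q, hq, ht⟩ x hU hV e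
      obtain ⟨W, hW, h⟩ := (structSheaf S).germ_eq U V _ _ hs ht x hU hV
        (congrArg (fun a => (a.2 : S.presheaf.stalk x)) e)
      refine ⟨W, hW, fun y yU yV yW => Prod.ext ?_ (Units.ext (h y yU yV yW))⟩
      rw [hp, hq, ← hp ⟨x, hU⟩, ← hq ⟨x, hV⟩, e])

open Classical in
/-- The homomorphism `P ⊕ Aˣ → A` that vanishes outside `Aˣ`, for a sharp monoid `P`. -/
noncomputable def hollowHom (P : Type u) [CommMonoid P] (sharp : ∀ a b : P, a * b = 1 → a = 1)
    (A : Type u) [CommRing A] : P × Aˣ →* A where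
  toFun a := if a.1 = 1 then (a.2 : A) else 0
  map_one' := if_pos rfl
  map_mul' := by
    rintro ⟨p, a⟩ ⟨q, b⟩
    by_cases hp : p = 1
    · by_cases hq : q = 1
      · simp [hp, hq]
      · simp [hp, hq]
    · have : p * q ≠ 1 := fun h => hp (sharp _ _ h)
      simp [hp, this]

theorem hollowHom_of_eq_one {P : Type u} [CommMonoid P] {sharp : ∀ a b : P, a * b = 1 → a = 1}
    {A : Type u} [CommRing A] {a : P × Aˣ} (h : a.1 = 1) : hollowHom P sharp A a = a.2 := if_pos h

theorem hollowHom_of_ne_one {P : Type u} [CommMonoid P] {sharp : ∀ a b : P, a * b = 1 → a = 1}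
    {A : Type u} [CommRing A] {a : P × Aˣ} (h : a.1 ≠ 1) : hollowHom P sharp A a = 0 := if_neg h

theorem hollowHom_existsUnique {P : Type u} [CommMonoid P]
    (sharp : ∀ a b : P, a * b = 1 → a = 1) {A : Type u} [CommRing A] [Nontrivial A] (a : Aˣ) :
    ∃! m, hollowHom P sharp A m = a := by
  refine ⟨(1, a), hollowHom_of_eq_one rfl, ?_⟩
  rintro ⟨p, b⟩ h
  by_cases hp : p = 1
  · rw [hollowHom_of_eq_one hp] at h
    exact Prod.ext hp (Units.ext h)
  · rw [hollowHom_of_ne_one hp] at h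
    exact absurd h.symm a.ne_zero

/-- The component in `P` is locally constant, so the function is locally either the unit component
or zero. -/
theorem hollowSheaf_hollowHom_mem {S : Scheme.{u}} {P : Type u} [CommMonoid P]
    (sharp : ∀ a b : P, a * b = 1 → a = 1) {U : S.Opens}
    {s : ∀ y : U, P × (S.presheaf.stalk y.1)ˣ} (hs : s ∈ (hollowSheaf S P).sections U) :
    (fun y : U => hollowHom P sharp (S.presheaf.stalk y.1) (s y)) ∈
      (structSheaf S).sections U := by
  refine (structSheaf S).locality _ _ fun x hx => ?_
  obtain ⟨W, V, hW, hV, t, ⟨p, hp, ht⟩, e⟩ := hs x hx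
  by_cases h : p = 1
  · refine ⟨V ⊓ W, ⟨hV, hW⟩, _, (structSheaf S).restrict_mem inf_le_left ht, fun y yU yV => ?_⟩
    refine (congrArg (hollowHom P sharp (S.presheaf.stalk y)) (e y yU yV.1 yV.2)).trans ?_
    exact hollowHom_of_eq_one ((hp _).trans h)
  · refine ⟨V ⊓ W, ⟨hV, hW⟩, _, germ_mem_structSheaf 0, fun y yU yV => ?_⟩
    refine (congrArg (hollowHom P sharp (S.presheaf.stalk y)) (e y yU yV.1 yV.2)).trans ?_
    exact (hollowHom_of_ne_one (fun h' => h ((hp _).symm.trans h'))).trans (map_zero _).symm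

/-- The log scheme with underlying scheme `S` and `M = P ⊕ 𝒪_S^×`, where `α` vanishes outside the
units, for a sharp monoid `P`. -/
noncomputable def hollow (S : Scheme.{u}) (P : Type u) [CommMonoid P]
    (sharp : ∀ a b : P, a * b = 1 → a = 1) : LogScheme.{u} where
  X := S
  M := hollowSheaf S P
  α t := hollowHom P sharp (S.presheaf.stalk t)
  α_sections _ _ hs := exists_germ_of_mem (hollowSheaf_hollowHom_mem sharp hs)
  existsUnique_unit _ a := hollowHom_existsUnique sharp a

section Hollow

variable {S : Scheme.{u}} {P : Type u} [CommMonoid P] {sharp : ∀ a b : P, a * b = 1 → a = 1}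

theorem hollow_mem {U : S.Opens} (p : P) (s : ∀ y : U, (S.presheaf.stalk y.1)ˣ)
    (hs : (fun y : U => (s y : S.presheaf.stalk y.1)) ∈ (structSheaf S).sections U) :
    (fun y : U => ((p, s y) : P × (S.presheaf.stalk y.1)ˣ)) ∈ (hollowSheaf S P).sections U :=
  fun _ hx => ⟨⊤, U, trivial, hx, fun y => (p, s y), ⟨p, fun _ => rfl, hs⟩, fun _ _ _ _ => rfl⟩

theorem exists_unit_mul_eq {G : Type w} [CommGroup G] (m : P × G) :
    ∃ (p : P) (a : (P × G)ˣ), (p, 1) * (a : P × G) = m :=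
  ⟨m.1, ⟨(1, m.2), (1, m.2⁻¹), by simp, by simp⟩, by simp⟩

theorem eq_of_unit_mul_eq (sharp : ∀ a b : P, a * b = 1 → a = 1) {G : Type w} [CommGroup G] {p q : P} {a b : (P × G)ˣ}
    (h : (p, 1) * (a : P × G) = (q, 1) * (b : P × G)) : p = q ∧ a = b := by
  have hu : ∀ a : (P × G)ˣ, a.1.1 = 1 := fun a => sharp _ _ (congrArg Prod.fst a.mul_inv)
  have h1 := congrArg Prod.fst h
  have h2 := congrArg Prod.snd h
  simp only [Prod.fst_mul, Prod.snd_mul, hu, mul_one, one_mul] at h1 h2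
  exact ⟨h1, Units.ext (Prod.ext ((hu a).trans (hu b).symm) h2)⟩

/-- The constant sections `(p, 1)` form a global chart; since `P` is sharp, the units of `P × G` are
exactly those of `G`. -/
theorem hollow_isFs (hP : IsFsMonoid P) : (hollow S P sharp).IsFs := by
  intro x
  refine ⟨(⊤ : S.Opens), trivial, P, inferInstance,
    { toFun := fun p => ⟨fun y => (p, 1), hollow_mem p 1 ((structSheaf S).sections ⊤).one_mem⟩
      map_one' := rfl
      map_mul' := fun p q => Subtype.ext (funext fun y => Prod.ext rfl (mul_one _).symm) }, hP,
    ⟨fun y m => exists_unit_mul_eq (P := P) (G := (S.presheaf.stalk y.1)ˣ) m, ?_⟩⟩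
  intro y p q a b h
  obtain ⟨h1, h2⟩ := eq_of_unit_mul_eq sharp (G := (S.presheaf.stalk y.1)ˣ) h
  exact ⟨1, 1, isUnit_one, isUnit_one, by rw [h1], congrArg (fun c => Units.val c * _) h2⟩

end Hollow
end LogScheme

/-! ### Pushouts along the units -/

section UnitPushout

variable {M : Type u} [CommMonoid M] {G : Type v} [CommGroup G]

/-- The congruence defining the pushout of `M` along a homomorphism `Mˣ → G`. -/
def unitPushoutCon (v : Mˣ →* G) : Con (M × G) where
  r a b := ∃ c : Mˣ, b.1 = a.1 * c ∧ a.2 = b.2 * v c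
  iseqv :=
    { refl := fun a => ⟨1, by simp, by simp⟩
      symm := fun {a b} ⟨c, h, h'⟩ => ⟨c⁻¹, by rw [h, mul_assoc, Units.mul_inv, mul_one], by
        rw [h', map_inv, mul_assoc, mul_inv_cancel, mul_one]⟩
      trans := fun ⟨c, h, h'⟩ ⟨d, k, k'⟩ => ⟨c * d, by rw [k, h, Units.val_mul, mul_assoc], by
        rw [h', k', map_mul, mul_assoc, mul_comm (v d)]⟩ }
  mul' := fun ⟨c, h, h'⟩ ⟨d, k, k'⟩ => ⟨c * d, by
      rw [Prod.fst_mul, Prod.fst_mul, h, k, Units.val_mul, mul_mul_mul_comm], by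
      rw [Prod.snd_mul, Prod.snd_mul, h', k', map_mul, mul_mul_mul_comm]⟩

/-- The pushout of `M` along a homomorphism `Mˣ → G`. -/
abbrev UnitPushout (v : Mˣ →* G) : Type _ := (unitPushoutCon v).Quotient

namespace UnitPushout

variable (v : Mˣ →* G)

/-- The canonical map from the product to the pushout. -/
def mk : M × G →* UnitPushout v := (unitPushoutCon v).mk'

theorem mk_surjective : Function.Surjective (mk v) := Con.mk'_surjective

variable {v}

theorem mk_eq_iff {a b : M × G} : mk v a = mk v b ↔ ∃ c : Mˣ, b.1 = a.1 * c ∧ a.2 = b.2 * v c :=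
  Con.eq _

theorem mk_unit (c : Mˣ) (g : G) : mk v (c, g) = mk v (1, v c * g) :=
  mk_eq_iff.2 ⟨c⁻¹, by simp, by simp [mul_comm (v c), mul_assoc]⟩

theorem mk_eq_mul (m : M) (g : G) : mk v (m, g) = mk v (m, 1) * mk v (1, g) := by
  rw [← map_mul, Prod.mk_mul_mk, mul_one, one_mul]

/-- The universal property of the pushout. -/
def lift {N : Type w} [CommMonoid N] (f : M →* N) (g : G →* N) (h : ∀ c : Mˣ, f c = g (v c)) :
    UnitPushout v →* N :=
  Con.lift _ (f.coprod g) (by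
    rintro a b ⟨c, e, e'⟩
    rw [Con.ker_rel, MonoidHom.coprod_apply, MonoidHom.coprod_apply, e, e', map_mul, map_mul, h,
      mul_assoc, mul_comm (g b.2)])

variable {A : Type w} [CommRing A] (β : M →* A)

/-- The homomorphism `M ⊕ Aˣ → A` from the pushout. -/
noncomputable def toRing : UnitPushout (Units.map β) →* A :=
  lift β (Units.coeHom A) fun _ => rfl

@[simp] theorem toRing_mk (a : M × Aˣ) : toRing β (mk _ a) = β a.1 * a.2 := rfl

variable {β}

/-- As `β` is local, a class with invertible image has a unit as its first component, which can be
moved across to `Aˣ`. -/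
theorem eq_mk_of_toRing_eq (hβ : ∀ m, IsUnit (β m) → IsUnit m) {x : UnitPushout (Units.map β)}
    {a : Aˣ} (h : toRing β x = a) : x = mk _ (1, a) := by
  obtain ⟨⟨m, c⟩, rfl⟩ := mk_surjective _ x
  rw [toRing_mk] at h
  obtain ⟨d, rfl⟩ := hβ m (isUnit_of_mul_isUnit_left (h ▸ a.isUnit))
  rw [mk_unit]
  exact congrArg (fun a => mk _ (1, a)) (Units.ext h)

theorem existsUnique_toRing_eq (hβ : ∀ m, IsUnit (β m) → IsUnit m) (a : Aˣ) :
    ∃! x, toRing β x = a :=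
  ⟨mk _ (1, a), by simp, fun _ h => eq_mk_of_toRing_eq hβ h⟩

theorem exists_eq_mul_unit {P : Type*} {π : P → M} (h : ∀ m, ∃ (p : P) (a : Mˣ), π p * a = m)
    (x : UnitPushout v) : ∃ (p : P) (a : (UnitPushout v)ˣ), mk v (π p, 1) * a = x := by
  obtain ⟨⟨m, g⟩, rfl⟩ := mk_surjective _ x
  obtain ⟨p, a, rfl⟩ := h m
  refine ⟨p, Units.map (mk v) (MulEquiv.prodUnits.symm (a, toUnits g)), ?_⟩
  refine (map_mul (mk v) _ _).symm.trans (congrArg _ (Prod.ext rfl (one_mul _)))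

/-- The injectivity half of a chart survives the pushout: all units there come from `Aˣ`, so an
equality of classes amounts to a relation in `M` up to a unit `w`, to which the original chart
applies. -/
theorem exists_of_mul_unit_eq (hβ : ∀ m, IsUnit (β m) → IsUnit m) {P : Type*} [CommMonoid P]
    {π : P →* M} (h : ∀ (p q : P) (a b : Mˣ), π p * a = π q * b →
      ∃ f g : P, IsUnit (π f) ∧ IsUnit (π g) ∧ p * f = q * g ∧ a * π g = b * π f)
    (p q : P) (a b : (UnitPushout (Units.map β))ˣ)
    (e : mk _ (π p, 1) * a.1 = mk _ (π q, 1) * b.1) :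
    ∃ f g : P, IsUnit (π f) ∧ IsUnit (π g) ∧ p * f = q * g ∧
      a.1 * mk _ (π g, 1) = b.1 * mk _ (π f, 1) := by
  have key : ∀ a : (UnitPushout (Units.map β))ˣ, ∃ c : Aˣ, a.1 = mk _ (1, c) := fun a => by
    obtain ⟨c, hc⟩ := a.isUnit.map (toRing β)
    exact ⟨c, eq_mk_of_toRing_eq hβ hc.symm⟩
  obtain ⟨c, hc⟩ := key a
  obtain ⟨d, hd⟩ := key b
  rw [hc, hd, ← map_mul, ← map_mul, mk_eq_iff] at e
  obtain ⟨w, h1, h2⟩ := e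
  simp only [Prod.mk_mul_mk, mul_one, one_mul] at h1 h2
  obtain ⟨f, g, hf, hg, e1, e2⟩ := h p q w 1 (by rw [← h1, Units.val_one, mul_one])
  refine ⟨f, g, hf, hg, e1, ?_⟩
  rw [hc, hd, ← map_mul, ← map_mul, mk_eq_iff]
  refine ⟨w, ?_, ?_⟩
  · simp only [Prod.mk_mul_mk, one_mul]
    rw [mul_comm, e2, Units.val_one, one_mul]
  · simpa using h2

end UnitPushout

end UnitPushout

/-! ### Inverse images of log structures -/

namespace LogScheme

section PullbackLog

variable (Y : LogScheme.{u}) {S : Scheme.{u}} (i : S ⟶ Y.X)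

/-- The homomorphism `M_{Y,i(t)} → 𝒪_{S,t}`. -/
noncomputable def pullbackα (t : S) : Y.M.stalk (i t) →* S.presheaf.stalk t :=
  (i.stalkMap t).hom.toMonoidHom.comp (Y.α (i t))

theorem isUnit_of_isUnit_pullbackα (t : S) (m : Y.M.stalk (i t))
    (h : IsUnit (Y.pullbackα i t m)) : IsUnit m :=
  Y.isUnit_of_isUnit_α (isUnit_of_map_unit (i.stalkMap t).hom _ h)

theorem pullbackα_mem {V : Y.X.Opens} {m : ∀ y : V, Y.M.stalk y.1} (hm : m ∈ Y.M.sections V) :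
    (fun t : ↥(i ⁻¹ᵁ V) => Y.pullbackα i t.1 (m ⟨i t.1, t.2⟩)) ∈
      (structSheaf S).sections (i ⁻¹ᵁ V) :=
  structSheaf_pullback i (α_mem hm)

/-- The stalks of the inverse image log structure. -/
abbrev PullbackStalk (t : S) : Type u := UnitPushout (Units.map (Y.pullbackα i t))

/-- The basic sections of the inverse image log structure. -/
def IsPullbackBase (U : S.Opens) (s : ∀ t : U, Y.PullbackStalk i t.1) : Prop :=
  ∃ (V : Y.X.Opens) (hV : U ≤ i ⁻¹ᵁ V) (m : ∀ y : V, Y.M.stalk y.1)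
    (c : ∀ t : U, (S.presheaf.stalk t.1)ˣ), m ∈ Y.M.sections V ∧
    (fun t : U => (c t : S.presheaf.stalk t.1)) ∈ (structSheaf S).sections U ∧
    ∀ t : U, s t = UnitPushout.mk _ (m ⟨i t.1, hV t.2⟩, c t)

/-- The unit witnessing equality of the two classes at `x` extends to an invertible section near `i
x`, and both relations of the congruence then hold nearby. -/
theorem IsPullbackBase.germ_eq {U V : S.Opens} {s : ∀ t : U, Y.PullbackStalk i t.1}
    {s' : ∀ t : V, Y.PullbackStalk i t.1} (hs : Y.IsPullbackBase i U s)
    (hs' : Y.IsPullbackBase i V s') {x : S} (hU : x ∈ U) (hV : x ∈ V)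
    (e : s ⟨x, hU⟩ = s' ⟨x, hV⟩) : ∃ W : S.Opens, x ∈ W ∧
      ∀ (y : S) (hU : y ∈ U) (hV : y ∈ V), y ∈ W → s ⟨y, hU⟩ = s' ⟨y, hV⟩ := by
  obtain ⟨A, hA, m, c, hm, hc, es⟩ := hs
  obtain ⟨B, hB, m', c', hm', hc', es'⟩ := hs'
  rw [es, es', UnitPushout.mk_eq_iff] at e
  obtain ⟨d, h1, h2⟩ := e
  obtain ⟨D, hD, p, hp, -, ep⟩ := Y.M.exists_unit_section d
  obtain ⟨W, hW, hWe⟩ := Y.M.germ_eq B (A ⊓ D) m' _ hm'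
    (mul_mem (Y.M.restrict_mem inf_le_left hm) (Y.M.restrict_mem inf_le_right hp))
    (i x) (hB hV) ⟨hA hU, hD⟩ (by rw [← ep] at h1; exact h1)
  have hp' := pullbackα_mem Y i hp
  obtain ⟨W', hW', hWe'⟩ := (structSheaf S).germ_eq U (V ⊓ i ⁻¹ᵁ D) _ _ hc
    (mul_mem ((structSheaf S).restrict_mem inf_le_left hc')
      ((structSheaf S).restrict_mem inf_le_right hp')) x hU ⟨hV, hD⟩ (by
      have := congrArg Units.val h2
      rw [← ep] at this
      exact this)
  refine ⟨W' ⊓ i ⁻¹ᵁ (W ⊓ D), ⟨hW', hW, hD⟩, fun y yU yV yW => ?_⟩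
  rw [es, es', UnitPushout.mk_eq_iff]
  exact ⟨p ⟨i y, yW.2.2⟩, hWe (i y) (hB yV) ⟨hA yU, yW.2.2⟩ yW.2.1,
    Units.ext (hWe' y yU ⟨yV, yW.2.2⟩ yW.1)⟩

/-- The sheaf of monoids of the inverse image log structure. -/
noncomputable def pullbackSheaf : MonoidSheaf.{u, u} S :=
  MonoidSheaf.ofBase (fun t : S => Y.PullbackStalk i t) (Y.IsPullbackBase i)
    ⟨⊤, fun _ _ => trivial, 1, 1, one_mem _, ((structSheaf S).sections ⊤).one_mem,
      fun _ => (map_one _).symm⟩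
    (by
      rintro U V s t ⟨A, hA, m, c, hm, hc, e⟩ ⟨B, hB, m', c', hm', hc', e'⟩
      refine ⟨A ⊓ B, fun x hx => ⟨hA hx.1, hB hx.2⟩, _,
        fun y => c ⟨y, y.2.1⟩ * c' ⟨y, y.2.2⟩,
        mul_mem (Y.M.restrict_mem inf_le_left hm) (Y.M.restrict_mem inf_le_right hm'),
        mul_mem ((structSheaf S).restrict_mem inf_le_left hc)
          ((structSheaf S).restrict_mem inf_le_right hc'), fun y => ?_⟩
      exact (congrArg₂ (· * ·) (e ⟨y.1, y.2.1⟩) (e' ⟨y.1, y.2.2⟩)).trans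
        (map_mul (UnitPushout.mk _) _ _).symm)
    (by
      intro x a
      obtain ⟨⟨m, c⟩, rfl⟩ := UnitPushout.mk_surjective _ a
      obtain ⟨A, hA, s, hs, rfl⟩ := Y.M.exists_germ (i x) m
      obtain ⟨B, hB, t, ht, -, rfl⟩ := exists_unit_germ c
      exact ⟨B ⊓ i ⁻¹ᵁ A, ⟨hB, hA⟩, fun y => UnitPushout.mk _ (s ⟨i y.1, y.2.2⟩, t ⟨y.1, y.2.1⟩),
        ⟨A, inf_le_right, s, fun y => t ⟨y.1, y.2.1⟩, hs,
          (structSheaf S).restrict_mem inf_le_left ht, fun _ => rfl⟩, rfl⟩)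
    (fun _ _ _ _ hs ht _ hU hV e => hs.germ_eq Y i ht hU hV e)

variable {Y i}

theorem pullbackSheaf_mem {U : S.Opens} {s : ∀ t : U, Y.PullbackStalk i t.1}
    (hs : Y.IsPullbackBase i U s) : s ∈ (Y.pullbackSheaf i).sections U :=
  fun _ hx => ⟨⊤, U, trivial, hx, s, hs, fun _ _ _ _ => rfl⟩

theorem toRing_mem {U : S.Opens} {s : ∀ t : U, Y.PullbackStalk i t.1}
    (hs : s ∈ (Y.pullbackSheaf i).sections U) :
    (fun t : U => UnitPushout.toRing (Y.pullbackα i t.1) (s t)) ∈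
      (structSheaf S).sections U := by
  refine (structSheaf S).locality _ _ fun x hx => ?_
  obtain ⟨W, V, hW, hV, t, ⟨A, hA, m, c, hm, hc, et⟩, e⟩ := hs x hx
  refine ⟨V ⊓ W, ⟨hV, hW⟩, _, (structSheaf S).restrict_mem inf_le_left
    (mul_mem ((structSheaf S).restrict_mem hA (pullbackα_mem Y i hm)) hc), fun y yU yV => ?_⟩
  exact congrArg (UnitPushout.toRing (Y.pullbackα i y)) ((e y yU yV.1 yV.2).trans (et _))

variable (Y i)

/-- The inverse image of a log structure under a morphism of schemes. -/
noncomputable def pullbackLog : LogScheme.{u} where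
  X := S
  M := Y.pullbackSheaf i
  α t := UnitPushout.toRing (Y.pullbackα i t)
  α_sections _ _ hs := exists_germ_of_mem (toRing_mem hs)
  existsUnique_unit t a :=
    UnitPushout.existsUnique_toRing_eq (Y.isUnit_of_isUnit_pullbackα i t) a

/-- The homomorphism to the stalk of the inverse image log structure. -/
noncomputable def pullbackStalkMap (t : S) : Y.M.stalk (i t) →* Y.PullbackStalk i t :=
  (UnitPushout.mk _).comp (MonoidHom.inl _ _)

theorem pullbackStalkMap_mem {V : Y.X.Opens} {m : ∀ y : V, Y.M.stalk y.1}
    (hm : m ∈ Y.M.sections V) :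
    (fun t : ↥(i ⁻¹ᵁ V) => Y.pullbackStalkMap i t.1 (m ⟨i t.1, t.2⟩)) ∈
      (Y.pullbackSheaf i).sections (i ⁻¹ᵁ V) :=
  pullbackSheaf_mem ⟨V, le_rfl, m, 1, hm, ((structSheaf S).sections _).one_mem, fun _ => rfl⟩

/-- The strict morphism from the inverse image log structure. -/
noncomputable def pullbackHom : Hom (Y.pullbackLog i) Y where
  base := i
  stalkMap t := Y.pullbackStalkMap i t
  map_sections _ _ hs := Y.pullbackStalkMap_mem i hs
  α_stalkMap _ _ := mul_one _

theorem pullbackLog_isFs (hY : Y.IsFs) : (Y.pullbackLog i).IsFs := by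
  intro x
  obtain ⟨U, hU, P, _, β, hP, hβ⟩ := hY (i x)
  refine ⟨i ⁻¹ᵁ U, hU, P, inferInstance,
    { toFun := fun p => ⟨_, Y.pullbackStalkMap_mem i (β p).2⟩
      map_one' := Subtype.ext (funext fun t => by rw [map_one]; exact map_one _)
      map_mul' := fun p q => Subtype.ext (funext fun t => by
        rw [map_mul]; exact map_mul (Y.pullbackStalkMap i t.1) _ _) }, hP, ⟨?_, ?_⟩⟩
  · exact fun y m => UnitPushout.exists_eq_mul_unit (π := fun p => (β p).1 ⟨i y.1, y.2⟩)
      (hβ.surjective ⟨i y.1, y.2⟩) m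
  · intro y p q a b e
    obtain ⟨f, g, hf, hg, e1, e2⟩ := UnitPushout.exists_of_mul_unit_eq
      (Y.isUnit_of_isUnit_pullbackα i y.1)
      (π := ((Pi.evalMonoidHom (fun y : U => Y.M.stalk y) ⟨i y.1, y.2⟩).comp
        (Y.M.sections U).subtype).comp β) (hβ.injective ⟨i y.1, y.2⟩) p q a b e
    exact ⟨f, g, hf.map (Y.pullbackStalkMap i y.1), hg.map (Y.pullbackStalkMap i y.1), e1, e2⟩

end PullbackLog

theorem IsCompatible.comp {S T X : LogScheme.{u}} {F' : MonoidalSpace.{u}}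
    {φ : MonoidalSpace.Hom F' X.fan} {f : Hom T X} {g : MonoidalSpace.Hom T.sharp F'}
    (h : IsCompatible φ f g) (k : Hom S T) : IsCompatible φ (f.comp k) (g.comp k.sharp) := by
  intro t
  obtain ⟨h1, h2⟩ := h (k.base t)
  refine ⟨h1, fun U s hs ht hy => ?_⟩
  exact congrArg (sharpMap (k.stalkMap t)) (h2 U s hs ht hy)

end LogScheme

namespace LogScheme

/-! ### Charts of a subdivision at a point of a stratum -/

/-- A splitting of the homomorphism `M_x → M_{F',x'}` at a point `x` of the stratum of
`φ(x')`. -/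
structure StratumChart {X : LogScheme.{u}} {F' : MonoidalSpace.{u}}
    (φ : MonoidalSpace.Hom F' X.fan) (x' : F') (x : X.X) where
  isCharPoint : X.IsCharPoint x (φ x')
  isFs : IsFsMonoid (F'.stalk x')
  sharp : ∀ a b : F'.stalk x', a * b = 1 → a = 1
  cancel : IsCancelMul (X.M.stalk x)
  r : ℕ
  torusPart : Associates (X.M.stalk (φ x').1) →* Multiplicative (Fin r → ℤ)
  sec : Associates (X.M.stalk (φ x').1) →* X.M.stalk x
  unitPart : X.M.stalk x →* (X.M.stalk x)ˣ
  injective : Function.Injective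
    (MonoidHom.prod (φ.stalkMap x' : Associates (X.M.stalk (φ x').1) →* F'.stalk x')
      torusPart)
  surjective : ∀ q, ∃ a c,
    (MonoidHom.prod (φ.stalkMap x' : Associates (X.M.stalk (φ x').1) →* F'.stalk x')
      torusPart) a = q *
    (MonoidHom.prod (φ.stalkMap x' : Associates (X.M.stalk (φ x').1) →* F'.stalk x')
      torusPart) c
  charMap_sec : ∀ n, X.charMap isCharPoint.choose (sec n) = n
  eq_sec_mul : ∀ m, m = sec (X.charMap isCharPoint.choose m) * unitPart m

namespace StratumChart

variable {X : LogScheme.{u}} {F' : MonoidalSpace.{u}} {φ : MonoidalSpace.Hom F' X.fan} {x' : F'}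
  {x : X.X} (C : StratumChart φ x' x)

/-- The monoid `M_{F(X),φ(x')}`. -/
abbrev N (_ : StratumChart φ x' x) : Type u := Associates (X.M.stalk (φ x').1)

/-- The stalk homomorphism of the subdivision. -/
def subd : C.N →* F'.stalk x' := φ.stalkMap x'

/-- The splitting homomorphism. -/
def ι : C.N →* F'.stalk x' × Multiplicative (Fin C.r → ℤ) := C.subd.prod C.torusPart

theorem exists_ι_eq_mul (q) : ∃ n k : C.N, C.ι n = q * C.ι k := C.surjective q

/-- The homomorphism `M_x → M_{F(X),φ(x')}`. -/
noncomputable def char : X.M.stalk x →* C.N := X.charMap C.isCharPoint.choose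

theorem unitPart_sec (n : C.N) : C.unitPart (C.sec n) = 1 := by
  have := C.cancel
  have h := C.eq_sec_mul (C.sec n)
  rw [C.charMap_sec] at h
  exact Units.ext (mul_left_cancel (h.symm.trans (mul_one _).symm))

/-- Both steps from `M_x` to the stalk of `F'` reflect units: the second because `φ` is local, the
first because `φ x'` is the characteristic point of `x`. -/
theorem isUnit_of_subd_char_eq_one {m : X.M.stalk x} (h : C.subd (C.char m) = 1) : IsUnit m := by
  have h1 : IsUnit (C.subd (C.char m)) := h ▸ isUnit_one
  have h2 := φ.isLocal x' _ h1
  exact C.isCharPoint.isUnit_of_isUnit_cosp (Associates.isUnit_mk.1 h2)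

theorem char_eq_one_of_isUnit {m : X.M.stalk x} (h : IsUnit m) : C.char m = 1 :=
  Associates.mk_eq_one.2 (h.map (X.M.cosp C.isCharPoint.choose))

theorem unitPart_of_isUnit {m : X.M.stalk x} (h : IsUnit m) : (C.unitPart m : X.M.stalk x) = m := by
  have h1 := C.eq_sec_mul m
  have h2 : X.charMap C.isCharPoint.choose m = 1 := C.char_eq_one_of_isUnit h
  rw [h2, map_one, one_mul] at h1
  exact h1.symm

/-! ### Stalks of `Y` at points over `x` and `x'` -/

variable {Y : LogScheme.{u}} {b : Hom Y X} {ρ : MonoidalSpace.Hom Y.sharp F'}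

/-- The homomorphism `M_x → M_{Y,z}` at a point `z` over `x`. -/
noncomputable def toStalk (b : Hom Y X) {z : Y.X} (hb : b.base z = x) :
    X.M.stalk x →* Y.M.stalk z :=
  (b.stalkMap z).comp (X.M.cosp (specializes_of_eq hb))

theorem toStalk_section {z : Y.X} (hb : b.base z = x) {U : X.X.Opens}
    {s : ∀ y : U, X.M.stalk y.1} (hs : s ∈ X.M.sections U) (hx : x ∈ U) (hz : b.base z ∈ U) :
    toStalk b hb (s ⟨x, hx⟩) = b.stalkMap z (s ⟨b.base z, hz⟩) :=
  congrArg (b.stalkMap z) (X.M.cosp_section (specializes_of_eq hb) hs hz hx)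

/-- The homomorphism `M_{F',x'} → M_{Y,z}^♯` at a point `z` over `x'`. -/
noncomputable def toSharp (ρ : MonoidalSpace.Hom Y.sharp F') {z : Y.X} (hz : ρ z = x') :
    F'.stalk x' →* Associates (Y.M.stalk z) :=
  (ρ.stalkMap z).comp (F'.sheaf.cosp (specializes_of_eq hz))

theorem toSharp_section {z : Y.X} (hz : ρ z = x') {U : Opens F'}
    {s : ∀ y : U, F'.stalk y.1} (hs : s ∈ F'.sheaf.sections U) (hx : x' ∈ U) (hzU : ρ z ∈ U) :
    toSharp ρ hz (s ⟨x', hx⟩) = ρ.stalkMap z (s ⟨ρ z, hzU⟩) :=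
  congrArg (ρ.stalkMap z) (F'.sheaf.cosp_section (specializes_of_eq hz) hs hzU hx)

theorem isUnit_of_toSharp {z : Y.X} (hz : ρ z = x') {p : F'.stalk x'}
    (h : IsUnit (toSharp ρ hz p)) : IsUnit p := by
  subst hz
  have := ρ.isLocal z _ h
  rwa [MonoidSheaf.cosp_refl] at this

theorem toSharp_subd_char (hc : IsCompatible φ b ρ) {z : Y.X} (hb : b.base z = x)
    (hz : ρ z = x') (m : X.M.stalk x) :
    toSharp ρ hz (C.subd (C.char m)) = Associates.mk (toStalk b hb m) := by
  subst hz hb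
  obtain ⟨U, hU, s, hs, rfl⟩ := X.M.exists_germ (b.base z) m
  have hy : (φ (ρ z)).1 ∈ U := C.isCharPoint.choose.mem_open U.2 hU
  have h := (hc z).2 U s hs hU hy
  rw [toStalk_section rfl hs hU hU, ← h]
  refine congrArg (ρ.stalkMap z) ((MonoidSheaf.cosp_refl _ _ _).trans ?_)
  exact congrArg (φ.stalkMap (ρ z)) (charMap_section _ hs hU hy)

/-- The homomorphism `M_{F(X),φ(x')} → M_{Y,z}` given by the section. -/
noncomputable def secStalk (b : Hom Y X) {z : Y.X} (hb : b.base z = x) : C.N →* Y.M.stalk z :=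
  (toStalk b hb).comp C.sec

theorem mk_secStalk (hc : IsCompatible φ b ρ) {z : Y.X} (hb : b.base z = x) (hz : ρ z = x')
    (n : C.N) : Associates.mk (C.secStalk b hb n) = toSharp ρ hz (C.subd n) := by
  refine (C.toSharp_subd_char hc hb hz (C.sec n)).symm.trans ?_
  exact congrArg (fun n => toSharp ρ hz (C.subd n)) (C.charMap_sec n)

/-- Divisibility in `M_{Y,z}` may be tested modulo units. There the map factors through `F'.stalk
x'`, where the quotient of the two elements exists: it is the first component of `q`. -/
theorem exists_ext (hY : Y.IsFs) (hc : IsCompatible φ b ρ) {z : Y.X} (hb : b.base z = x)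
    (hz : ρ z = x') : ∃ E : F'.stalk x' × Multiplicative (Fin C.r → ℤ) →* Y.M.stalk z,
      ∀ q n k, C.ι n = q * C.ι k → C.secStalk b hb n = E q * C.secStalk b hb k := by
  have := hY.isCancelMul z
  refine exists_extension C.ι C.injective C.surjective (C.secStalk b hb) fun q n k e => ?_
  rw [← Associates.mk_dvd_mk, C.mk_secStalk hc hb hz, C.mk_secStalk hc hb hz]
  refine map_dvd _ ⟨q.1, ?_⟩
  rw [mul_comm]
  exact congrArg Prod.fst e

/-- The extension of `secStalk` to `M_{F',x'} × ℤ^r`. -/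
noncomputable def ext (hY : Y.IsFs) (hc : IsCompatible φ b ρ) {z : Y.X} (hb : b.base z = x)
    (hz : ρ z = x') : F'.stalk x' × Multiplicative (Fin C.r → ℤ) →* Y.M.stalk z :=
  (C.exists_ext hY hc hb hz).choose

section Ext

variable (hY : Y.IsFs) (hc : IsCompatible φ b ρ) {z : Y.X} (hb : b.base z = x) (hz : ρ z = x')

theorem secStalk_eq_ext_mul {q n k} (h : C.ι n = q * C.ι k) :
    C.secStalk b hb n = C.ext hY hc hb hz q * C.secStalk b hb k :=
  (C.exists_ext hY hc hb hz).choose_spec q n k h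

theorem ext_ι (n : C.N) : C.ext hY hc hb hz (C.ι n) = C.secStalk b hb n := by
  have h := C.secStalk_eq_ext_mul hY hc hb hz (q := C.ι n) (n := n) (k := 1) (by
    rw [map_one, mul_one])
  rw [h, map_one, mul_one]

theorem mk_ext (q) : Associates.mk (C.ext hY hc hb hz q) = toSharp ρ hz q.1 := by
  have := (hY.associates z).1.cancel
  obtain ⟨n, k, h⟩ := C.exists_ι_eq_mul q
  have h1 := congrArg Associates.mk (C.secStalk_eq_ext_mul hY hc hb hz h)
  rw [← Associates.mk_mul_mk, C.mk_secStalk hc hb hz, C.mk_secStalk hc hb hz] at h1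
  refine mul_right_cancel (h1.symm.trans ?_)
  rw [← map_mul]
  exact congrArg (fun a => toSharp ρ hz a.1) h

end Ext

/-- The equation characterising the extension spreads out near `z` and determines it at nearby
points by cancellation. The last clause concerns all nearby points over `x'`, not only those over
`x`; it is what controls invertibility along the whole stratum. -/
theorem exists_section_ext (hY : Y.IsFs) (hc : IsCompatible φ b ρ) {z : Y.X} (hb : b.base z = x)
    (hz : ρ z = x') (q : F'.stalk x' × Multiplicative (Fin C.r → ℤ)) : ∃ (V : Y.X.Opens) (_ : z ∈ V) (m : ∀ y : V, Y.M.stalk y.1),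
    m ∈ Y.M.sections V ∧
    (∀ (y : Y.X) (hy : y ∈ V) (hb : b.base y = x) (hz : ρ y = x'),
      C.ext hY hc hb hz q = m ⟨y, hy⟩) ∧
    ∀ (y : Y.X) (hy : y ∈ V) (hz : ρ y = x'), Associates.mk (m ⟨y, hy⟩) = toSharp ρ hz q.1 := by
  obtain ⟨n, k, h⟩ := C.exists_ι_eq_mul q
  obtain ⟨A, hA, s, hs, es⟩ := X.M.exists_germ x (C.sec n)
  obtain ⟨B, hB, t, ht, et⟩ := X.M.exists_germ x (C.sec k)
  obtain ⟨D, hD, m, hm, em⟩ := Y.M.exists_germ z (C.ext hY hc hb hz q)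
  have hs' := b.map_sections A s hs
  have ht' := b.map_sections B t ht
  have hsec : ∀ (y : Y.X) (hb : b.base y = x),
      C.secStalk b hb n = b.stalkMap y (s ⟨b.base y, hb ▸ hA⟩) := fun y hb => by
    rw [← toStalk_section hb hs hA, es]; rfl
  have hsec' : ∀ (y : Y.X) (hb : b.base y = x),
      C.secStalk b hb k = b.stalkMap y (t ⟨b.base y, hb ▸ hB⟩) := fun y hb => by
    rw [← toStalk_section hb ht hB, et]; rfl
  obtain ⟨W, hW, hWe⟩ := Y.M.germ_eq (b.base ⁻¹ᵁ A) (D ⊓ b.base ⁻¹ᵁ B) _ _ hs'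
    (mul_mem (Y.M.restrict_mem inf_le_left hm) (Y.M.restrict_mem inf_le_right ht')) z
    (show b.base z ∈ A from hb ▸ hA) ⟨hD, show b.base z ∈ B from hb ▸ hB⟩ (by
      refine (hsec z hb).symm.trans ((C.secStalk_eq_ext_mul hY hc hb hz h).trans ?_)
      rw [hsec' z hb, ← em]
      rfl)
  obtain ⟨A', hA', p, hp, ep⟩ := F'.sheaf.exists_germ x' q.1
  have hp' := ρ.map_sections A' p hp
  obtain ⟨W', hW', hWe'⟩ := Y.M.sharp.germ_eq D _ _ _ (Y.M.mk_mem_sharp hm) hp' z hD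
    (show ρ z ∈ A' from hz ▸ hA') (by
      refine (congrArg Associates.mk em).trans ((C.mk_ext hY hc hb hz q).trans ?_)
      rw [← ep]
      exact toSharp_section hz hp hA' _)
  refine ⟨(D ⊓ W) ⊓ W', ⟨⟨hD, hW⟩, hW'⟩, _, Y.M.restrict_mem (inf_le_left.trans inf_le_left) hm,
    fun y hy hb hz => ?_, fun y hy hz => ?_⟩
  · have := hY.isCancelMul y
    have h1 := hWe y (show b.base y ∈ A from hb ▸ hA) ⟨hy.1.1, show b.base y ∈ B from hb ▸ hB⟩
      hy.1.2
    have h2 := C.secStalk_eq_ext_mul hY hc hb hz h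
    rw [hsec, hsec'] at h2
    exact mul_right_cancel (h2.symm.trans h1)
  · have hyA : ρ y ∈ A' := hz ▸ hA'
    refine (hWe' y hy.1.1 hyA hy.2).trans ?_
    rw [← ep]
    exact (toSharp_section hz hp hA' hyA).symm

end StratumChart
end LogScheme

/-! ### Morphisms to spectra -/

section SpecMaps

variable {S : Scheme.{u}}

/-- The homomorphism `A → Γ(S, 𝒪_S)` given by a morphism `S → Spec A`. -/
noncomputable def specApp {A : CommRingCat.{u}} (f : S ⟶ Spec A) : A →+* Γ(S, ⊤) :=
  ((Scheme.ΓSpecIso A).inv ≫ f.appTop).hom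

theorem specApp_comp {T : Scheme.{u}} {A : CommRingCat.{u}} (g : T ⟶ S) (f : S ⟶ Spec A) (a : A) :
    specApp (g ≫ f) a = g.appTop (specApp f a) := by
  simp only [specApp, Scheme.Hom.comp_appTop]
  rfl

theorem specApp_comp_map {A B : CommRingCat.{u}} (f : S ⟶ Spec B) (g : A ⟶ B) (a : A) :
    specApp (f ≫ Spec.map g) a = specApp f (g a) := by
  have h := congrArg (fun k => (k ≫ f.appTop).hom a) (Scheme.ΓSpecIso_inv_naturality g)
  simp only [specApp, Scheme.Hom.comp_appTop]
  exact h.symm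

theorem spec_hom_ext {A : CommRingCat.{u}} {f g : S ⟶ Spec A}
    (h : ∀ a, specApp f a = specApp g a) : f = g := by
  apply ext_of_isAffine
  rw [← cancel_epi (Scheme.ΓSpecIso A).inv]
  ext a
  exact h a

theorem exists_specApp_eq {A : CommRingCat.{u}} (φ : A →+* Γ(S, ⊤)) :
    ∃ f : S ⟶ Spec A, ∀ a, specApp f a = φ a := by
  refine ⟨S.toSpecΓ ≫ Spec.map (CommRingCat.ofHom φ), fun a => ?_⟩
  rw [specApp_comp_map]
  simp [specApp]

/-- A morphism to a torus over `k` from a morphism to `Spec k` and invertible functions. -/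
theorem exists_toTorus {k : CommRingCat.{u}} {r : ℕ} (s : S ⟶ Spec k)
    (w : Multiplicative (Fin r → ℤ) →* Γ(S, ⊤)) :
    ∃ f : S ⟶ (splitTorus k r).left, f ≫ (splitTorus k r).hom = s ∧
      ∀ l, specApp f (AddMonoidAlgebra.single l.toAdd 1) = w l := by
  obtain ⟨f, hf⟩ := exists_specApp_eq (S := S)
    (A := CommRingCat.of (AddMonoidAlgebra k (Fin r → ℤ)))
    (AddMonoidAlgebra.liftNCRingHom (specApp s) w fun _ _ => Commute.all _ _)
  refine ⟨f, spec_hom_ext fun a => ?_, fun l => ?_⟩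
  · refine (specApp_comp_map f _ a).trans ((hf _).trans ?_)
    simp [AddMonoidAlgebra.liftNCRingHom]
  · rw [hf]
    simp [AddMonoidAlgebra.liftNCRingHom]

theorem toTorus_ext {k : CommRingCat.{u}} {r : ℕ} {f g : S ⟶ (splitTorus k r).left}
    (h : f ≫ (splitTorus k r).hom = g ≫ (splitTorus k r).hom)
    (h' : ∀ l, specApp f (AddMonoidAlgebra.single l 1) =
      specApp g (AddMonoidAlgebra.single l 1)) : f = g := by
  refine spec_hom_ext fun a => ?_
  have e : (specApp f : AddMonoidAlgebra k (Fin r → ℤ) →+* Γ(S, ⊤)) = specApp g := by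
    refine AddMonoidAlgebra.ringHom_ext (fun c => ?_) h'
    have h1 := specApp_comp_map f
      (CommRingCat.ofHom (algebraMap k (AddMonoidAlgebra k (Fin r → ℤ)))) c
    have h2 := specApp_comp_map g
      (CommRingCat.ofHom (algebraMap k (AddMonoidAlgebra k (Fin r → ℤ)))) c
    exact h1.symm.trans ((congrArg (fun q => specApp q c) h).trans h2)
  exact DFunLike.congr_fun e a

/-- The universal invertible functions on a torus. -/
noncomputable def torusChar (k : CommRingCat.{u}) (r : ℕ) :
    Multiplicative (Fin r → ℤ) →* Γ((splitTorus k r).left, ⊤) :=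
  (specApp (𝟙 (splitTorus k r).left) :
    AddMonoidAlgebra k (Fin r → ℤ) →+* Γ((splitTorus k r).left, ⊤)).toMonoidHom.comp
    (AddMonoidAlgebra.of k (Fin r → ℤ))

theorem specApp_single {k : CommRingCat.{u}} {r : ℕ} (f : S ⟶ (splitTorus k r).left) (l) :
    specApp f (AddMonoidAlgebra.single l 1) =
      f.appTop (torusChar k r (Multiplicative.ofAdd l)) :=
  (congrArg (fun q => specApp q (AddMonoidAlgebra.single l 1)) (Category.comp_id f)).symm.trans
    (specApp_comp f (𝟙 (splitTorus k r).left) _)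

instance (k : CommRingCat.{u}) [IsDomain k] (r : ℕ) : IsReduced (splitTorus k r).left :=
  inferInstanceAs (IsReduced (Spec (CommRingCat.of (AddMonoidAlgebra k (Fin r → ℤ)))))

/-! ### Global functions and morphisms through a residue field -/

/-- The germ of a global function. -/
noncomputable def topGerm (t : S) : Γ(S, ⊤) →+* S.presheaf.stalk t :=
  (S.presheaf.germ ⊤ t trivial).hom

theorem stalkMap_topGerm {T : Scheme.{u}} (g : T ⟶ S) (t : T) (a : Γ(S, ⊤)) :
    g.stalkMap t (topGerm (g t) a) = topGerm t (g.appTop a) :=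
  Scheme.Hom.germ_stalkMap_apply g ⊤ t trivial a

theorem topGerm_ext {a c : Γ(S, ⊤)} (h : ∀ t, topGerm t a = topGerm t c) : a = c :=
  germ_ext fun t _ => h t

theorem topGerm_mem (a : Γ(S, ⊤)) (U : S.Opens) :
    (fun t : U => topGerm t.1 a) ∈ (structSheaf S).sections U :=
  (structSheaf S).restrict_mem (U := ⊤) le_top (germ_mem_structSheaf a)

/-- For `s : S → Spec κ(x)`, the pullback of germs at `x` to `S`. -/
noncomputable def resSection {X : Scheme.{u}} {x : X} (s : S ⟶ Spec (X.residueField x)) :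
    X.presheaf.stalk x →+* Γ(S, ⊤) :=
  (specApp s).comp (X.residue x).hom

theorem resSection_comp {T X : Scheme.{u}} {x : X} (g : T ⟶ S)
    (s : S ⟶ Spec (X.residueField x)) (a : X.presheaf.stalk x) :
    resSection (g ≫ s) a = g.appTop (resSection s a) :=
  specApp_comp g s _

theorem resSection_eq_zero {X : Scheme.{u}} {x : X} (s : S ⟶ Spec (X.residueField x))
    {a : X.presheaf.stalk x} (ha : ¬ IsUnit a) : resSection s a = 0 := by
  have h : (X.residue x).hom a = 0 := (IsLocalRing.residue_eq_zero_iff a).2 ha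
  rw [resSection, RingHom.comp_apply, h, map_zero]

theorem fromSpecResidueField_eq {X : Scheme.{u}} {x : X} (s : S ⟶ Spec (X.residueField x))
    (t : S) : (s ≫ X.fromSpecResidueField x) t = x :=
  Scheme.fromSpecResidueField_apply x (s t)

/-- All of `S` lies over `x`, so every function near `x` pulls back to a function on all of `S`,
which depends only on its value in `κ(x)`. -/
theorem stalkMap_eq_topGerm_resSection {X : Scheme.{u}} {x : X} (s : S ⟶ Spec (X.residueField x))
    {p : S ⟶ X} (hp : p = s ≫ X.fromSpecResidueField x) (t : S) (h : x ⤳ p t)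
    (a : X.presheaf.stalk (p t)) :
    p.stalkMap t a = topGerm t (resSection s (X.presheaf.stalkSpecializes h a)) := by
  obtain ⟨V, hV, f, rfl⟩ := X.presheaf.exists_germ_eq a
  have hx : x ∈ V := h.mem_open V.2 hV
  rw [Scheme.Hom.germ_stalkMap_apply, TopCat.Presheaf.germ_stalkSpecializes_apply]
  subst hp
  have h1 : (s ≫ Spec.map (X.residue x) ≫ X.fromSpecStalk x).app V f =
      S.presheaf.map (homOfLE le_top).op (resSection s (X.presheaf.germ V x hx f)) := by
    rw [← Category.assoc, Scheme.Hom.comp_app, Scheme.fromSpecStalk_app hx]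
    have h2 := congrArg (fun k => k.hom ((Scheme.ΓSpecIso (X.presheaf.stalk x)).inv
      (X.presheaf.germ V x hx f)))
      ((s ≫ Spec.map (X.residue x)).naturality (homOfLE (le_top : X.fromSpecStalk x ⁻¹ᵁ V ≤ ⊤)).op)
    have h4 := congrArg (S.presheaf.map (homOfLE (le_top :
      (s ≫ Spec.map (X.residue x)) ⁻¹ᵁ (X.fromSpecStalk x ⁻¹ᵁ V) ≤ ⊤)).op) (specApp_comp_map s (X.residue x)
      (X.presheaf.germ V x hx f))
    exact h2.trans h4
  have h3 : (s ≫ X.fromSpecResidueField x).app V f =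
      S.presheaf.map (homOfLE le_top).op (resSection s (X.presheaf.germ V x hx f)) := h1
  rw [h3]
  exact S.presheaf.germ_res_apply (homOfLE le_top) t hV _

end SpecMaps

/-! ### Reduced subschemes -/

section Reduced

theorem isReduced_vanishingIdeal (Y : Scheme.{u}) (Z : Closeds Y) :
    IsReduced (Scheme.IdealSheafData.vanishingIdeal Z).subscheme := by
  have h : ∀ U, IsReduced
      ((Scheme.IdealSheafData.vanishingIdeal Z).subschemeCover.openCover.X U) := by
    intro (U : Y.affineOpens)
    have h1 : _root_.IsReduced (Γ(Y, U) ⧸ (Scheme.IdealSheafData.vanishingIdeal Z).ideal U) := by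
      rw [← Ideal.isRadical_iff_quotient_reduced, Scheme.IdealSheafData.vanishingIdeal_ideal]
      exact PrimeSpectrum.isRadical_vanishingIdeal _
    exact inferInstanceAs (IsReduced (Spec (CommRingCat.of
      (Γ(Y, U) ⧸ (Scheme.IdealSheafData.vanishingIdeal Z).ideal U))))
  exact IsReduced.of_openCover _ (Scheme.IdealSheafData.vanishingIdeal Z).subschemeCover.openCover

instance (Y : Scheme.{u}) (Z : Set Y) : IsReduced (reducedSubscheme Y Z) :=
  have : IsReduced (reducedClosure Y Z).subscheme := isReduced_vanishingIdeal Y _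
  show IsReduced (openInClosure Y Z).toScheme from isReduced_of_isOpenImmersion (openInClosure Y Z).ι

instance (Y : Scheme.{u}) (Z : Set Y) : Mono (reducedSubschemeι Y Z) :=
  inferInstanceAs (Mono ((openInClosure Y Z).ι ≫ (reducedClosure Y Z).subschemeι))

theorem reducedSubschemeι_mem {Y : Scheme.{u}} {Z : Set Y} (t : reducedSubscheme Y Z) :
    reducedSubschemeι Y Z t ∈ Z :=
  interior_subset (s := (reducedClosure Y Z).subschemeι ⁻¹' Z) t.2

/-- Since `S` is reduced, the kernel of `f` is the full vanishing ideal of the closure of its image,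
so `f` factors through the reduced closure of `Z`. It lands in `Z`, which is open there by local
closedness. -/
theorem exists_lift_reducedSubscheme {Y S : Scheme.{u}} [IsReduced S] {Z : Set Y}
    (hZ : IsLocallyClosed Z) (f : S ⟶ Y) (hf : ∀ t, f t ∈ Z) :
    ∃ g : S ⟶ reducedSubscheme Y Z, g ≫ reducedSubschemeι Y Z = f := by
  have hker : (reducedClosure Y Z).subschemeι.ker ≤ f.ker := by
    rw [Scheme.IdealSheafData.ker_subschemeι, ← Scheme.IdealSheafData.map_bot]
    have h1 : (⊥ : S.IdealSheafData) = Scheme.IdealSheafData.vanishingIdeal ⊤ := by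
      rw [Scheme.IdealSheafData.vanishingIdeal_top, Scheme.nilradical_eq_bot]
    rw [h1, Scheme.IdealSheafData.map_vanishingIdeal]
    refine Scheme.IdealSheafData.vanishingIdeal_antimono ?_
    refine closure_mono ?_
    rintro _ ⟨t, -, rfl⟩
    exact hf t
  let g := IsClosedImmersion.lift (reducedClosure Y Z).subschemeι f hker
  have hg : g ≫ (reducedClosure Y Z).subschemeι = f := IsClosedImmersion.lift_fac _ _ _
  have hopen : IsOpen ((reducedClosure Y Z).subschemeι ⁻¹' Z) := by
    obtain ⟨U, K, hU, hK, rfl⟩ := hZ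
    convert hU.preimage (reducedClosure Y (U ∩ K)).subschemeι.continuous using 1
    ext t
    refine ⟨fun h => h.1, fun h => ⟨h, ?_⟩⟩
    have h1 : (reducedClosure Y (U ∩ K)).subschemeι t ∈ closure (U ∩ K) := by
      have h2 : (reducedClosure Y (U ∩ K)).subschemeι t ∈
          Set.range (reducedClosure Y (U ∩ K)).subschemeι := ⟨t, rfl⟩
      rw [Scheme.IdealSheafData.range_subschemeι] at h2
      exact h2
    exact closure_minimal Set.inter_subset_right hK h1
  have hrange : Set.range g ⊆ Set.range (openInClosure Y Z).ι := by
    rw [Scheme.Opens.range_ι]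
    rintro _ ⟨t, rfl⟩
    refine (interior_eq_iff_isOpen.2 hopen).ge ?_
    have := hf t
    rw [← hg] at this
    exact this
  let l : S ⟶ (openInClosure Y Z).toScheme := IsOpenImmersion.lift (openInClosure Y Z).ι g hrange
  have hl : l ≫ (openInClosure Y Z).ι ≫ (reducedClosure Y Z).subschemeι = f := by
    rw [IsOpenImmersion.lift_fac_assoc, hg]
  exact ⟨l, hl⟩

/-- A function on a reduced scheme all of whose germs are non-units vanishes. -/
theorem eq_zero_of_not_isUnit {S : Scheme.{u}} [IsReduced S] {U : S.Opens} {f : Γ(S, U)}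
    (h : ∀ (t : S) (ht : t ∈ U), ¬ IsUnit (S.presheaf.germ U t ht f)) : f = 0 := by
  rw [← basicOpen_eq_bot_iff, eq_bot_iff]
  intro t ht
  exact h t (S.basicOpen_le f ht) ((Scheme.mem_basicOpen S f t _).1 ht)

end Reduced

theorem associates_mk_prod_eq {P : Type u} {G : Type v} [CommMonoid P] [CommGroup G] (p : P)
    (g : G) : Associates.mk ((p, 1) : P × G) = Associates.mk (p, g) :=
  Associates.mk_eq_mk_iff_associated.2 ⟨MulEquiv.prodUnits.symm (1, toUnits g),
    Prod.ext (mul_one _) (one_mul _)⟩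

namespace LogScheme.StratumChart

variable {X : LogScheme.{u}} {F' : MonoidalSpace.{u}} {φ : MonoidalSpace.Hom F' X.fan} {x' : F'}
  {x : X.X} (C : StratumChart φ x' x)

/-! ### Morphisms from hollow log schemes -/

section Hollow

variable {S : Scheme.{u}} (s : S ⟶ Spec (X.X.residueField x))
  (χ : Multiplicative (Fin C.r → ℤ) →* Γ(S, ⊤))

/-- The invertible function on `S` attached to a germ of `M` at `x`. -/
noncomputable def totalUnit : X.M.stalk x →* Γ(S, ⊤)ˣ :=
  (χ.toHomUnits.comp (C.torusPart.comp C.char)) *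
    (Units.map ((resSection s).toMonoidHom.comp (X.α x))).comp C.unitPart

theorem totalUnit_apply (m : X.M.stalk x) : (C.totalUnit s χ m : Γ(S, ⊤)) =
    χ (C.torusPart (C.char m)) * resSection s (X.α x (C.unitPart m)) := rfl

/-- The homomorphism from `M_x` to the stalk of a hollow log structure. -/
noncomputable def toHollow (t : S) : X.M.stalk x →* F'.stalk x' × (S.presheaf.stalk t)ˣ :=
  (C.subd.comp C.char).prod ((Units.map (topGerm t).toMonoidHom).comp (C.totalUnit s χ))

/-- On non-units both sides vanish, because the maximal ideal dies in `κ(x)`. On units `char` is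
trivial, so the character `χ` contributes nothing. -/
theorem hollowHom_toHollow (t : S) (m : X.M.stalk x) :
    hollowHom (F'.stalk x') C.sharp (S.presheaf.stalk t) (C.toHollow s χ t m) =
      topGerm t (resSection s (X.α x m)) := by
  by_cases h : C.subd (C.char m) = 1
  · have hm := C.isUnit_of_subd_char_eq_one h
    rw [hollowHom_of_eq_one (show (C.toHollow s χ t m).1 = 1 from h)]
    change topGerm t (C.totalUnit s χ m : Γ(S, ⊤)) = _
    rw [totalUnit_apply, C.char_eq_one_of_isUnit hm, map_one, map_one, one_mul,
      C.unitPart_of_isUnit hm]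
  · rw [hollowHom_of_ne_one (show (C.toHollow s χ t m).1 ≠ 1 from h), resSection_eq_zero, map_zero]
    intro h'
    refine h ?_
    rw [C.char_eq_one_of_isUnit (X.isUnit_of_isUnit_α h'), map_one]

/-- The morphism from a hollow log scheme over `κ(x)` given by a homomorphism from `ℤ^r` to the
invertible functions. -/
noncomputable def hollowMap : Hom (hollow S (F'.stalk x') C.sharp) X where
  base := s ≫ X.X.fromSpecResidueField x
  stalkMap t := (C.toHollow s χ t).comp
    (X.M.cosp (specializes_of_eq (fromSpecResidueField_eq s t).symm))
  map_sections V σ hσ := by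
    refine (hollowSheaf S (F'.stalk x')).locality _ _ fun t ht => ?_
    -- Every point of `S` maps to `x`, so the pulled-back section is given by the single germ at
    -- `x`.
    have hx : x ∈ V := (fromSpecResidueField_eq s t) ▸ ht
    refine ⟨(s ≫ X.X.fromSpecResidueField x) ⁻¹ᵁ V, ht, _,
      hollow_mem (C.subd (C.char (σ ⟨x, hx⟩)))
        (fun t => Units.map (topGerm t.1).toMonoidHom (C.totalUnit s χ (σ ⟨x, hx⟩)))
        (topGerm_mem _ _), fun y hU _ => ?_⟩
    exact congrArg (C.toHollow s χ y) (X.M.cosp_section _ hσ hx hU)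
  α_stalkMap t m := by
    have h := stalkMap_eq_topGerm_resSection s (p := s ≫ X.X.fromSpecResidueField x) rfl t
      (specializes_of_eq (fromSpecResidueField_eq s t).symm) (X.α _ m)
    have h' := α_cosp (X := X) (specializes_of_eq (fromSpecResidueField_eq s t).symm) m
    exact (C.hollowHom_toHollow s χ t _).trans
      ((congrArg (fun a => topGerm t (resSection s a)) h').trans h.symm)

/-- The constant morphism from a hollow log scheme. -/
noncomputable def hollowSharp (S : Scheme.{u}) :
    MonoidalSpace.Hom (hollow S (F'.stalk x') C.sharp).sharp F' where
  toFun _ := x'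
  continuous := continuous_const
  stalkMap t := Associates.mkMonoidHom.comp
    (MonoidHom.inl (F'.stalk x') (S.presheaf.stalk t)ˣ)
  isLocal t m h := (Prod.isUnit_iff.1 (Associates.isUnit_mk.1 h)).1
  map_sections V σ hσ := by
    refine (hollowSheaf S (F'.stalk x')).sharp.locality _ _ fun t ht => ?_
    have hx : x' ∈ V := ht
    exact ⟨⊤, trivial, _, MonoidSheaf.mk_mem_sharp _ (hollow_mem (U := ⊤) (σ ⟨x', hx⟩) 1
      ((structSheaf S).sections ⊤).one_mem), fun _ _ _ => rfl⟩

/-- Modulo units the choice of `χ` disappears and only `M_x → N → F'.stalk x'` remains. -/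
theorem isCompatible_hollow : IsCompatible φ (C.hollowMap s χ) (C.hollowSharp S) := by
  intro (t : S)
  have ht := fromSpecResidueField_eq s t
  refine ⟨?_, fun U σ hσ hU hy => ?_⟩
  · have h := C.isCharPoint
    rwa [← ht] at h
  · have hx : x ∈ U := ht ▸ hU
    have h1 : (C.hollowMap s χ).stalkMap t (σ ⟨(C.hollowMap s χ).base t, hU⟩) =
        C.toHollow s χ t (σ ⟨x, hx⟩) :=
      congrArg (C.toHollow s χ t) (X.M.cosp_section _ hσ hx hU)
    have h2 : C.char (σ ⟨x, hx⟩) = Associates.mk (σ ⟨(φ x').1, hy⟩) :=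
      charMap_section _ hσ hx hy
    rw [h1]
    have h3 : C.toHollow s χ t (σ ⟨x, hx⟩) = (C.subd (Associates.mk (σ ⟨(φ x').1, hy⟩)),
        Units.map (topGerm t).toMonoidHom (C.totalUnit s χ (σ ⟨x, hx⟩))) := by
      rw [← h2]; rfl
    rw [h3]
    exact associates_mk_prod_eq _ _

end Hollow

/-! ### Morphisms to hollow log schemes -/

section Stratum

variable {Y : LogScheme.{u}} {b : Hom Y X} {ρ : MonoidalSpace.Hom Y.sharp F'}
  (hY : Y.IsFs) (hc : IsCompatible φ b ρ) {S : Scheme.{u}} {i : S ⟶ Y.X}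
  (hb : ∀ t, b.base (i t) = x) (hz : ∀ t, ρ (i t) = x')

theorem ext_mem (q) : (fun t : (⊤ : S.Opens) =>
    Y.pullbackStalkMap i t.1 (C.ext hY hc (hb t.1) (hz t.1) q)) ∈
      (Y.pullbackSheaf i).sections ⊤ := by
  refine (Y.pullbackSheaf i).locality _ _ fun t _ => ?_
  obtain ⟨V, hV, m, hm, e, -⟩ := C.exists_section_ext hY hc (hb t) (hz t) q
  exact ⟨i ⁻¹ᵁ V, hV, _, Y.pullbackStalkMap_mem i hm, fun y _ hy =>
    congrArg (Y.pullbackStalkMap i y) (e (i y) hy (hb y) (hz y))⟩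

theorem exists_torusUnit (l : Multiplicative (Fin C.r → ℤ)) : ∃ f : Γ(S, ⊤), ∀ t,
    topGerm t f = Y.pullbackα i t (C.ext hY hc (hb t) (hz t) (1, l)) := by
  obtain ⟨f, hf⟩ := toRing_mem (C.ext_mem hY hc hb hz (1, l))
  exact ⟨f, fun t => ((mul_one _).symm.trans (hf ⟨t, trivial⟩)).symm⟩

/-- The invertible functions on the stratum given by the chart. -/
noncomputable def torusUnit : Multiplicative (Fin C.r → ℤ) →* Γ(S, ⊤) where
  toFun l := (C.exists_torusUnit hY hc hb hz l).choose
  map_one' := topGerm_ext fun t => by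
    rw [(C.exists_torusUnit hY hc hb hz 1).choose_spec, map_one, ← Prod.one_eq_mk, map_one,
      map_one]
  map_mul' l l' := topGerm_ext fun t => by
    rw [(C.exists_torusUnit hY hc hb hz _).choose_spec, map_mul,
      (C.exists_torusUnit hY hc hb hz _).choose_spec,
      (C.exists_torusUnit hY hc hb hz _).choose_spec, ← map_mul, ← map_mul, Prod.mk_mul_mk, one_mul]

theorem topGerm_torusUnit (t : S) (l) : topGerm t (C.torusUnit hY hc hb hz l) =
    Y.pullbackα i t (C.ext hY hc (hb t) (hz t) (1, l)) :=
  (C.exists_torusUnit hY hc hb hz l).choose_spec t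

/-- The extension depends only on the point of `Y`, so the functions it defines commute with
pullback. -/
theorem torusUnit_comp {T : Scheme.{u}} (j : T ⟶ S) {i' : T ⟶ Y.X} (h : j ≫ i = i')
    (hb' : ∀ t, b.base (i' t) = x) (hz' : ∀ t, ρ (i' t) = x') (l) :
    C.torusUnit hY hc hb' hz' l = j.appTop (C.torusUnit hY hc hb hz l) := by
  subst h
  refine topGerm_ext fun t => ?_
  rw [← stalkMap_topGerm, topGerm_torusUnit, topGerm_torusUnit]
  exact congrArg (fun f => f.hom (Y.α (i (j t)) (C.ext hY hc (hb (j t)) (hz (j t)) (1, l))))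
    (Scheme.Hom.stalkMap_comp j i t)

theorem pullbackα_toStalk {s : S ⟶ Spec (X.X.residueField x)}
    (e : i ≫ b.base = s ≫ X.X.fromSpecResidueField x) (t : S) (m : X.M.stalk x) :
    Y.pullbackα i t (toStalk b (hb t) m) = topGerm t (resSection s (X.α x m)) := by
  have h := stalkMap_eq_topGerm_resSection s e t (specializes_of_eq (hb t).symm)
    (X.α _ (X.M.cosp (specializes_of_eq (hb t)) m))
  rw [Scheme.Hom.stalkMap_comp] at h
  have h2 := α_cosp (X := X) (specializes_of_eq (hb t).symm)
    (X.M.cosp (specializes_of_eq (hb t)) m)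
  rw [MonoidSheaf.cosp_cosp, MonoidSheaf.cosp_refl] at h2
  rw [h2]
  exact (congrArg (i.stalkMap t) (b.α_stalkMap (i t) _)).trans h

/-- The functions that are nowhere invertible on the stratum of `x'` vanish on `S`. -/
def VanishesOn (ρ : MonoidalSpace.Hom Y.sharp F') (x' : F') (i : S ⟶ Y.X) : Prop :=
  ∀ (V : Y.X.Opens) (f : Γ(Y.X, V)),
    (∀ (z : Y.X) (hz : z ∈ V), ρ z = x' → ¬ IsUnit (Y.X.presheaf.germ V z hz f)) →
    i.app V f = 0

/-- A local section realising `q` has the class of `q.1` along the stratum. As `q.1` is not a unit,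
its function is nowhere invertible there and hence vanishes on `S`. -/
theorem pullbackα_ext_eq_zero (hv : VanishesOn ρ x' i) (t : S) {q} (hq : q.1 ≠ 1) :
    Y.pullbackα i t (C.ext hY hc (hb t) (hz t) q) = 0 := by
  obtain ⟨V, hV, m, hm, e, e'⟩ := C.exists_section_ext hY hc (hb t) (hz t) q
  obtain ⟨f, hf⟩ := α_mem hm
  rw [e (i t) hV (hb t) (hz t)]
  have h1 : Y.α (i t) (m ⟨i t, hV⟩) = Y.X.presheaf.germ V (i t) hV f := hf ⟨i t, hV⟩
  have h2 : i.app V f = 0 := hv V f fun z hzV hzx hu => by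
    have h3 : Y.α z (m ⟨z, hzV⟩) = Y.X.presheaf.germ V z hzV f := hf ⟨z, hzV⟩
    rw [← h3] at hu
    have h4 := Associates.isUnit_mk.2 (Y.isUnit_of_isUnit_α hu)
    rw [e' z hzV hzx] at h4
    obtain ⟨c, hc⟩ := isUnit_of_toSharp hzx h4
    exact hq (C.sharp _ _ (hc ▸ c.mul_inv))
  refine (congrArg (i.stalkMap t) h1).trans ?_
  rw [Scheme.Hom.germ_stalkMap_apply, h2, map_zero]

/-- The homomorphism from the stalk of a hollow log structure given by the chart. -/
noncomputable def fromHollow {G : Scheme.{u}} (r : S ⟶ G) (t : S) :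
    F'.stalk x' × (G.presheaf.stalk (r t))ˣ →* Y.PullbackStalk i t :=
  (UnitPushout.mk (Units.map (Y.pullbackα i t))).comp
    (MonoidHom.prodMap ((C.ext hY hc (hb t) (hz t)).comp (MonoidHom.inl _ _))
      (Units.map (r.stalkMap t).hom.toMonoidHom))

theorem fromHollow_mk {G : Scheme.{u}} (r : S ⟶ G) (t : S) (m) :
    C.fromHollow hY hc hb hz r t m = UnitPushout.mk _ (C.ext hY hc (hb t) (hz t) (m.1, 1),
      Units.map (r.stalkMap t).hom.toMonoidHom m.2) := rfl

theorem toRing_fromHollow (hv : VanishesOn ρ x' i) {G : Scheme.{u}} (r : S ⟶ G) (t : S)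
    (m : F'.stalk x' × (G.presheaf.stalk (r t))ˣ) :
    UnitPushout.toRing (Y.pullbackα i t) (C.fromHollow hY hc hb hz r t m) =
      r.stalkMap t (hollowHom (F'.stalk x') C.sharp (G.presheaf.stalk (r t)) m) := by
  rw [fromHollow_mk, UnitPushout.toRing_mk]
  by_cases h : m.1 = 1
  · rw [hollowHom_of_eq_one h, h, ← Prod.one_eq_mk, map_one, map_one, one_mul]
    rfl
  · rw [hollowHom_of_ne_one h, map_zero,
      C.pullbackα_ext_eq_zero hY hc hb hz hv t (q := (m.1, 1)) h, zero_mul]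

/-- The morphism to a hollow log scheme given by the chart. -/
noncomputable def toHollowHom (hv : VanishesOn ρ x' i) {G : Scheme.{u}} (r : S ⟶ G) :
    Hom (Y.pullbackLog i) (hollow G (F'.stalk x') C.sharp) where
  base := r
  stalkMap t := C.fromHollow hY hc hb hz r t
  map_sections V σ hσ := by
    refine (Y.pullbackSheaf i).locality _ _ fun t ht => ?_
    -- Locally the section is a constant `p` with an invertible function; its image is the global
    -- section attached to `(p, 1)` times the pulled-back function.
    obtain ⟨W, A, hW, hA, τ, ⟨p, hp, hτ⟩, e⟩ := hσ (r t) ht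
    have h1 := structSheaf_pullback r hτ
    refine ⟨r ⁻¹ᵁ W ⊓ r ⁻¹ᵁ A, ⟨hW, hA⟩, _, mul_mem
      ((Y.pullbackSheaf i).restrict_mem le_top (C.ext_mem hY hc hb hz (p, 1)))
      ((Y.pullbackSheaf i).restrict_mem inf_le_right (pullbackSheaf_mem (U := r ⁻¹ᵁ A)
        ⟨⊤, fun _ _ => trivial, 1, fun y => Units.map (r.stalkMap y.1).hom.toMonoidHom
          (τ ⟨r y.1, y.2⟩).2, one_mem _, h1, fun _ => rfl⟩)), fun y hU hy => ?_⟩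
    refine (congrArg (C.fromHollow hY hc hb hz r y) (e (r y) hU hy.2 hy.1)).trans ?_
    refine Eq.trans ?_ (UnitPushout.mk_eq_mul _ _)
    refine congrArg (UnitPushout.mk _) (Prod.ext ?_ rfl)
    exact congrArg (fun p => C.ext hY hc (hb y) (hz y) (p, 1)) (hp ⟨r y, hy.2⟩)
  α_stalkMap t m := C.toRing_fromHollow hY hc hb hz hv r t m

end Stratum

end LogScheme.StratumChart

theorem LogScheme.Hom.sharp_comp {S T X : LogScheme.{u}} (f : Hom T X) (g : Hom S T) :
    (f.comp g).sharp = f.sharp.comp g.sharp := by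
  refine MonoidalSpace.Hom.ext (funext fun _ => rfl) (heq_of_eq (funext fun t => ?_))
  ext m
  obtain ⟨m, rfl⟩ := Associates.mk_surjective m
  rfl

namespace LogScheme.StratumChart

variable {X : LogScheme.{u}} {F' : MonoidalSpace.{u}} {φ : MonoidalSpace.Hom F' X.fan} {x' : F'}
  {x : X.X} (C : StratumChart φ x' x)

/-! ### Strata of log blow-ups -/

section Compare

variable {Y : LogScheme.{u}} {b : Hom Y X} {ρ : MonoidalSpace.Hom Y.sharp F'}
  (hY : Y.IsFs) (hc : IsCompatible φ b ρ) {S : Scheme.{u}} {i : S ⟶ Y.X}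
  (hb : ∀ t, b.base (i t) = x) (hz : ∀ t, ρ (i t) = x')

/-- The image of `m` in `M_Y` is the extension at `(subd (char m), 1)` times a unit formed from the
torus part and the unit part of `m`. In the pushout that unit moves to the structure sheaf, where
`hw` identifies it with the pullback of `totalUnit`. -/
theorem fromHollow_toHollow {s : S ⟶ Spec (X.X.residueField x)}
    (e : i ≫ b.base = s ≫ X.X.fromSpecResidueField x) {G : Scheme.{u}}
    {sG : G ⟶ Spec (X.X.residueField x)} {χ : Multiplicative (Fin C.r → ℤ) →* Γ(G, ⊤)}
    {r : S ⟶ G} (hr : r ≫ sG = s) (hw : ∀ l, r.appTop (χ l) = C.torusUnit hY hc hb hz l) (t : S)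
    (m : X.M.stalk x) : C.fromHollow hY hc hb hz r t (C.toHollow sG χ (r t) m) =
      Y.pullbackStalkMap i t (toStalk b (hb t) m) := by
  have h1 : toStalk b (hb t) m = C.ext hY hc (hb t) (hz t) (C.subd (C.char m), 1) *
      (C.ext hY hc (hb t) (hz t) (1, C.torusPart (C.char m)) *
        toStalk b (hb t) (C.unitPart m)) := by
    rw [← mul_assoc, ← map_mul, Prod.mk_mul_mk, mul_one, one_mul]
    have h2 := C.ext_ι hY hc (hb t) (hz t) (C.char m)
    have h3 := congrArg (toStalk b (hb t)) (C.eq_sec_mul m)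
    rw [map_mul] at h3
    exact h3.trans (congrArg (· * _) h2.symm)
  have hu : IsUnit (C.ext hY hc (hb t) (hz t) (1, C.torusPart (C.char m)) *
      toStalk b (hb t) (C.unitPart m)) := by
    refine IsUnit.mul (IsUnit.map _ ?_) ((C.unitPart m).isUnit.map _)
    exact Prod.isUnit_iff.2 ⟨isUnit_one, Group.isUnit _⟩
  obtain ⟨c, hc'⟩ := hu
  rw [← hc'] at h1
  rw [h1, fromHollow_mk]
  refine UnitPushout.mk_eq_iff.2 ⟨c, rfl, Units.ext ?_⟩
  have h4 : Y.pullbackα i t c = topGerm t (C.torusUnit hY hc hb hz (C.torusPart (C.char m))) *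
      topGerm t (resSection s (X.α x (C.unitPart m))) := by
    rw [hc', map_mul, topGerm_torusUnit, pullbackα_toStalk hb e]
  refine Eq.trans ?_ ((one_mul _).trans h4).symm
  change r.stalkMap t (topGerm (r t) (C.totalUnit sG χ m : Γ(G, ⊤))) = _
  rw [stalkMap_topGerm, totalUnit_apply, map_mul, map_mul, hw, ← hr, resSection_comp]

theorem hollowMap_comp {s : S ⟶ Spec (X.X.residueField x)}
    (e : i ≫ b.base = s ≫ X.X.fromSpecResidueField x) (hv : VanishesOn ρ x' i) {G : Scheme.{u}}
    {sG : G ⟶ Spec (X.X.residueField x)} {χ : Multiplicative (Fin C.r → ℤ) →* Γ(G, ⊤)}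
    {r : S ⟶ G} (hr : r ≫ sG = s) (hw : ∀ l, r.appTop (χ l) = C.torusUnit hY hc hb hz l) :
    (C.hollowMap sG χ).comp (C.toHollowHom hY hc hb hz hv r) = b.comp (Y.pullbackHom i) := by
  refine Hom.ext_of_sections ?_ ?_
  · refine (Category.assoc r sG (X.X.fromSpecResidueField x)).symm.trans ?_
    rw [hr, ← e]
    rfl
  · intro (t : S) V σ hσ hf hg
    have hx : x ∈ V := (hb t) ▸ hg
    have h1 : X.M.cosp (specializes_of_eq (fromSpecResidueField_eq sG (r t)).symm) (σ ⟨_, hf⟩) =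
      σ ⟨x, hx⟩ := X.M.cosp_section _ hσ hx hf
    have h2 := toStalk_section (hb t) hσ hx hg
    exact (congrArg (fun m => C.fromHollow hY hc hb hz r t (C.toHollow sG χ (r t) m)) h1).trans
      ((C.fromHollow_toHollow hY hc hb hz e hr hw t _).trans
        (congrArg (Y.pullbackStalkMap i t) h2))

/-- Together with `hollowMap_comp`, this is the input for uniqueness in the universal property: the
composite through the hollow log scheme and the inclusion have the same maps to `X` and to `F'`. -/
theorem hollowSharp_comp (hv : VanishesOn ρ x' i) {G : Scheme.{u}} (r : S ⟶ G) :
    (C.hollowSharp G).comp (C.toHollowHom hY hc hb hz hv r).sharp =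
      ρ.comp (Y.pullbackHom i).sharp := by
  refine MonoidalSpace.Hom.ext_of_sections (fun t => (hz t).symm) ?_
  intro (t : S) V σ hσ hf hg
  have hx : x' ∈ V := hf
  have h1 := C.mk_ext hY hc (hb t) (hz t) (σ ⟨x', hx⟩, 1)
  rw [toSharp_section (hz t) hσ hx hg] at h1
  have h2 : C.fromHollow hY hc hb hz r t (σ ⟨x', hx⟩, 1) =
      Y.pullbackStalkMap i t (C.ext hY hc (hb t) (hz t) (σ ⟨x', hx⟩, 1)) := by
    rw [fromHollow_mk, map_one]
    rfl
  exact (congrArg Associates.mk h2).trans (congrArg ((Y.pullbackHom i).sharp.stalkMap t) h1)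

theorem stalkMap_toStalk {T : LogScheme.{u}} {h : Hom T Y} {f : Hom T X} (e : b.comp h = f)
    (t : T.X) (hb : b.base (h.base t) = x) (hf : f.base t = x) (m : X.M.stalk x) :
    h.stalkMap t (toStalk b hb m) = f.stalkMap t (X.M.cosp (specializes_of_eq hf) m) := by
  subst e
  rfl

/-- The invertible functions attached to a lift of a morphism from a hollow log scheme. -/
theorem torusUnit_of_comp_eq {G : Scheme.{u}} {sG : G ⟶ Spec (X.X.residueField x)}
    {χ : Multiplicative (Fin C.r → ℤ) →* Γ(G, ⊤)}
    {h : Hom (hollow G (F'.stalk x') C.sharp) Y} (e : b.comp h = C.hollowMap sG χ)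
    (hb : ∀ t : G, b.base (h.base t) = x) (hz : ∀ t : G, ρ (h.base t) = x') (l) :
    C.torusUnit (S := G) (i := h.base) hY hc hb hz l = χ l := by
  have := C.isFs.cancel
  refine topGerm_ext fun t => (C.topGerm_torusUnit hY hc hb hz t l).trans ?_
  let H : Y.M.stalk (h.base t) →* F'.stalk x' × (G.presheaf.stalk t)ˣ := h.stalkMap t
  -- On the section the unit part is trivial, so only the character remains in the unit component.
  have hsec : ∀ n, H (C.secStalk b (hb t) n) =
      ((C.subd n, Units.map (topGerm t).toMonoidHom (χ.toHomUnits (C.torusPart n))) :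
        F'.stalk x' × (G.presheaf.stalk t)ˣ) := by
    intro n
    refine (stalkMap_toStalk e t (hb t) (fromSpecResidueField_eq sG t) (C.sec n)).trans ?_
    have h1 := X.M.cosp_cosp (specializes_of_eq (fromSpecResidueField_eq sG t).symm)
      (specializes_of_eq (fromSpecResidueField_eq sG t)) (C.sec n)
    rw [MonoidSheaf.cosp_refl] at h1
    refine (congrArg (C.toHollow sG χ t) h1).trans ?_
    have h2 : C.char (C.sec n) = n := C.charMap_sec n
    refine Prod.ext (congrArg C.subd h2) (congrArg (Units.map (topGerm t).toMonoidHom) ?_)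
    refine Units.ext ?_
    rw [totalUnit_apply, h2, unitPart_sec, Units.val_one, map_one, map_one, mul_one]
    rfl
  -- Writing `(1, l)` as a fraction of elements of `N` and applying `H` shows that the image of the
  -- extension is `1` in `F'.stalk x'` and `χ l` in the units.
  obtain ⟨n, k, hnk⟩ := C.exists_ι_eq_mul (1, l)
  obtain ⟨a, ha⟩ : ∃ a : F'.stalk x' × (G.presheaf.stalk t)ˣ,
    H (C.ext hY hc (hb t) (hz t) (1, l)) = a := ⟨_, rfl⟩
  have h1 : ((C.subd n, Units.map (topGerm t).toMonoidHom (χ.toHomUnits (C.torusPart n))) :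
        F'.stalk x' × (G.presheaf.stalk t)ˣ) =
      a * (C.subd k, Units.map (topGerm t).toMonoidHom (χ.toHomUnits (C.torusPart k))) :=
    (hsec n).symm.trans ((congrArg H
      (C.secStalk_eq_ext_mul hY hc (hb t) (hz t) hnk)).trans
        ((map_mul H _ _).trans (congrArg₂ (· * ·) ha (hsec k))))
  have h2 : C.subd n = a.1 * C.subd k := congrArg Prod.fst h1
  have h3 : Units.map (topGerm t).toMonoidHom (χ.toHomUnits (C.torusPart n)) =
    a.2 * Units.map (topGerm t).toMonoidHom (χ.toHomUnits (C.torusPart k)) := congrArg Prod.snd h1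
  have h4 : C.subd n = 1 * C.subd k := congrArg Prod.fst hnk
  have h5 : C.torusPart n = l * C.torusPart k := congrArg Prod.snd hnk
  have h6 : a.1 = 1 := mul_right_cancel (h2.symm.trans h4)
  rw [h5, map_mul, map_mul] at h3
  have h7 := mul_right_cancel h3
  have h8 : hollowHom (F'.stalk x') C.sharp (G.presheaf.stalk t) a =
      Y.pullbackα (S := G) h.base t (C.ext hY hc (hb t) (hz t) (1, l)) :=
    (congrArg _ ha.symm).trans (h.α_stalkMap t (C.ext hY hc (hb t) (hz t) (1, l)))
  refine h8.symm.trans ((hollowHom_of_eq_one h6).trans ?_)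
  rw [← h7]
  rfl

end Compare

/-! ### Comparison of the stratum fibre with the torus -/

section Main

variable {Y : LogScheme.{u}} {b : Hom Y X} {ρ : MonoidalSpace.Hom Y.sharp F'}

/-- A subscheme of the fibre over `x` of a log blow-up through which all reduced schemes that map
to the stratum of `x'` factor, is a split torus. -/
theorem nonempty_iso_splitTorus (hbl : IsLogBlowup φ b ρ) {S : Scheme.{u}} {i : S ⟶ Y.X} [Mono i]
    {s : S ⟶ Spec (X.X.residueField x)} (e : i ≫ b.base = s ≫ X.X.fromSpecResidueField x)
    (hz : ∀ t, ρ (i t) = x') (hv : VanishesOn ρ x' i)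
    (hlift : ∀ (G : Scheme.{u}) (sG : G ⟶ Spec (X.X.residueField x)) (g : G ⟶ Y.X), IsReduced G →
      g ≫ b.base = sG ≫ X.X.fromSpecResidueField x → (∀ t, ρ (g t) = x') →
      ∃ j : G ⟶ S, j ≫ i = g ∧ j ≫ s = sG) :
    Nonempty (Over.mk s ≅ splitTorus (X.X.residueField x) C.r) := by
  have hY := hbl.isFs
  have hc := hbl.isCompatible
  have hbase : ∀ {G : Scheme.{u}} {g : G ⟶ Y.X} {sG : G ⟶ Spec (X.X.residueField x)},
      g ≫ b.base = sG ≫ X.X.fromSpecResidueField x → ∀ t, b.base (g t) = x := by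
    intro G g sG e t
    rw [← Scheme.Hom.comp_apply, e, fromSpecResidueField_eq]
  have hb := hbase e
  let G := (splitTorus (X.X.residueField x) C.r).left
  let sG : G ⟶ Spec (X.X.residueField x) := (splitTorus (X.X.residueField x) C.r).hom
  let χ := torusChar (X.X.residueField x) C.r
  -- The map to the torus comes from the functions attached to `ℤ^r`; the map `h` below, from the
  -- torus, comes from the universal property with its tautological characters.
  obtain ⟨r, hr, hw⟩ := exists_toTorus s (C.torusUnit hY hc hb hz)
  have hw' : ∀ l, r.appTop (χ l) = C.torusUnit hY hc hb hz l := fun l =>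
    (specApp_single r l.toAdd).symm.trans (hw l)
  obtain ⟨h, ⟨h1, h2⟩, -⟩ := hbl.existsUnique _ (C.hollowMap sG χ) (C.hollowSharp G)
    (hollow_isFs C.isFs) (C.isCompatible_hollow sG χ)
  have hbG : h.base ≫ b.base = sG ≫ X.X.fromSpecResidueField x := congrArg Hom.base h1
  have hzG : ∀ t : G, ρ (h.base t) = x' := fun t => congrArg (fun g => g.toFun t) h2
  -- With the log structure pulled back from `Y`, both sides underlie lifts of the same pair of
  -- morphisms to `X` and `F'`, hence agree.
  have hr' : r ≫ h.base = i := by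
    have h3 := hbl.existsUnique _ (b.comp (Y.pullbackHom i)) (ρ.comp (Y.pullbackHom i).sharp)
      (Y.pullbackLog_isFs i hY) (hc.comp _)
    have h4 := h3.unique (y₁ := h.comp (C.toHollowHom hY hc hb hz hv r)) (y₂ := Y.pullbackHom i)
      ⟨?_, ?_⟩ ⟨rfl, rfl⟩
    · exact congrArg Hom.base h4
    · refine Eq.trans ?_ (C.hollowMap_comp hY hc hb hz e hv hr hw')
      rw [← h1]
      rfl
    · refine Eq.trans ?_ (C.hollowSharp_comp hY hc hb hz hv r)
      rw [← h2]
      exact congrArg ρ.comp (Hom.sharp_comp _ _)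
  obtain ⟨j, hj, hj'⟩ := hlift G sG h.base inferInstance hbG hzG
  refine ⟨Over.isoMk ⟨r, j, ?_, ?_⟩ hr⟩
  · rw [← cancel_mono i, Category.assoc, hj, hr', Category.id_comp]
  · refine toTorus_ext ?_ fun l => ?_
    · rw [Category.assoc, hr, hj', Category.id_comp]
    -- The characters pulled back along torus → fibre → torus are the functions of the chart along
    -- `h`, which are the tautological characters.
    · refine (specApp_comp j r _).trans ((congrArg j.appTop (hw (Multiplicative.ofAdd l))).trans ?_)
      have h3 := C.torusUnit_comp hY hc hb hz j hj (hbase hbG) hzG (Multiplicative.ofAdd l)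
      refine h3.symm.trans ((C.torusUnit_of_comp_eq hY hc h1 _ _ _).trans ?_)
      rfl

end Main
end LogScheme.StratumChart

/-! ### Points of fs fans -/

theorem Face.mul_mem_iff {P : Type u} [CommMonoid P] (S : Face P) (a b : P) :
    a * b ∈ S.1 ↔ a ∈ S.1 ∧ b ∈ S.1 :=
  ⟨fun h => ⟨S.2 a b h, S.2 b a (mul_comm a b ▸ h)⟩, fun h => S.1.mul_mem h.1 h.2⟩

/-- A product lies in a face exactly when its factors do, so a face is determined by the generators
it contains. -/
theorem Face.eq_of_closure_eq_top {P : Type u} [CommMonoid P] {G : Set P}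
    (hG : Submonoid.closure G = ⊤) {S T : Face P} (h : ∀ g ∈ G, g ∈ S.1 ↔ g ∈ T.1) : S = T := by
  refine Subtype.ext (Submonoid.ext fun p => ?_)
  have hp : p ∈ Submonoid.closure G := hG ▸ Submonoid.mem_top p
  induction hp using Submonoid.closure_induction with
  | mem g hg => exact h g hg
  | one => exact ⟨fun _ => T.1.one_mem, fun _ => S.1.one_mem⟩
  | mul a b _ _ ha hb =>
    exact (S.mul_mem_iff a b).trans ((and_congr ha hb).trans (T.mul_mem_iff a b).symm)

theorem Face.isOpen_setOf_mem {P : Type u} [CommMonoid P] (a : P) :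
    IsOpen {S : Face P | a ∈ S.1} :=
  TopologicalSpace.isOpen_generateFrom_of_mem ⟨a, rfl⟩

/-- Containing the finitely many generators in `S` is an open condition, and avoiding the others is
a closed one. -/
theorem Face.isLocallyClosed_singleton {P : Type u} [CommMonoid P] (hP : Monoid.FG P)
    (S : Face P) : IsLocallyClosed ({S} : Set (Face P)) := by
  obtain ⟨G, hG⟩ := hP.fg_top
  classical
  refine ⟨⋂ g ∈ G.filter (· ∈ S.1), {T : Face P | g ∈ T.1},
    ⋂ g ∈ G.filter (· ∉ S.1), {T : Face P | g ∈ T.1}ᶜ,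
    isOpen_biInter_finset fun g _ => isOpen_setOf_mem g,
    isClosed_biInter fun g _ => (isOpen_setOf_mem g).isClosed_compl, ?_⟩
  ext T
  simp only [Set.mem_singleton_iff, Set.mem_inter_iff, Set.mem_iInter, Finset.mem_filter,
    Set.mem_ofPred_eq, Set.mem_compl_iff]
  constructor
  · rintro rfl
    exact ⟨fun g hg => hg.2, fun g hg => hg.2⟩
  · rintro ⟨h1, h2⟩
    refine eq_of_closure_eq_top hG fun g hg => ⟨fun hT => ?_, fun hS => h1 g ⟨hg, hS⟩⟩
    by_contra hS
    exact h2 g ⟨hg, hS⟩ hT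

theorem IsFsFan.isLocallyClosed_singleton {F : MonoidalSpace.{u}} (hF : IsFsFan F) (t : F) :
    IsLocallyClosed ({t} : Set F) := by
  obtain ⟨U, ht, P, _, hP, f, hf⟩ := hF t
  have h1 := (Face.isLocallyClosed_singleton hP.fg (f ⟨t, ht⟩)).preimage f.continuous
  have h2 : (f.toFun ⁻¹' {f ⟨t, ht⟩} : Set (U : Set F)) = {⟨t, ht⟩} := by
    ext y
    exact ⟨fun h => hf.isHomeomorph.injective h, fun h => congrArg f.toFun h⟩
  have h3 : IsLocallyClosed ({⟨t, ht⟩} : Set (U : Set F)) := h2 ▸ h1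
  have h4 := h3.image Topology.IsInducing.subtypeVal (by
    rw [Subtype.range_coe]
    exact U.2.isLocallyClosed)
  rwa [Set.image_singleton] at h4

/-- The stalk is the quotient of an fs monoid by a face. -/
theorem IsFsFan.stalk {F : MonoidalSpace.{u}} (hF : IsFsFan F) (t : F) :
    IsFsMonoid (F.stalk t) ∧ ∀ a b : F.stalk t, a * b = 1 → a = 1 := by
  obtain ⟨U, ht, P, _, hP, f, hf⟩ := hF t
  let S : Face P := f ⟨t, ht⟩
  let e : (faceCon S).Quotient →* F.stalk t := f.stalkMap ⟨t, ht⟩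
  have he : Function.Bijective e := hf.bijective ⟨t, ht⟩
  refine hP.of_face_quotient S (e.comp (faceCon S).mk') (he.2.comp Con.mk'_surjective)
    fun p q => ?_
  exact he.1.eq_iff.trans (Con.eq _)

/-! ### Strata of log blow-ups along subdivisions -/

namespace LogScheme

/-- The splitting of `N^gp → P^gp` and that of `M_x → N` are chosen independently; the first fixes
the rank `C.r` of the torus. -/
theorem exists_stratumChart {X : LogScheme.{u}} (hX : X.IsFs) {F' : MonoidalSpace.{u}}
    (hF : IsFsFan F') {φ : MonoidalSpace.Hom F' X.fan} {x' : F'}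
    (hφ : Function.Surjective (gpMap (φ.stalkMap x'))) {x : X.X} (hx : X.IsCharPoint x (φ x')) :
    ∃ C : StratumChart φ x' x,
      gpRank (X.fan.stalk (φ x')) = gpRank (F'.stalk x') + C.r := by
  obtain ⟨hP, sP⟩ := hF.stalk x'
  obtain ⟨hN, sN⟩ := hX.associates (φ x').1
  obtain ⟨r, θ, hr, h1, h2⟩ := exists_splitting hN sN hP sP (φ.stalkMap x') hφ
  have := hX.isCancelMul x
  obtain ⟨σ, c, h3, h4⟩ := exists_section hN sN (X.charMap hx.choose) (hx.charMap_surjective hX)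
    fun a b => hx.associated_of_charMap_eq hX
  exact ⟨⟨hx, hP, sP, this, r, θ, σ, c, h1, h2, h3, h4⟩, hr⟩

theorem height_fan {X : LogScheme.{u}} (hX : X.IsFs) (y : X.fan) :
    height X.fan y = (gpRank (X.fan.stalk y) : ℕ) := by
  obtain ⟨hN, sN⟩ := hX.associates y.1
  have := hN.cancel
  have := hN.fg
  exact monoidDim_eq_gpRank (N := Associates (X.M.stalk y.1)) sN

/-- Functions that are nowhere invertible on a stratum vanish on its reduced subscheme. -/
theorem vanishesOn_reducedSubscheme {Y : LogScheme.{u}} {F' : MonoidalSpace.{u}}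
    (ρ : MonoidalSpace.Hom Y.sharp F') (x' : F') {S : Scheme.{u}}
    (j : S ⟶ reducedSubscheme Y.X (ρ.toFun ⁻¹' {x'})) :
    StratumChart.VanishesOn ρ x' (j ≫ reducedSubschemeι Y.X (ρ.toFun ⁻¹' {x'})) := by
  intro V f hf
  have h : (reducedSubschemeι Y.X (ρ.toFun ⁻¹' {x'})).app V f = 0 :=
    eq_zero_of_not_isUnit fun t ht hu => by
      have h1 := Scheme.Hom.germ_stalkMap_apply (reducedSubschemeι Y.X (ρ.toFun ⁻¹' {x'})) V t ht f
      exact hf _ ht (reducedSubschemeι_mem t)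
        (isUnit_of_map_unit (Scheme.Hom.stalkMap _ t).hom _ (h1 ▸ hu))
  rw [Scheme.Hom.comp_app]
  exact (congrArg (j.app _) h).trans (map_zero _)

/-- The strata of the log blow-up of an fs log scheme along a subdivision are torus bundles over
the strata of the log scheme. -/
theorem IsLogBlowup.stratum_fiber {X : LogScheme.{u}} (hX : X.IsFs) {F' : MonoidalSpace.{u}}
    {φ : MonoidalSpace.Hom F' X.fan} (hφ : IsSubdivision φ) {Y : LogScheme.{u}} {b : Hom Y X}
    {ρ : MonoidalSpace.Hom Y.sharp F'} (hY : IsLogBlowup φ b ρ) (x' : F') (x : X.X)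
    (hx : X.IsCharPoint x (φ x')) :
    IsLocallyClosed (ρ.toFun ⁻¹' {x'}) ∧
    ∃ h' h : ℕ, height F' x' = h' ∧ height X.fan (φ x') = h ∧ h' ≤ h ∧
      Nonempty
        (Over.mk ((reducedSubschemeι Y.X (ρ.toFun ⁻¹' {x'}) ≫ b.base).fiberToSpecResidueField x) ≅
          splitTorus (X.X.residueField x) (h - h')) := by
  have hlc : IsLocallyClosed (ρ.toFun ⁻¹' {x'}) :=
    (hφ.isFsFan.isLocallyClosed_singleton x').preimage ρ.continuous
  obtain ⟨C, hr⟩ := exists_stratumChart hX hφ.isFsFan (hφ.gp_surjective x') hx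
  have hP := C.isFs
  have := hP.cancel
  have := hP.fg
  refine ⟨hlc, gpRank (F'.stalk x'), gpRank (X.fan.stalk (φ x')), monoidDim_eq_gpRank C.sharp,
    height_fan hX _, by omega, ?_⟩
  have hr' : gpRank (X.fan.stalk (φ x')) - gpRank (F'.stalk x') = C.r := by omega
  rw [hr']
  let ι := reducedSubschemeι Y.X (ρ.toFun ⁻¹' {x'})
  refine C.nonempty_iso_splitTorus hY (i := (ι ≫ b.base).fiberι x ≫ ι) ?_
    (fun t => reducedSubschemeι_mem ((ι ≫ b.base).fiberι x t))
    (vanishesOn_reducedSubscheme ρ x' _) ?_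
  · rw [Category.assoc, Scheme.Hom.fiber_fac]
  -- Reducedness of `G` gives the lift to the reduced stratum, and the fibre is a fibre product,
  -- which gives the rest.
  · intro G sG g _ hg hgz
    obtain ⟨l, hl⟩ := exists_lift_reducedSubscheme hlc g hgz
    have hl' : l ≫ ι ≫ b.base = sG ≫ X.X.fromSpecResidueField x := by
      rw [← hg, ← hl, Category.assoc]
    refine ⟨Limits.pullback.lift l sG hl', ?_, Limits.pullback.lift_snd _ _ _⟩
    rw [← hl]
    exact Limits.pullback.lift_fst_assoc _ _ hl' ι

end LogScheme
end LogGeom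

/-! ### The case of the divisorial log structure of the special fibre -/

theorem mainTheorem7 {R : Type u} [CommRing R] [IsDomain R] [IsDiscreteValuationRing R]
    {𝒳 : Scheme.{u}} (q : 𝒳 ⟶ Spec (CommRingCat.of R)) (hflat : Flat q)
    (hreg : (LogGeom.dagger q).IsLogRegular)
    {F' : LogGeom.MonoidalSpace.{u}}
    (φ : LogGeom.MonoidalSpace.Hom F' (LogGeom.dagger q).fan) (hφ : LogGeom.IsSubdivision φ)
    {Y : LogGeom.LogScheme.{u}} (b : LogGeom.LogScheme.Hom Y (LogGeom.dagger q))
    (ρ : LogGeom.MonoidalSpace.Hom Y.sharp F') (hY : LogGeom.LogScheme.IsLogBlowup φ b ρ)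
    (x' : F') (x : (LogGeom.dagger q).X) (hx : (LogGeom.dagger q).IsCharPoint x (φ x')) :
    IsLocallyClosed (ρ ⁻¹' {x'}) ∧
    ∃ h' h : ℕ, LogGeom.height F' x' = h' ∧
      LogGeom.height (LogGeom.dagger q).fan (φ x') = h ∧ h' ≤ h ∧
      Nonempty
        (Over.mk ((LogGeom.reducedSubschemeι Y.X (ρ ⁻¹' {x'}) ≫
            b.base).fiberToSpecResidueField x) ≅
          LogGeom.splitTorus ((LogGeom.dagger q).X.residueField x) (h - h')) :=
  hY.stratum_fiber hreg.isFs hφ x' x hx
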